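/- Let $Z=(X,A,Y)\sim P$ with $X\in\mathbb R^d$, $A\in\{0,1\}$, $Y\in\mathbb R$. For $S\subseteq\{1,\dots,d\}$ let $X_{-S}$ be $X$ without the coordinates in $S$ (so $X_{-\emptyset}=X$), and put $\pi_a(X_{-S})=P(A=a\mid X_{-S})$, $\mu_a(X_{-S})=E(Y\mid A=a,X_{-S})$, $\varphi_a(X_{-S})=\mu_a(X_{-S})-E\{\mu_a(X)\mid A=1-a,X_{-S}\}$ and $\|f(Z)\|_2^2=E\{f(Z)^2\}$. Assume positivity: for some $\delta>0$, $P\{\delta\le\pi_1(X)\le 1-\delta\}=1$. Let $a\in\{0,1\}$ and $S\subseteq\{1,\dots,d\}$. A smooth submodel through $P$ is a family of probability measures $(P_\epsilon)_{\epsilon\in\mathbb R}$ with $P_0=P$, dominated by a $\sigma$-finite measure $\nu$, with densities $p_\epsilon$ and a score $g\in L^2(P)$ such that $\int\{(\sqrt{p_\epsilon}-\sqrt{p_0})/\epsilon-\tfrac12 g\sqrt{p_0}\}^2d\nu\to0$ as $\epsilon\to0$. Given a class of smooth submodels, an influence function at $P$ of a functional $\psi$ is a mean-zero $f\in L^2(P)$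 with $\frac{d}{d\epsilon}\psi(P_\epsilon)|_{\epsilon=0}=E_P\{f(Z)g(Z)\}$ for every submodel in the class; it is efficient if it lies in the $L^2(P)$-closure of the linear span of the scores. A function $f$ is the un-centered efficient influence function of $\psi$ if $f-\psi(P)$ is an efficient influence function and is, up to $P$-null sets, the only influence function. For $f=f(P)$ the von Mises remainder is $R_2(\bar P,P)=\psi(\bar P)-\psi(P)-\int f(\bar P)\,d(\bar P-P)$. Bars denote quantities under $\bar P$, and $E$ is expectation under $P$. (1) In the nonparametric model (all smooth submodels), the un-centered efficient influence function of $\|\pi_a(X)\|_2^2$ is $$\xi_a(Z)=\pi_a(X)^2+2\pi_a(X)\{1(A=a)-\pi_a(X)\}.$$ For every probability measure $\bar P$ such that the law of $X$ under $P$ is absolutely continuous with respect to that under $\bar P$, its von Mises remainder is $R_2(\bar P,P)=-E[\{\bar\pi_a(X)-\pi_a(X)\}^2]$. (2) Suppose $E(Y^4)<\infty$. In the nonparametric model with all smooth submodels along which, for $\epsilon$ near $0$, positivity holds with a common constant and $E_{P_\epsilon}(Y^4)$ is bounded, the un-centered efficient influence function of $\|\varphi_a(X_{-S})\|_2^2$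 is $$\lambda_a(Z;S)=\varphi_a(X_{-S})^2+2\varphi_a(X_{-S})\Big(\tfrac{1(A=a)}{\pi_a(X_{-S})}\{Y-\mu_a(X_{-S})\}-\tfrac{1(A=a)}{\pi_a(X)}\{Y-\mu_a(X)\}\tfrac{\pi_{1-a}(X)}{\pi_{1-a}(X_{-S})}-\tfrac{1(A=1-a)}{\pi_{1-a}(X_{-S})}\big[\mu_a(X)-E\{\mu_a(X)\mid A=1-a,X_{-S}\}\big]\Big).$$ (3) Let $\bar P$ satisfy positivity, let the law of $X$ under $P$ be absolutely continuous with respect to that under $\bar P$, let $Y$ have a finite second moment under $P$ and $\bar P$, and let $\bar\mu_a(X)$, $\bar\mu_a(X_{-S})$ and $\bar E\{\bar\mu_a(X)\mid A=1-a,X_{-S}\}$ be in $L^2(P)$. Then the von Mises remainder of $\|\varphi_a(X_{-S})\|_2^2$ with influence function $\lambda_a$ is second order, namely $R_2(\bar P,P)=E[-\{\bar\varphi_a(X_{-S})-\varphi_a(X_{-S})\}^2+2f]$ with $$\begin{aligned}f=\bar\varphi_a(X_{-S})\Big(&\tfrac{\pi_a(X_{-S})-\bar\pi_a(X_{-S})}{\bar\pi_a(X_{-S})}\{\mu_a(X_{-S})-\bar\mu_a(X_{-S})\}-\tfrac{\pi_a(X)-\bar\pi_a(X)}{\bar\pi_a(X)}\{\mu_a(X)-\bar\mu_a(X)\}\tfrac{\bar\pi_{1-a}(X)}{\bar\pi_{1-a}(X_{-S})}\\&-\tfrac{\pi_{1-a}(X_{-S})-\bar\pi_{1-a}(X_{-S})}{\bar\pi_{1-a}(X_{-S})}\big[E\{\bar\mu_a(X)\mid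 A=1-a,X_{-S}\}-\bar E\{\bar\mu_a(X)\mid A=1-a,X_{-S}\}\big]\\&-\{\mu_a(X)-\bar\mu_a(X)\}\Big\{\tfrac{\bar\pi_{1-a}(X)}{\bar\pi_{1-a}(X_{-S})}-\tfrac{\pi_{1-a}(X)}{\pi_{1-a}(X_{-S})}\Big\}\Big).\end{aligned}$$ -/

import Mathlib

open MeasureTheory ProbabilityTheory Filter Topology
open scoped ENNReal NNReal

noncomputable section

/-! ### Efficient influence functions -/

/-- `Q` is a smooth (differentiable in quadratic mean) one-dimensional submodel through `P` with
score `g`: the `Q ε` are probability measures dominated by one `σ`-finite measure `ν`, with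
densities `p ε`, `Q 0 = P`, and `∫ ((√(p ε) - √(p 0)) / ε - g √(p 0) / 2)² dν → 0`. -/
structure IsSmoothSubmodel {Ω : Type*} [MeasurableSpace Ω] (P : Measure Ω) (Q : ℝ → Measure Ω)
    (g : Ω → ℝ) : Prop where
  isProb : ∀ ε, IsProbabilityMeasure (Q ε)
  base : Q 0 = P
  score_memLp : MemLp g 2 P
  qmd : ∃ (ν : Measure Ω) (p : ℝ → Ω → ℝ), SigmaFinite ν ∧ (∀ ε, Measurable (p ε)) ∧
    (∀ ε z, 0 ≤ p ε z) ∧ (∀ ε, Q ε = ν.withDensity fun z => ENNReal.ofReal (p ε z)) ∧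
    Tendsto (fun ε : ℝ => ∫ z, ((√(p ε z) - √(p 0 z)) / ε - g z * √(p 0 z) / 2) ^ 2 ∂ν)
      (𝓝[≠] 0) (𝓝 0)

/-- `f` is an influence function (gradient) at `P` of the functional `ψ`: it is a mean-zero
function of finite variance with `d/dε ψ(Q ε) = ∫ f g dP` at `ε = 0`, for every smooth submodel
`Q` through `P`, with score `g`, that lies in the class `R`. -/
structure IsInfluenceFunction {Ω : Type*} [MeasurableSpace Ω] (R : (ℝ → Measure Ω) → Prop)
    (ψ : Measure Ω → ℝ) (P : Measure Ω) (f : Ω → ℝ) : Prop where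
  memLp : MemLp f 2 P
  mean_zero : ∫ z, f z ∂P = 0
  pathwise : ∀ (Q : ℝ → Measure Ω) (g : Ω → ℝ), R Q → IsSmoothSubmodel P Q g →
    HasDerivAt (fun ε => ψ (Q ε)) (∫ z, f z * g z ∂P) 0

/-- The scores at `P` of the smooth submodels in the class `R`. -/
def scoreSet {Ω : Type*} [MeasurableSpace Ω] (R : (ℝ → Measure Ω) → Prop) (P : Measure Ω) :
    Set (Ω → ℝ) :=
  {g | ∃ Q : ℝ → Measure Ω, R Q ∧ IsSmoothSubmodel P Q g}

/-- The efficient influence function: an influence function in the tangent space, the closure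
in `L²(P)` of the linear span of the scores. -/
structure IsEfficientInfluenceFunction {Ω : Type*} [MeasurableSpace Ω]
    (R : (ℝ → Measure Ω) → Prop) (ψ : Measure Ω → ℝ) (P : Measure Ω) (f : Ω → ℝ) : Prop
    extends IsInfluenceFunction R ψ P f where
  mem_tangent : ∀ η : ℝ≥0∞, 0 < η →
    ∃ g ∈ Submodule.span ℝ (scoreSet R P), eLpNorm (f - g) 2 P < η

/-- `f` is the un-centered efficient influence function of `ψ` at `P`: `f - ψ(P)` is an efficient
influence function, and it is the only influence function up to `P`-null sets. -/
def IsUncenteredEIF {Ω : Type*} [MeasurableSpace Ω] (R : (ℝ → Measure Ω) → Prop)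
    (ψ : Measure Ω → ℝ) (P : Measure Ω) (f : Ω → ℝ) : Prop :=
  IsEfficientInfluenceFunction R ψ P (fun z => f z - ψ P) ∧
    ∀ h : Ω → ℝ, IsInfluenceFunction R ψ P h → h =ᵐ[P] fun z => f z - ψ P

/-- The remainder `R₂(P', P) = ψ(P') - ψ(P) - ∫ f(P') d(P' - P)` of the von Mises expansion of
`ψ` with (un-centered) influence function `f`. -/
def vonMisesRemainder {Ω : Type*} [MeasurableSpace Ω] (ψ : Measure Ω → ℝ)
    (f : Measure Ω → Ω → ℝ) (P' P : Measure Ω) : ℝ :=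
  ψ P' - ψ P - (∫ z, f P' z ∂P' - ∫ z, f P' z ∂P)

/-! ### Observations and nuisance functions -/

/-- An observation `Z = (X, A, Y)`: covariates in `ℝ^d`, binary exposure, real outcome. -/
abbrev Obs (d : ℕ) : Type := (Fin d → ℝ) × Fin 2 × ℝ

/-- The covariates `X_{-S}`, without those with index in `S`. -/
def covOmit {d : ℕ} (S : Finset (Fin d)) (z : Obs d) : {j : Fin d // j ∉ S} → ℝ :=
  fun j => z.1 j

/-- The `σ`-algebra generated by `X_{-S}`; for `S = ∅` it is the one generated by `X`. -/
@[reducible] def covSigma {d : ℕ} (S : Finset (Fin d)) : MeasurableSpace (Obs d) :=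
  MeasurableSpace.comap (covOmit S) inferInstance

/-- `1(A = a)`. -/
def expInd {d : ℕ} (a : Fin 2) (z : Obs d) : ℝ := if z.2.1 = a then 1 else 0

/-- The outcome `Y`. -/
def outcome {d : ℕ} (z : Obs d) : ℝ := z.2.2

/-- The propensity score `π_a(X_{-S}) = P(A = a ∣ X_{-S})`, as a random variable. -/
def propScore {d : ℕ} (P : Measure (Obs d)) (a : Fin 2) (S : Finset (Fin d)) : Obs d → ℝ :=
  condExp (covSigma S) P (expInd a)

/-- The regression `E(f ∣ A = a, X_{-S})`, as a random variable: conditional expectation given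
`X_{-S}` under the conditional law of `Z` given `A = a`. -/
def regr {d : ℕ} (P : Measure (Obs d)) (a : Fin 2) (S : Finset (Fin d)) (f : Obs d → ℝ) :
    Obs d → ℝ :=
  condExp (covSigma S) (cond P {z : Obs d | z.2.1 = a}) f

/-- The outcome regression `μ_a(X_{-S}) = E(Y ∣ A = a, X_{-S})`. -/
def outReg {d : ℕ} (P : Measure (Obs d)) (a : Fin 2) (S : Finset (Fin d)) : Obs d → ℝ :=
  regr P a S outcome

/-- `E{μ_a(X) ∣ A = 1 - a, X_{-S}}`. -/
def crossReg {d : ℕ} (P : Measure (Obs d)) (a : Fin 2) (S : Finset (Fin d)) : Obs d → ℝ :=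
  regr P (1 - a) S (outReg P a ∅)

/-- `φ_a(X_{-S}) = μ_a(X_{-S}) - E{μ_a(X) ∣ A = 1 - a, X_{-S}}`. -/
def outGap {d : ℕ} (P : Measure (Obs d)) (a : Fin 2) (S : Finset (Fin d)) (z : Obs d) : ℝ :=
  outReg P a S z - crossReg P a S z

/-- Positivity with constant `δ`: `P{δ ≤ π_1(X) ≤ 1 - δ} = 1`. -/
def PositivityWith {d : ℕ} (δ : ℝ) (P : Measure (Obs d)) : Prop :=
  ∀ᵐ z ∂P, δ ≤ propScore P 1 ∅ z ∧ propScore P 1 ∅ z ≤ 1 - δ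

/-- Positivity: `P{δ ≤ π_1(X) ≤ 1 - δ} = 1` for some `δ > 0`. -/
def Positivity {d : ℕ} (P : Measure (Obs d)) : Prop := ∃ δ : ℝ, 0 < δ ∧ PositivityWith δ P

/-! ### The two functionals and the proposed efficient influence functions -/

/-- `‖π_a(X)‖₂²`. -/
def propNormSq {d : ℕ} (a : Fin 2) (P : Measure (Obs d)) : ℝ :=
  ∫ z, propScore P a ∅ z ^ 2 ∂P

/-- `‖μ_a(X_{-S}) - E{μ_a(X) ∣ A = 1 - a, X_{-S}}‖₂²`. -/
def gapNormSq {d : ℕ} (a : Fin 2) (S : Finset (Fin d)) (P : Measure (Obs d)) : ℝ :=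
  ∫ z, outGap P a S z ^ 2 ∂P

/-- `ξ_a = π_a(X)² + 2 π_a(X) {1(A = a) - π_a(X)}`. -/
def xiEIF {d : ℕ} (a : Fin 2) (P : Measure (Obs d)) (z : Obs d) : ℝ :=
  propScore P a ∅ z ^ 2 + 2 * propScore P a ∅ z * (expInd a z - propScore P a ∅ z)

/-- `λ_a(Z; S)`. -/
def lambdaEIF {d : ℕ} (a : Fin 2) (S : Finset (Fin d)) (P : Measure (Obs d)) (z : Obs d) : ℝ :=
  outGap P a S z ^ 2
    + 2 * outGap P a S z *
      (expInd a z / propScore P a S z * (outcome z - outReg P a S z)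
        - expInd a z / propScore P a ∅ z * (outcome z - outReg P a ∅ z)
            * (propScore P (1 - a) ∅ z / propScore P (1 - a) S z)
        - expInd (1 - a) z / propScore P (1 - a) S z * (outReg P a ∅ z - crossReg P a S z))

/-- The class of submodels of the nonparametric model along which positivity and a bound on the
fourth moment of `Y` hold locally uniformly. -/
def LocallyRegular {d : ℕ} (Q : ℝ → Measure (Obs d)) : Prop :=
  ∃ (δ : ℝ) (C : ℝ≥0), 0 < δ ∧
    ∀ᶠ ε in 𝓝 (0 : ℝ), PositivityWith δ (Q ε) ∧ eLpNorm outcome 4 (Q ε) ≤ C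

/-- The products of errors between the nuisance functions of `P'` and `P` in the remainder of the
von Mises expansion of `gapNormSq a S`. -/
def errorProducts {d : ℕ} (a : Fin 2) (S : Finset (Fin d)) (P' P : Measure (Obs d))
    (z : Obs d) : ℝ :=
  outGap P' a S z *
    ((propScore P a S z - propScore P' a S z) / propScore P' a S z
        * (outReg P a S z - outReg P' a S z)
      - (propScore P a ∅ z - propScore P' a ∅ z) / propScore P' a ∅ z
        * (outReg P a ∅ z - outReg P' a ∅ z)
        * (propScore P' (1 - a) ∅ z / propScore P' (1 - a) S z)
      - (propScore P (1 - a) S z - propScore P' (1 - a) S z) / propScore P' (1 - a) S z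
        * (regr P (1 - a) S (outReg P' a ∅) z - crossReg P' a S z)
      - (outReg P a ∅ z - outReg P' a ∅ z)
        * (propScore P' (1 - a) ∅ z / propScore P' (1 - a) S z
            - propScore P (1 - a) ∅ z / propScore P (1 - a) S z))

end

noncomputable section

/-! ### Integral inequalities -/

section Integrals

variable {Ω : Type*} [MeasurableSpace Ω] {μ : Measure Ω}

/-! Two exact identities carry all the claims. If the nuisance functions of one law are put into the
proposed influence function and the result is integrated under another law, the outcome is the
functional at the second law plus an explicit integral of squares and products of nuisance errors
(`integral_propensity_expansion`, `integral_gap_expansion`). They use only the defining property of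
a regression `r` of `f` with weight `w`, namely `∫ w h f = ∫ w h r` for test functions `h` of the
covariates (`IsRegr`); `w = 1` gives propensity scores and `w = 1(A = a)` gives regressions within
an arm. Under `P'` itself the errors vanish, and under `P` they form the stated remainder, so the
von Mises formulas follow by subtraction.

For pathwise derivatives the same identity is read with the nuisance functions of `P` and the law `Q
ε`: `ψ(Q ε) - ψ(P)` is `∫ f dQ_ε - ∫ f dP` minus a remainder. Differentiability in quadratic mean
gives the derivative `∫ f g dP` of the first part (`IsSmoothSubmodel.tendsto_slope_integral`), and
the remainder has to be `o(ε)`. For the propensity functional it is a squared error of propensity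
scores, which is `O(ε²)`.

For the gap functional the regressions involve an unbounded `Y` with only four moments, so `Y` is
first clipped at `|ε|^(-1/2)`. Clipping acts on an event of probability `o(ε²)` under `P`, hence
also under `Q ε`, and changes the functional by the order of the root of that probability, which is
`o(ε)` (`PositivityWith.gapNormSq_sub_eq`, `exists_abs_gapNormSq_sub_le`). Clipped regressions move
by `o(|ε|)` in squared `L²` norm (`IsSmoothSubmodel.tendsto_regression_sub`). In the remainder, the
squares of regression errors are then `o(ε)`. A propensity error times the gap has `L²` norm
`O(|ε|^(1/2))`, by Cauchy-Schwarz with fourth moments, and it multiplies a regression error of norm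
`o(|ε|^(1/2))`. The integrand of the first part now varies with `ε`; the slope lemma allows this
when it is bounded in `L²` and converges in `L¹`.

Finally, every bounded mean-zero function is the score of a tilt `1 + ε g`, also within the
restricted class of submodels (`isSmoothSubmodel_tilt`, `mem_scoreSet_locallyRegular`). Such
functions are dense among mean-zero functions in `L²(P)`, so an influence function is efficient and
unique (`isUncenteredEIF_of_pathwise`). -/

lemma integral_abs_mul_le_sqrt {f g : Ω → ℝ} (hf : MemLp f 2 μ) (hg : MemLp g 2 μ) :
    ∫ z, |f z * g z| ∂μ ≤ √(∫ z, f z ^ 2 ∂μ) * √(∫ z, g z ^ 2 ∂μ) := by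
  have h := integral_mul_le_Lp_mul_Lq_of_nonneg (μ := μ) (f := fun z => |f z|)
    (g := fun z => |g z|) Real.HolderConjugate.two_two (ae_of_all _ fun z => abs_nonneg _)
    (ae_of_all _ fun z => abs_nonneg _) (by simpa using hf.norm) (by simpa using hg.norm)
  simp only [Real.rpow_two, sq_abs, ← Real.sqrt_eq_rpow] at h
  simpa only [abs_mul] using h

lemma abs_integral_mul_le_sqrt {f g : Ω → ℝ} (hf : MemLp f 2 μ) (hg : MemLp g 2 μ) :
    |∫ z, f z * g z ∂μ| ≤ √(∫ z, f z ^ 2 ∂μ) * √(∫ z, g z ^ 2 ∂μ) :=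
  (abs_integral_le_integral_abs).trans (integral_abs_mul_le_sqrt hf hg)

lemma integral_add_sq_le {f g : Ω → ℝ} (hf : MemLp f 2 μ) (hg : MemLp g 2 μ) :
    ∫ z, (f z + g z) ^ 2 ∂μ ≤ 2 * ∫ z, f z ^ 2 ∂μ + 2 * ∫ z, g z ^ 2 ∂μ := by
  rw [← integral_const_mul, ← integral_const_mul,
    ← integral_add (hf.integrable_sq.const_mul 2) (hg.integrable_sq.const_mul 2)]
  refine integral_mono (hf.add hg).integrable_sq
    ((hf.integrable_sq.const_mul 2).add (hg.integrable_sq.const_mul 2)) fun z => ?_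
  simp only
  nlinarith [sq_nonneg (f z - g z)]

lemma integral_sub_sq_le {f g : Ω → ℝ} (hf : MemLp f 2 μ) (hg : MemLp g 2 μ) :
    ∫ z, (f z - g z) ^ 2 ∂μ ≤ 2 * ∫ z, f z ^ 2 ∂μ + 2 * ∫ z, g z ^ 2 ∂μ := by
  simpa [sub_eq_add_neg] using integral_add_sq_le hf hg.neg

lemma integral_abs_le_sqrt [IsProbabilityMeasure μ] {f : Ω → ℝ} (hf : MemLp f 2 μ) :
    ∫ z, |f z| ∂μ ≤ √(∫ z, f z ^ 2 ∂μ) := by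
  simpa using integral_abs_mul_le_sqrt hf (memLp_const (μ := μ) (p := 2) (1 : ℝ))

lemma exists_bounded_integral_sub_sq_lt {g : Ω → ℝ} (hg : MemLp g 2 μ) {η : ℝ} (hη : 0 < η) :
    ∃ (b : Ω → ℝ) (N : ℝ), Measurable b ∧ 0 ≤ N ∧ (∀ z, |b z| ≤ N) ∧ MemLp b 2 μ ∧
      ∫ z, (g z - b z) ^ 2 ∂μ < η := by
  obtain ⟨φ, hφ, hφm⟩ := hg.exists_simpleFunc_eLpNorm_sub_lt (by norm_num)
    (ε := ENNReal.ofReal √η) (by simpa using hη)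
  obtain ⟨N, hN⟩ := φ.exists_forall_norm_le
  refine ⟨φ, max N 0, φ.measurable, le_max_right _ _, fun z => (hN z).trans (le_max_left _ _),
    hφm, ?_⟩
  have hm : MemLp (g - ⇑φ) 2 μ := hg.sub hφm
  rw [hm.eLpNorm_eq_integral_rpow_norm (by norm_num) (by norm_num),
    ENNReal.ofReal_lt_ofReal_iff (by positivity)] at hφ
  simp only [ENNReal.toReal_ofNat, Real.rpow_two, Pi.sub_apply, Real.norm_eq_abs, sq_abs,
    ← one_div, ← Real.sqrt_eq_rpow] at hφ
  exact (Real.sqrt_lt_sqrt_iff (integral_nonneg fun z => sq_nonneg _)).1 hφ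

end Integrals

/-! ### Smooth submodels -/

section Submodel

variable {Ω : Type*} [MeasurableSpace Ω] {ν : Measure Ω} {s : Ω → ℝ}

lemma integral_withDensity_sq (hs : Measurable s) (f : Ω → ℝ) :
    ∫ z, f z ∂(ν.withDensity fun z => ENNReal.ofReal (s z ^ 2)) = ∫ z, f z * s z ^ 2 ∂ν := by
  rw [integral_withDensity_eq_integral_toReal_smul (by fun_prop) (by simp)]
  refine integral_congr_ae (ae_of_all _ fun z => ?_)
  simp [ENNReal.toReal_ofReal (sq_nonneg _), mul_comm]

lemma integrable_withDensity_sq_iff (hs : Measurable s) (f : Ω → ℝ) :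
    Integrable f (ν.withDensity fun z => ENNReal.ofReal (s z ^ 2)) ↔
      Integrable (fun z => f z * s z ^ 2) ν := by
  rw [integrable_withDensity_iff (by fun_prop) (by simp)]
  simp [ENNReal.toReal_ofReal (sq_nonneg _)]

lemma memLp_mul_sqrtDensity (hs : Measurable s) {f : Ω → ℝ} (hf : Measurable f)
    (h : MemLp f 2 (ν.withDensity fun z => ENNReal.ofReal (s z ^ 2))) :
    MemLp (fun z => f z * s z) 2 ν := by
  refine (memLp_two_iff_integrable_sq (hf.mul hs).aestronglyMeasurable).2 ?_
  have := (integrable_withDensity_sq_iff hs _).1 h.integrable_sq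
  simpa [mul_pow] using this

lemma integral_mul_sqrtDensity_sq (hs : Measurable s) (f : Ω → ℝ) :
    ∫ z, (f z * s z) ^ 2 ∂ν
      = ∫ z, f z ^ 2 ∂(ν.withDensity fun z => ENNReal.ofReal (s z ^ 2)) := by
  rw [integral_withDensity_sq hs]; simp [mul_pow]

lemma IsSmoothSubmodel.exists_sqrtDensity {P : Measure Ω} {Q : ℝ → Measure Ω} {g : Ω → ℝ}
    (h : IsSmoothSubmodel P Q g) :
    ∃ (ν : Measure Ω) (s : ℝ → Ω → ℝ) (g' : Ω → ℝ), (∀ ε, Measurable (s ε)) ∧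
      (∀ ε, Q ε = ν.withDensity fun z => ENNReal.ofReal (s ε z ^ 2)) ∧ Measurable g' ∧
      g =ᵐ[P] g' ∧ MemLp g' 2 P ∧
      Tendsto (fun ε : ℝ => ∫ z, ((s ε z - s 0 z) / ε - g' z * s 0 z / 2) ^ 2 ∂ν)
        (𝓝[≠] 0) (𝓝 0) := by
  obtain ⟨ν, p, -, hpm, hp0, hQ, hlim⟩ := h.qmd
  have hg := h.score_memLp
  obtain rfl := h.base
  refine ⟨ν, fun ε z => √(p ε z), hg.1.mk g, fun ε => (hpm ε).sqrt, fun ε => ?_,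
    hg.1.stronglyMeasurable_mk.measurable, hg.1.ae_eq_mk, hg.ae_eq hg.1.ae_eq_mk, ?_⟩
  · rw [hQ ε]; simp [Real.sq_sqrt (hp0 _ _)]
  · refine hlim.congr fun ε => integral_congr_ae ?_
    -- The two versions of the score agree only `P`-almost everywhere, whereas the integral is over
    -- `ν`. Where they may differ off a `ν`-null set the density `p 0` vanishes, and there the score
    -- is multiplied by `√(p 0) = 0`.
    have h1 := hg.1.ae_eq_mk
    generalize hg.1.mk g = g' at h1
    rw [hQ 0, Filter.EventuallyEq, ae_withDensity_iff (by have := hpm 0; fun_prop)] at h1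
    filter_upwards [h1] with z hz
    by_cases h0 : p 0 z = 0
    · simp [h0]
    · rw [hz]
      simpa using lt_of_le_of_ne (hp0 0 z) (Ne.symm h0)

/-- Along a smooth submodel, expectations of functions of bounded variance are Lipschitz at `0`. -/
lemma IsSmoothSubmodel.exists_abs_integral_sub_le {P : Measure Ω} {Q : ℝ → Measure Ω}
    {g : Ω → ℝ} (h : IsSmoothSubmodel P Q g) :
    ∃ K : ℝ, 0 < K ∧ ∀ᶠ ε in 𝓝[≠] (0 : ℝ), ∀ f : Ω → ℝ, Measurable f → MemLp f 2 P →
      MemLp f 2 (Q ε) → |∫ z, f z ∂(Q ε) - ∫ z, f z ∂P| ≤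
        K * |ε| * (√(∫ z, f z ^ 2 ∂(Q ε)) + √(∫ z, f z ^ 2 ∂P)) := by
  obtain ⟨ν, s, g', hsm, hQ, hgm, -, hg, hlim⟩ := h.exists_sqrtDensity
  have hprob := h.isProb
  have hP : P = ν.withDensity fun z => ENNReal.ofReal (s 0 z ^ 2) := by rw [← hQ, h.base]
  have hs : ∀ ε, MemLp (s ε) 2 ν := fun ε => by
    have := memLp_mul_sqrtDensity (hsm ε) (f := fun _ => 1) measurable_const
      (by rw [← hQ]; exact memLp_const 1)
    simpa using this
  have hgs : MemLp (fun z => g' z * s 0 z) 2 ν :=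
    memLp_mul_sqrtDensity (hsm 0) hgm (by rwa [← hP])
  refine ⟨√(2 + ∫ z, g' z ^ 2 ∂P), Real.sqrt_pos.2 (by positivity), ?_⟩
  filter_upwards [hlim.eventually_le_const one_pos, self_mem_nhdsWithin] with ε hε hε0 f hfm hfP hfQ
  have hε0 : ε ≠ 0 := hε0
  have hd : MemLp (fun z => s ε z - s 0 z) 2 ν := (hs ε).sub (hs 0)
  have hD : MemLp (fun z => (s ε z - s 0 z) / ε - g' z * s 0 z / 2) 2 ν := by
    have := (hd.const_mul ε⁻¹).sub (hgs.const_mul 2⁻¹)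
    refine this.ae_eq (ae_of_all _ fun z => ?_)
    simp only [Pi.sub_apply]; ring
  -- The increment of the root density is `ε` times the error in the quadratic mean limit plus `ε /
  -- 2` times `g' s₀`. The error has squared norm at most `1` near `0`, which gives the constant `2
  -- + ∫ g'²`.
  have hd2 : √(∫ z, (s ε z - s 0 z) ^ 2 ∂ν) ≤ √(2 + ∫ z, g' z ^ 2 ∂P) * |ε| := by
    rw [← Real.sqrt_sq_eq_abs, ← Real.sqrt_mul (by positivity)]
    refine Real.sqrt_le_sqrt ?_
    have h1 := integral_add_sq_le (hD.const_mul ε) (hgs.const_mul (ε / 2))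
    simp only [mul_pow ε, mul_pow (ε / 2), integral_const_mul] at h1
    have h2 : ∀ z, (ε * ((s ε z - s 0 z) / ε - g' z * s 0 z / 2) + ε / 2 * (g' z * s 0 z))
        = s ε z - s 0 z := fun z => by field_simp; ring
    simp only [h2] at h1
    rw [integral_mul_sqrtDensity_sq (hsm 0), ← hP] at h1
    have h3 : 0 ≤ ∫ z, g' z ^ 2 ∂P := integral_nonneg fun z => sq_nonneg _
    have h4 : 0 ≤ ε ^ 2 := sq_nonneg _
    nlinarith [mul_le_mul_of_nonneg_left hε h4, mul_nonneg h4 h3]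
  have hfs : MemLp (fun z => f z * s ε z) 2 ν :=
    memLp_mul_sqrtDensity (hsm ε) hfm (by rwa [← hQ])
  have hf0 : MemLp (fun z => f z * s 0 z) 2 ν :=
    memLp_mul_sqrtDensity (hsm 0) hfm (by rwa [← hP])
  -- Factor `s_ε² - s₀² = (s_ε - s₀)(s_ε + s₀)`; each summand is then a product of two functions in
  -- `L²(ν)`.
  have e1 : ∫ z, f z ∂(Q ε) - ∫ z, f z ∂P = (∫ z, (s ε z - s 0 z) * (f z * s ε z) ∂ν)
      + ∫ z, (s ε z - s 0 z) * (f z * s 0 z) ∂ν := by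
    rw [hQ ε, hP, integral_withDensity_sq (hsm ε), integral_withDensity_sq (hsm 0),
      ← integral_sub, ← integral_add]
    · congr 1; ext z; ring
    · exact hd.integrable_mul hfs
    · exact hd.integrable_mul hf0
    · have := (hs ε).integrable_mul hfs
      refine this.congr (ae_of_all _ fun z => ?_)
      simp only [Pi.mul_apply]; ring
    · have := (hs 0).integrable_mul hf0
      refine this.congr (ae_of_all _ fun z => ?_)
      simp only [Pi.mul_apply]; ring
  rw [e1, mul_add]
  refine (abs_add_le _ _).trans (add_le_add ?_ ?_)
  · refine (abs_integral_mul_le_sqrt hd hfs).trans ?_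
    rw [integral_mul_sqrtDensity_sq (hsm ε), ← hQ]
    gcongr
  · refine (abs_integral_mul_le_sqrt hd hf0).trans ?_
    rw [integral_mul_sqrtDensity_sq (hsm 0), ← hP]
    gcongr

/-- Square-integrable families of functions, bounded uniformly in mean square near `ε = 0`. -/
def L2Bounded (P : Measure Ω) (Q : ℝ → Measure Ω) (f : ℝ → Ω → ℝ) : Prop :=
  ∃ C : ℝ, 0 ≤ C ∧ ∀ᶠ ε in 𝓝[≠] (0 : ℝ), Measurable (f ε) ∧ MemLp (f ε) 2 P ∧
    MemLp (f ε) 2 (Q ε) ∧ ∫ z, f ε z ^ 2 ∂P ≤ C ∧ ∫ z, f ε z ^ 2 ∂(Q ε) ≤ C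

set_option maxHeartbeats 800000 in
/-- The derivative of an expectation along a smooth submodel, with an integrand that may vary. -/
lemma IsSmoothSubmodel.tendsto_slope_integral {P : Measure Ω} {Q : ℝ → Measure Ω}
    {g : Ω → ℝ} (h : IsSmoothSubmodel P Q g) {f : ℝ → Ω → ℝ} {f₀ : Ω → ℝ}
    (hf : L2Bounded P Q f) (hf₀ : MemLp f₀ 2 P)
    (hlim : Tendsto (fun ε => ∫ z, |f ε z - f₀ z| ∂P) (𝓝[≠] 0) (𝓝 0)) :
    Tendsto (fun ε => (∫ z, f ε z ∂(Q ε) - ∫ z, f ε z ∂P) / ε) (𝓝[≠] 0)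
      (𝓝 (∫ z, f₀ z * g z ∂P)) := by
  obtain ⟨ν, s, g', hsm, hQ, hgm, hgg, hg, hDlim⟩ := h.exists_sqrtDensity
  obtain ⟨C, hC, hf⟩ := hf
  have hprob := h.isProb
  have : IsProbabilityMeasure P := h.base ▸ hprob 0
  have hP : P = ν.withDensity fun z => ENNReal.ofReal (s 0 z ^ 2) := by rw [← hQ, h.base]
  have hs : ∀ ε, MemLp (s ε) 2 ν := fun ε => by
    have := memLp_mul_sqrtDensity (hsm ε) (f := fun _ => 1) measurable_const
      (by rw [← hQ]; exact memLp_const 1)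
    simpa using this
  have hgs : MemLp (fun z => g' z * s 0 z) 2 ν :=
    memLp_mul_sqrtDensity (hsm 0) hgm (by rwa [← hP])
  have hd : ∀ ε, MemLp (fun z => s ε z - s 0 z) 2 ν := fun ε => (hs ε).sub (hs 0)
  have hD : ∀ ε, MemLp (fun z => (s ε z - s 0 z) / ε - g' z * s 0 z / 2) 2 ν := fun ε => by
    have := ((hd ε).const_mul ε⁻¹).sub (hgs.const_mul 2⁻¹)
    refine this.ae_eq (ae_of_all _ fun z => ?_)
    simp only [Pi.sub_apply]; ring
  have hdlim : Tendsto (fun ε => √(∫ z, (s ε z - s 0 z) ^ 2 ∂ν)) (𝓝[≠] 0) (𝓝 0) := by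
    have hb : Tendsto (fun ε : ℝ => √(2 * (ε ^ 2 * ∫ z, ((s ε z - s 0 z) / ε
        - g' z * s 0 z / 2) ^ 2 ∂ν) + 2 * ((ε / 2) ^ 2 * ∫ z, (g' z * s 0 z) ^ 2 ∂ν)))
        (𝓝[≠] 0) (𝓝 0) := by
      have hε : Tendsto (fun ε : ℝ => ε) (𝓝[≠] 0) (𝓝 0) := tendsto_nhdsWithin_of_tendsto_nhds
        tendsto_id
      have := ((((hε.pow 2).mul hDlim).const_mul 2).add
        ((((hε.div_const 2).pow 2).mul_const (∫ z, (g' z * s 0 z) ^ 2 ∂ν)).const_mul 2)).sqrt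
      simpa using this
    refine squeeze_zero' (Eventually.of_forall fun _ => Real.sqrt_nonneg _) ?_ hb
    filter_upwards [self_mem_nhdsWithin] with ε hε0
    have hε0 : ε ≠ 0 := hε0
    refine Real.sqrt_le_sqrt ?_
    have h1 := integral_add_sq_le ((hD ε).const_mul ε) (hgs.const_mul (ε / 2))
    simp only [mul_pow ε, mul_pow (ε / 2), integral_const_mul] at h1
    have h2 : ∀ z, (ε * ((s ε z - s 0 z) / ε - g' z * s 0 z / 2) + ε / 2 * (g' z * s 0 z))
        = s ε z - s 0 z := fun z => by field_simp; ring
    simpa only [h2] using h1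
  have hgg' : ∫ z, f₀ z * g z ∂P = ∫ z, f₀ z * g' z ∂P :=
    integral_congr_ae (by filter_upwards [hgg] with z hz; rw [hz])
  rw [hgg', Metric.tendsto_nhds]
  intro τ hτ
  set C₀ := ∫ z, f₀ z ^ 2 ∂P with hC₀
  have hC₀' : 0 ≤ C₀ := integral_nonneg fun z => sq_nonneg _
  -- Since `f ε - f₀` is small only in `L¹`, it cannot be paired with an unbounded score. The score
  -- is replaced by a bounded `b`; the two terms containing `g' - b` cost at most `√η * B` in total,
  -- and this is made smaller than `τ / 2`.
  set B := √C + √(2 * C + 2 * C₀) with hB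
  have hB0 : 0 ≤ B := by positivity
  obtain ⟨b, N, hbm, hN, hbN, hb, hbη⟩ := exists_bounded_integral_sub_sq_lt hg
    (η := (τ / (2 * (B + 1))) ^ 2) (by positivity)
  set η := ∫ z, (g' z - b z) ^ 2 ∂P with hη
  have hη1 : √η * B < τ / 2 := by
    have : √η ≤ τ / (2 * (B + 1)) := Real.sqrt_le_iff.2 ⟨by positivity, hbη.le⟩
    calc √η * B ≤ τ / (2 * (B + 1)) * B := by gcongr
      _ = τ / 2 * (B / (B + 1)) := by field_simp
      _ < τ / 2 * 1 := by
        gcongr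
        rw [div_lt_one (by positivity)]; linarith
      _ = τ / 2 := mul_one _
  have hrest : Tendsto (fun ε : ℝ => 2 * √(∫ z, ((s ε z - s 0 z) / ε
        - g' z * s 0 z / 2) ^ 2 ∂ν) * √C + N * √C * √(∫ z, (s ε z - s 0 z) ^ 2 ∂ν)
        + N * ∫ z, |f ε z - f₀ z| ∂P) (𝓝[≠] 0) (𝓝 0) := by
    have := (((hDlim.sqrt.const_mul 2).mul_const (√C)).add (hdlim.const_mul (N * √C))).add
      (hlim.const_mul N)
    simpa using this
  filter_upwards [hf, hrest.eventually_lt_const (half_pos hτ), self_mem_nhdsWithin]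
    with ε ⟨hfm, hfP, hfQ, hfPC, hfQC⟩ hεr hε0
  have hε0 : ε ≠ 0 := hε0
  have hfs : MemLp (fun z => f ε z * s ε z) 2 ν :=
    memLp_mul_sqrtDensity (hsm ε) hfm (by rwa [← hQ])
  have hf0 : MemLp (fun z => f ε z * s 0 z) 2 ν :=
    memLp_mul_sqrtDensity (hsm 0) hfm (by rwa [← hP])
  have hfd : MemLp (fun z => f ε z * (s ε z - s 0 z)) 2 ν := by
    exact (hfs.sub hf0).ae_eq (ae_of_all _ fun z => (mul_sub _ _ _).symm)
  have hsfs : √(∫ z, (f ε z * s ε z) ^ 2 ∂ν) ≤ √C := by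
    rw [integral_mul_sqrtDensity_sq (hsm ε), ← hQ]; exact Real.sqrt_le_sqrt hfQC
  have hsf0 : √(∫ z, (f ε z * s 0 z) ^ 2 ∂ν) ≤ √C := by
    rw [integral_mul_sqrtDensity_sq (hsm 0), ← hP]; exact Real.sqrt_le_sqrt hfPC
  have hsfd : √(∫ z, (f ε z * (s ε z - s 0 z)) ^ 2 ∂ν) ≤ 2 * √C := by
    have h1 := integral_sub_sq_le hfs hf0
    rw [integral_mul_sqrtDensity_sq (hsm ε), ← hQ, integral_mul_sqrtDensity_sq (hsm 0), ← hP] at h1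
    simp only [← mul_sub] at h1
    rw [Real.sqrt_le_iff]
    refine ⟨by positivity, h1.trans ?_⟩
    rw [mul_pow, Real.sq_sqrt hC]; linarith
  have hbs : MemLp (fun z => b z * s 0 z) 2 ν :=
    memLp_mul_sqrtDensity (hsm 0) hbm (by rwa [← hP])
  have hgb : MemLp (fun z => g' z - b z) 2 P := hg.sub hb
  have hgbs : MemLp (fun z => (g' z - b z) * s 0 z) 2 ν := by
    exact (hgs.sub hbs).ae_eq (ae_of_all _ fun z => (sub_mul _ _ _).symm)
  have hff : MemLp (fun z => f ε z - f₀ z) 2 P := hfP.sub hf₀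
  -- Write `(s_ε - s₀) / ε = D + g' s₀ / 2` and `s_ε + s₀ = 2 s₀ + (s_ε - s₀)`. The main term is `∫
  -- f_ε g' dP`; in every other term containing the score it is split as `(g' - b) + b`.
  have e1 : (∫ z, f ε z ∂(Q ε) - ∫ z, f ε z ∂P) / ε - ∫ z, f₀ z * g' z ∂P
      = (∫ z, ((s ε z - s 0 z) / ε - g' z * s 0 z / 2) * (f ε z * s ε z) ∂ν)
      + (∫ z, ((s ε z - s 0 z) / ε - g' z * s 0 z / 2) * (f ε z * s 0 z) ∂ν)
      + ((∫ z, ((g' z - b z) * s 0 z) * (f ε z * (s ε z - s 0 z)) ∂ν)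
        + ∫ z, (b z * s 0 z) * (f ε z * (s ε z - s 0 z)) ∂ν) / 2
      + ((∫ z, (f ε z - f₀ z) * (g' z - b z) ∂P) + ∫ z, (f ε z - f₀ z) * b z ∂P) := by
    have i1 : Integrable (fun z => ((s ε z - s 0 z) / ε - g' z * s 0 z / 2) * (f ε z * s ε z)) ν :=
      (hD ε).integrable_mul hfs
    have i2 : Integrable (fun z => ((s ε z - s 0 z) / ε - g' z * s 0 z / 2) * (f ε z * s 0 z)) ν :=
      (hD ε).integrable_mul hf0
    have i3 : Integrable (fun z => ((g' z - b z) * s 0 z) * (f ε z * (s ε z - s 0 z))) ν :=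
      hgbs.integrable_mul hfd
    have i4 : Integrable (fun z => (b z * s 0 z) * (f ε z * (s ε z - s 0 z))) ν :=
      hbs.integrable_mul hfd
    have i5 : Integrable (fun z => (f ε z - f₀ z) * (g' z - b z)) P := hff.integrable_mul hgb
    have i6 : Integrable (fun z => (f ε z - f₀ z) * b z) P := hff.integrable_mul hb
    have i7 : Integrable (fun z => f₀ z * g' z) P := hf₀.integrable_mul hg
    have i8 : Integrable (fun z => f ε z * g' z) P := hfP.integrable_mul hg
    have i9 : Integrable (fun z => (g' z * s 0 z) * (f ε z * s 0 z)) ν := hgs.integrable_mul hf0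
    have i10 : Integrable (fun z => s ε z * (f ε z * s ε z)) ν := (hs ε).integrable_mul hfs
    have i11 : Integrable (fun z => s 0 z * (f ε z * s 0 z)) ν := (hs 0).integrable_mul hf0
    have e2 : (∫ z, (f ε z - f₀ z) * (g' z - b z) ∂P) + ∫ z, (f ε z - f₀ z) * b z ∂P
        = (∫ z, (g' z * s 0 z) * (f ε z * s 0 z) ∂ν) - ∫ z, f₀ z * g' z ∂P := by
      have e3 : ∫ z, (g' z * s 0 z) * (f ε z * s 0 z) ∂ν = ∫ z, f ε z * g' z ∂P := by
        rw [hP, integral_withDensity_sq (hsm 0)]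
        congr 1; ext z; ring
      rw [e3, ← integral_add i5 i6, ← integral_sub i8 i7]
      congr 1; ext z; ring
    have e4 : (∫ z, f ε z ∂(Q ε)) = ∫ z, s ε z * (f ε z * s ε z) ∂ν := by
      rw [hQ ε, integral_withDensity_sq (hsm ε)]; congr 1; ext z; ring
    have e5 : (∫ z, f ε z ∂P) = ∫ z, s 0 z * (f ε z * s 0 z) ∂ν := by
      rw [hP, integral_withDensity_sq (hsm 0)]; congr 1; ext z; ring
    have j1 : Integrable (fun z => ((s ε z - s 0 z) / ε - g' z * s 0 z / 2) * (f ε z * s ε z)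
        + ((s ε z - s 0 z) / ε - g' z * s 0 z / 2) * (f ε z * s 0 z)) ν := i1.add i2
    have j2 : Integrable (fun z => (((g' z - b z) * s 0 z) * (f ε z * (s ε z - s 0 z))
        + (b z * s 0 z) * (f ε z * (s ε z - s 0 z))) / 2) ν := (i3.add i4).div_const 2
    have e6 := integral_add (j1.add j2) i9
    simp only [Pi.add_apply] at e6
    rw [e2, e4, e5, ← add_sub_assoc, ← integral_sub i10 i11, ← integral_add i1 i2,
      ← integral_add i3 i4, ← integral_div, ← integral_div, ← integral_add j1 j2, ← e6]
    congr 2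
    ext z
    field_simp
    ring
  have b1 := abs_integral_mul_le_sqrt (hD ε) hfs
  have b2 := abs_integral_mul_le_sqrt (hD ε) hf0
  have b3 := abs_integral_mul_le_sqrt hgbs hfd
  -- Boundedness of `b` allows `s₀` to be regrouped with `f_ε`, leaving the factor `s_ε - s₀`, whose
  -- norm tends to `0`.
  have b4 : |∫ z, (b z * s 0 z) * (f ε z * (s ε z - s 0 z)) ∂ν|
      ≤ N * (√(∫ z, (f ε z * s 0 z) ^ 2 ∂ν) * √(∫ z, (s ε z - s 0 z) ^ 2 ∂ν)) := by
    refine abs_integral_le_integral_abs.trans ?_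
    refine le_trans ?_ (mul_le_mul_of_nonneg_left (integral_abs_mul_le_sqrt hf0 (hd ε)) hN)
    rw [← integral_const_mul]
    refine integral_mono (hbs.integrable_mul hfd).norm
      ((hf0.integrable_mul (hd ε)).norm.const_mul N) fun z => ?_
    have : (b z * s 0 z) * (f ε z * (s ε z - s 0 z))
        = b z * (f ε z * s 0 z * (s ε z - s 0 z)) := by ring
    simp only [this, abs_mul (b z)]
    exact mul_le_mul_of_nonneg_right (hbN z) (abs_nonneg _)
  have b5 := abs_integral_mul_le_sqrt hff hgb
  have b6 : |∫ z, (f ε z - f₀ z) * b z ∂P| ≤ N * ∫ z, |f ε z - f₀ z| ∂P := by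
    refine abs_integral_le_integral_abs.trans ?_
    rw [← integral_const_mul]
    refine integral_mono (hff.integrable_mul hb).norm
      ((hff.integrable (by norm_num)).norm.const_mul N) fun z => ?_
    rw [abs_mul, mul_comm]
    exact mul_le_mul_of_nonneg_right (hbN z) (abs_nonneg _)
  have hsff : √(∫ z, (f ε z - f₀ z) ^ 2 ∂P) ≤ √(2 * C + 2 * C₀) :=
    Real.sqrt_le_sqrt ((integral_sub_sq_le hfP hf₀).trans (by linarith))
  have hη2 : √(∫ z, ((g' z - b z) * s 0 z) ^ 2 ∂ν) = √η := by
    rw [integral_mul_sqrtDensity_sq (hsm 0), ← hP]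
  rw [hη2] at b3
  rw [Real.dist_eq, e1]
  set D := √(∫ z, ((s ε z - s 0 z) / ε - g' z * s 0 z / 2) ^ 2 ∂ν)
  have hD0 : 0 ≤ D := Real.sqrt_nonneg _
  have c1 := b1.trans (mul_le_mul_of_nonneg_left hsfs hD0)
  have c2 := b2.trans (mul_le_mul_of_nonneg_left hsf0 hD0)
  have c3 := b3.trans (mul_le_mul_of_nonneg_left hsfd (Real.sqrt_nonneg _))
  have c4 := b4.trans (mul_le_mul_of_nonneg_left
    (mul_le_mul_of_nonneg_right hsf0 (Real.sqrt_nonneg _)) hN)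
  have c5 := b5.trans (mul_le_mul_of_nonneg_right hsff (Real.sqrt_nonneg _))
  rw [hB] at hη1
  have c7 : 0 ≤ N * (√C * √(∫ z, (s ε z - s 0 z) ^ 2 ∂ν)) := by positivity
  rw [abs_le] at c1 c2 c3 c4 c5 b6
  rw [abs_lt]
  constructor <;> linarith [c1.1, c1.2, c2.1, c2.2, c3.1, c3.2, c4.1, c4.2, c5.1, c5.2]

end Submodel

/-! ### Consequences for scores, rare events and fourth moments -/

section Submodel

variable {Ω : Type*} [MeasurableSpace Ω] {P : Measure Ω} {Q : ℝ → Measure Ω} {g : Ω → ℝ}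

lemma IsSmoothSubmodel.isProbabilityMeasure (h : IsSmoothSubmodel P Q g) :
    IsProbabilityMeasure P := h.base ▸ h.isProb 0

lemma L2Bounded.of_abs_le [∀ ε, IsProbabilityMeasure (Q ε)] [IsProbabilityMeasure P]
    {f : ℝ → Ω → ℝ} {C : ℝ} (hfm : ∀ ε, Measurable (f ε)) (hC : ∀ ε z, |f ε z| ≤ C) :
    L2Bounded P Q f := by
  have hC' : ∀ ε z, f ε z ^ 2 ≤ C ^ 2 := fun ε z => sq_le_sq.2 ((hC ε z).trans (le_abs_self C))
  have h : ∀ (ρ : Measure Ω) [IsProbabilityMeasure ρ] ε, MemLp (f ε) 2 ρ := fun ρ _ ε =>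
    MemLp.of_bound (hfm ε).aestronglyMeasurable C (ae_of_all _ (hC ε))
  have h2 : ∀ (ρ : Measure Ω) [IsProbabilityMeasure ρ] ε, ∫ z, f ε z ^ 2 ∂ρ ≤ C ^ 2 := fun ρ _ ε => by
    simpa using integral_mono (h ρ ε).integrable_sq (integrable_const (C ^ 2)) (hC' ε)
  exact ⟨C ^ 2, sq_nonneg _, Eventually.of_forall fun ε => ⟨hfm ε, h _ ε, h _ ε, h2 _ ε, h2 _ ε⟩⟩

/-- Scores have mean zero. -/
lemma IsSmoothSubmodel.integral_score (h : IsSmoothSubmodel P Q g) : ∫ z, g z ∂P = 0 := by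
  have := h.isProbabilityMeasure
  have := h.isProb
  have h1 := h.tendsto_slope_integral (f := fun _ _ => 1) (f₀ := fun _ => 1)
    (L2Bounded.of_abs_le (C := 1) (fun _ => measurable_const) (by simp)) (memLp_const 1) (by simp)
  simpa using tendsto_nhds_unique h1 (by simp)

/-- An event of probability `o(ε²)` under `P` has probability `o(ε²)` along a submodel. -/
lemma IsSmoothSubmodel.tendsto_measureReal_div_sq (h : IsSmoothSubmodel P Q g) {B : ℝ → Set Ω}
    (hB : ∀ ε, MeasurableSet (B ε))
    (hlim : Tendsto (fun ε => P.real (B ε) / ε ^ 2) (𝓝[≠] 0) (𝓝 0)) :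
    Tendsto (fun ε => (Q ε).real (B ε) / ε ^ 2) (𝓝[≠] 0) (𝓝 0) := by
  have := h.isProbabilityMeasure
  have := h.isProb
  obtain ⟨K, hK, hH⟩ := h.exists_abs_integral_sub_le
  -- The slope of `∫ ε⁻¹ 1_B` is `(Q_ε(B) - P(B)) / ε²`. These functions have second moment `P(B) /
  -- ε²` and `L¹` norm `|ε| P(B) / ε²`, so the slope lemma applies with limit function `0`.
  set f : ℝ → Ω → ℝ := fun ε => (B ε).indicator fun _ => ε⁻¹ with hf
  have hfm : ∀ ε, Measurable (f ε) := fun ε => measurable_const.indicator (hB ε)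
  have hint : ∀ (ρ : Measure Ω) (ε c : ℝ), ∫ z, (B ε).indicator (fun _ => c) z ∂ρ
      = ρ.real (B ε) * c := fun ρ ε c => by
    rw [integral_indicator_const _ (hB ε), smul_eq_mul]
  have hsq : ∀ (ρ : Measure Ω) (ε c : ℝ), ∫ z, (B ε).indicator (fun _ => c) z ^ 2 ∂ρ
      = ρ.real (B ε) * c ^ 2 := fun ρ ε c => by
    rw [← hint]; congr 1; ext z; by_cases hz : z ∈ B ε <;> simp [hz]
  have hmem : ∀ (ρ : Measure Ω) [IsProbabilityMeasure ρ] (ε c : ℝ),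
      MemLp ((B ε).indicator fun _ => c) 2 ρ := fun ρ _ ε c =>
    (memLp_const c).indicator (hB ε)
  have hbdd : L2Bounded P Q f := by
    -- With `x = Q_ε(B)`, `y = P(B)` and `√y ≤ |ε|`, the Lipschitz bound reads `x ≤ y + K|ε|(√x +
    -- √y)`. Absorbing `K|ε|√x ≤ (x + K²ε²) / 2` gives `x ≤ (2 + 2K + K²) ε²`.
    refine ⟨2 + 2 * K + K ^ 2, by positivity, ?_⟩
    filter_upwards [hH, hlim.eventually_le_const one_pos, self_mem_nhdsWithin] with ε hε hPε hε0
    have hε0 : ε ≠ 0 := hε0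
    refine ⟨hfm ε, hmem _ _ _, hmem _ _ _, ?_, ?_⟩
    · rw [hsq, inv_pow, ← div_eq_mul_inv]; nlinarith
    · have h1 := hε _ (measurable_const.indicator (hB ε)) (hmem P ε 1) (hmem (Q ε) ε 1)
      rw [hsq, hsq, hint, hint, one_pow, mul_one, mul_one] at h1
      rw [hsq, inv_pow, ← div_eq_mul_inv]
      set x := (Q ε).real (B ε) with hx
      set y := P.real (B ε) with hy
      have hx0 : 0 ≤ x := measureReal_nonneg
      have hy0 : 0 ≤ y := measureReal_nonneg
      rw [div_le_one (by positivity)] at hPε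
      rw [div_le_iff₀ (by positivity)]
      have hsy : √y ≤ |ε| := by rw [← Real.sqrt_sq_eq_abs]; exact Real.sqrt_le_sqrt hPε
      have hsx := Real.sq_sqrt hx0
      have h2 := (abs_le.1 h1).2
      have h3 : K * |ε| * √y ≤ K * |ε| * |ε| := by gcongr
      have h4 : |ε| * |ε| = ε ^ 2 := by rw [← sq, sq_abs]
      nlinarith [sq_nonneg (√x - K * |ε|), sq_nonneg K]
  have hL1 : Tendsto (fun ε => ∫ z, |f ε z - (fun _ => (0 : ℝ)) z| ∂P) (𝓝[≠] 0) (𝓝 0) := by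
    have hε : Tendsto (fun ε : ℝ => |ε|) (𝓝[≠] 0) (𝓝 0) := by
      simpa using (tendsto_nhdsWithin_of_tendsto_nhds (continuous_abs.tendsto (0 : ℝ)))
    refine (by simpa using hε.mul hlim : Tendsto (fun ε => |ε| * (P.real (B ε) / ε ^ 2)) (𝓝[≠] 0) (𝓝 0)).congr' ?_
    filter_upwards [self_mem_nhdsWithin] with ε hε0
    have hε0 : ε ≠ 0 := hε0
    have : ∀ z, |f ε z - 0| = (B ε).indicator (fun _ => |ε|⁻¹) z := fun z => by
      by_cases hz : z ∈ B ε <;> simp [hf, hz, abs_inv]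
    simp only [this, hint]
    have : |ε| ≠ 0 := abs_ne_zero.2 hε0
    rw [← sq_abs]; field_simp
  have h1 := h.tendsto_slope_integral hbdd (memLp_const (0 : ℝ)) hL1
  simp only [zero_mul, integral_zero] at h1
  have h2 := h1.add hlim
  rw [add_zero] at h2
  refine h2.congr' ?_
  filter_upwards [self_mem_nhdsWithin] with ε hε0
  have hε0 : ε ≠ 0 := hε0
  simp only [hf, hint]
  field_simp
  ring

/-- Fourth moments of functions bounded by `|ε|^(-1/2)` are comparable along a submodel. -/
lemma IsSmoothSubmodel.exists_integral_pow_four_le (h : IsSmoothSubmodel P Q g) {C : ℝ}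
    (hC : 0 ≤ C) :
    ∃ C' : ℝ, 0 ≤ C' ∧ ∀ᶠ ε in 𝓝[≠] (0 : ℝ), ∀ f : Ω → ℝ, Measurable f →
      (∀ z, f z ^ 2 * |ε| ≤ 1) →
      (∫ z, f z ^ 4 ∂P ≤ C → ∫ z, f z ^ 4 ∂(Q ε) ≤ C') ∧
      (∫ z, f z ^ 4 ∂(Q ε) ≤ C → ∫ z, f z ^ 4 ∂P ≤ C') := by
  have := h.isProbabilityMeasure
  have := h.isProb
  obtain ⟨K, hK, hH⟩ := h.exists_abs_integral_sub_le
  refine ⟨2 * C + 2 * K * √C + K ^ 2, by positivity, ?_⟩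
  filter_upwards [hH, self_mem_nhdsWithin] with ε hε hε0 f hfm hfε
  have hε0 : ε ≠ 0 := hε0
  have hpos : 0 < |ε| := abs_pos.2 hε0
  have hf4 : ∀ z, |f z ^ 4| ≤ (|ε|⁻¹) ^ 2 := fun z => by
    have h1 : f z ^ 2 ≤ |ε|⁻¹ := by rw [← one_div, le_div_iff₀ hpos]; exact hfε z
    have : |f z ^ 4| = (f z ^ 2) ^ 2 := by rw [abs_of_nonneg (by positivity)]; ring
    rw [this]; gcongr
  have hm : ∀ (ρ : Measure Ω) [IsProbabilityMeasure ρ] (p : ℝ≥0∞), MemLp (fun z => f z ^ 4) p ρ :=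
    fun ρ _ p => MemLp.of_bound (hfm.pow_const 4).aestronglyMeasurable _ (ae_of_all _ hf4)
  -- From `f⁴ ≤ |ε|⁻²` the eighth moment is at most `|ε|⁻²` times the fourth. The resulting factor
  -- `|ε|⁻¹` exactly cancels the `|ε|` of the Lipschitz bound, which leaves a quadratic inequality
  -- between the roots of the two fourth moments.
  have h8 : ∀ (ρ : Measure Ω) [IsProbabilityMeasure ρ], √(∫ z, (f z ^ 4) ^ 2 ∂ρ)
      ≤ |ε|⁻¹ * √(∫ z, f z ^ 4 ∂ρ) := fun ρ _ => by
    rw [Real.sqrt_le_left (by positivity), mul_pow,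
      Real.sq_sqrt (integral_nonneg fun z => by positivity), ← integral_const_mul]
    refine integral_mono (hm ρ 2).integrable_sq (((hm ρ 1).integrable le_rfl).const_mul _) fun z => ?_
    have h1 : 0 ≤ f z ^ 4 := by positivity
    have h2 := (le_abs_self _).trans (hf4 z)
    simp only
    nlinarith
  have h1 := hε _ (hfm.pow_const 4) (hm P 2) (hm (Q ε) 2)
  set x := ∫ z, f z ^ 4 ∂(Q ε)
  set y := ∫ z, f z ^ 4 ∂P
  have hx0 : 0 ≤ x := integral_nonneg fun z => by positivity
  have hy0 : 0 ≤ y := integral_nonneg fun z => by positivity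
  have h2 : |x - y| ≤ K * (√x + √y) := by
    refine h1.trans ?_
    calc K * |ε| * (√(∫ z, (f z ^ 4) ^ 2 ∂(Q ε)) + √(∫ z, (f z ^ 4) ^ 2 ∂P))
        ≤ K * |ε| * (|ε|⁻¹ * √x + |ε|⁻¹ * √y) := by
          gcongr
          · exact h8 _
          · exact h8 _
      _ = K * (√x + √y) := by field_simp
  have key : ∀ u v : ℝ, 0 ≤ u → 0 ≤ v → v ≤ C → u - v ≤ K * (√u + √v) →
      u ≤ 2 * C + 2 * K * √C + K ^ 2 := fun u v hu hv hvC huv => by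
    have h3 : √v ≤ √C := Real.sqrt_le_sqrt hvC
    have h4 := Real.sq_sqrt hu
    nlinarith [sq_nonneg (√u - K), mul_le_mul_of_nonneg_left h3 hK.le]
  refine ⟨fun hyC => key x y hx0 hy0 hyC (abs_le.1 h2).2, fun hxC => key y x hy0 hx0 hxC ?_⟩
  linarith [(abs_le.1 h2).1]

end Submodel

/-! ### The nonparametric tangent space -/

section Tangent

variable {Ω : Type*} [MeasurableSpace Ω] {P : Measure Ω} {g : Ω → ℝ} {N : ℝ}

/-- The density `1 + ε g`, for `ε` with `|ε| N ≤ 1 / 2`. -/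
def tiltDensity {α : Type*} (g : α → ℝ) (N ε : ℝ) (z : α) : ℝ := if |ε| * N ≤ 1 / 2 then 1 + ε * g z else 1

/-- The submodel with density `1 + ε g`. -/
def tilt (P : Measure Ω) (g : Ω → ℝ) (N ε : ℝ) : Measure Ω :=
  P.withDensity fun z => ENNReal.ofReal (tiltDensity g N ε z)

lemma tiltDensity_bounds {α : Type*} {g : α → ℝ} (hN : ∀ z, |g z| ≤ N) (ε : ℝ) (z : α) :
    1 / 2 ≤ tiltDensity g N ε z ∧ tiltDensity g N ε z ≤ 3 / 2 := by
  unfold tiltDensity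
  split_ifs with h
  · have h1 : |ε * g z| ≤ 1 / 2 := by
      rw [abs_mul]; exact (mul_le_mul_of_nonneg_left (hN z) (abs_nonneg _)).trans h
    rw [abs_le] at h1
    constructor <;> linarith [h1.1, h1.2]
  · norm_num

lemma measurable_tiltDensity (hg : Measurable g) (ε : ℝ) : Measurable (tiltDensity g N ε) := by
  unfold tiltDensity; split_ifs <;> fun_prop

lemma abs_sqrt_one_add_sub_le {x : ℝ} (hx : |x| ≤ 1 / 2) : |√(1 + x) - 1 - x / 2| ≤ x ^ 2 / 2 := by
  have h := abs_le.1 hx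
  have h1 : √(1 + x) ≤ 1 + x / 2 := by
    rw [Real.sqrt_le_left (by linarith [h.1])]; nlinarith [sq_nonneg x]
  have h2 : 1 + x / 2 - x ^ 2 / 2 ≤ √(1 + x) := by
    refine Real.le_sqrt_of_sq_le ?_
    nlinarith [mul_nonneg (sq_nonneg x) (by linarith [h.1] : (0 : ℝ) ≤ 1 / 2 + x),
      mul_nonneg (sq_nonneg x) (by nlinarith [h.1, h.2] : (0 : ℝ) ≤ 1 / 4 - x ^ 2)]
  rw [abs_le]
  constructor <;> nlinarith [sq_nonneg x]

/-- Take `ν = P` and expand `√(1 + x) = 1 + x / 2 + O(x²)`. Because `g` is bounded, the error is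
uniform in `z`, and after division by `ε` it is at most `|ε| N² / 2`. -/
lemma isSmoothSubmodel_tilt [IsProbabilityMeasure P] (hg : Measurable g) (hN : ∀ z, |g z| ≤ N)
    (h0 : ∫ z, g z ∂P = 0) : IsSmoothSubmodel P (tilt P g N) g := by
  have hgi : MemLp g 2 P := MemLp.of_bound hg.aestronglyMeasurable N (ae_of_all _ hN)
  have hgi1 : Integrable g P := hgi.integrable (by norm_num)
  have hp0 : ∀ ε z, 0 ≤ tiltDensity g N ε z := fun ε z => by
    linarith [(tiltDensity_bounds hN ε z).1]
  refine ⟨fun ε => ⟨?_⟩, ?_, hgi, P, tiltDensity g N, inferInstance, measurable_tiltDensity hg,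
    hp0, fun ε => rfl, ?_⟩
  · have hi : Integrable (tiltDensity g N ε) P := by
      unfold tiltDensity; split_ifs
      · exact (integrable_const 1).add (hgi1.const_mul ε)
      · exact integrable_const 1
    rw [tilt, withDensity_apply _ MeasurableSet.univ, Measure.restrict_univ,
      ← ofReal_integral_eq_lintegral_ofReal hi (ae_of_all _ (hp0 ε))]
    unfold tiltDensity
    split_ifs
    · rw [integral_add (integrable_const 1) (hgi1.const_mul ε), integral_const_mul, h0]; simp
    · simp
  · simp [tilt, tiltDensity]
  · have hsmall : ∀ᶠ ε in 𝓝[≠] (0 : ℝ), |ε| * N ≤ 1 / 2 := by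
      have : Tendsto (fun ε : ℝ => |ε| * N) (𝓝[≠] 0) (𝓝 0) := by
        have : Continuous fun ε : ℝ => |ε| * N := by fun_prop
        simpa using tendsto_nhdsWithin_of_tendsto_nhds (this.tendsto 0)
      exact this.eventually_le_const (by norm_num)
    have hlim : Tendsto (fun ε : ℝ => (ε * N ^ 2 / 2) ^ 2) (𝓝[≠] 0) (𝓝 0) := by
      have : Continuous fun ε : ℝ => (ε * N ^ 2 / 2) ^ 2 := by fun_prop
      simpa using tendsto_nhdsWithin_of_tendsto_nhds (this.tendsto 0)
    refine squeeze_zero' (Eventually.of_forall fun ε => integral_nonneg fun z => sq_nonneg _) ?_ hlim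
    filter_upwards [hsmall, self_mem_nhdsWithin] with ε hε hε0
    have hε0 : ε ≠ 0 := hε0
    have hb : ∀ z, ((√(tiltDensity g N ε z) - √(tiltDensity g N 0 z)) / ε
        - g z * √(tiltDensity g N 0 z) / 2) ^ 2 ≤ (ε * N ^ 2 / 2) ^ 2 := fun z => by
      have h00 : tiltDensity g N 0 z = 1 := by simp [tiltDensity]
      have h01 : tiltDensity g N ε z = 1 + ε * g z := by simp only [tiltDensity, if_pos hε]
      have hx : |ε * g z| ≤ 1 / 2 := by
        rw [abs_mul]; exact (mul_le_mul_of_nonneg_left (hN z) (abs_nonneg _)).trans hε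
      have h1 := abs_sqrt_one_add_sub_le hx
      rw [h00, h01, Real.sqrt_one]
      have h2 : (√(1 + ε * g z) - 1) / ε - g z * 1 / 2
          = (√(1 + ε * g z) - 1 - ε * g z / 2) / ε := by field_simp
      rw [h2, div_pow, div_le_iff₀ (by positivity), ← mul_pow]
      rw [← sq_abs]
      have h3 : (ε * g z) ^ 2 / 2 ≤ |ε * N ^ 2 / 2 * ε| := by
        refine le_trans ?_ (le_abs_self _)
        have : g z ^ 2 ≤ N ^ 2 := sq_le_sq.2 ((hN z).trans (le_abs_self N))
        nlinarith [mul_le_mul_of_nonneg_left this (sq_nonneg ε)]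
      calc |√(1 + ε * g z) - 1 - ε * g z / 2| ^ 2 ≤ |ε * N ^ 2 / 2 * ε| ^ 2 := by
            exact pow_le_pow_left₀ (abs_nonneg _) (h1.trans h3) 2
        _ = _ := sq_abs _
    calc _ ≤ ∫ _, (ε * N ^ 2 / 2) ^ 2 ∂P :=
          integral_mono_of_nonneg (ae_of_all _ fun z => sq_nonneg _) (integrable_const _)
            (ae_of_all _ hb)
      _ = _ := by simp

/-- If every bounded function of mean zero is a score, then a pathwise derivative of finite
variance is the efficient influence function. -/
lemma isUncenteredEIF_of_pathwise [IsProbabilityMeasure P] {R : (ℝ → Measure Ω) → Prop}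
    {ψ : Measure Ω → ℝ} {f : Ω → ℝ}
    (hR : ∀ (b : Ω → ℝ) (N : ℝ), Measurable b → (∀ z, |b z| ≤ N) → ∫ z, b z ∂P = 0 →
      b ∈ scoreSet R P)
    (hf : MemLp f 2 P) (hmean : ∫ z, f z ∂P = ψ P)
    (hpath : ∀ (Q : ℝ → Measure Ω) (g : Ω → ℝ), R Q → IsSmoothSubmodel P Q g →
      HasDerivAt (fun ε => ψ (Q ε)) (∫ z, f z * g z ∂P) 0) :
    IsUncenteredEIF R ψ P f := by
  have hF : MemLp (fun z => f z - ψ P) 2 P := hf.sub (memLp_const _)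
  have hF0 : ∫ z, f z - ψ P ∂P = 0 := by
    rw [integral_sub (hf.integrable (by norm_num)) (integrable_const _), hmean]; simp
  have hinf : IsInfluenceFunction R ψ P (fun z => f z - ψ P) := by
    refine ⟨hF, hF0, fun Q g hQ hg => ?_⟩
    have h1 : ∫ z, (f z - ψ P) * g z ∂P = ∫ z, f z * g z ∂P := by
      have i1 : Integrable (fun z => f z * g z) P := hf.integrable_mul hg.score_memLp
      simp only [sub_mul]
      rw [integral_sub i1
        ((hg.score_memLp.integrable (by norm_num)).const_mul _), integral_const_mul,
        hg.integral_score, mul_zero, sub_zero]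
    rw [h1]
    exact hpath Q g hQ hg
  -- A bounded approximation of `F` must be centred to become a score. As `∫ F = 0`, the squared
  -- mean of `b` is at most `∫ (F - b)²`, so centring costs no more than the approximation itself;
  -- hence the choice `η / 4`.
  have happrox : ∀ F : Ω → ℝ, MemLp F 2 P → ∫ z, F z ∂P = 0 → ∀ η : ℝ, 0 < η →
      ∃ b ∈ scoreSet R P, MemLp b 2 P ∧ ∫ z, (F z - b z) ^ 2 ∂P < η := fun F hF hF0 η hη => by
    obtain ⟨b, N, hbm, hN, hbN, hb, hbη⟩ := exists_bounded_integral_sub_sq_lt hF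
      (η := η / 4) (by positivity)
    have hbi : Integrable b P := hb.integrable (by norm_num)
    have hd : MemLp (fun z => F z - b z) 2 P := hF.sub hb
    have hm : MemLp (fun z => b z - ∫ w, b w ∂P) 2 P := hb.sub (memLp_const _)
    refine ⟨fun z => b z - ∫ w, b w ∂P, hR _ (N + |∫ w, b w ∂P|) (hbm.sub measurable_const)
      (fun z => (abs_sub _ _).trans (by gcongr; exact hbN z)) ?_, hm, ?_⟩
    · rw [integral_sub hbi (integrable_const _)]; simp
    · have h1 := integral_add_sq_le hd (memLp_const (∫ w, b w ∂P))
      have h2 : |∫ z, (F z - b z) ∂P| ≤ √(∫ z, (F z - b z) ^ 2 ∂P) :=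
        abs_integral_le_integral_abs.trans (integral_abs_le_sqrt hd)
      rw [integral_sub (hF.integrable (by norm_num)) hbi, hF0, zero_sub, abs_neg] at h2
      have h3 : (∫ w, b w ∂P) ^ 2 ≤ ∫ z, (F z - b z) ^ 2 ∂P := by
        rw [← sq_abs]
        exact (pow_le_pow_left₀ (abs_nonneg _) h2 2).trans
          (Real.sq_sqrt (integral_nonneg fun z => sq_nonneg _)).le
      have h4 : ∀ z, F z - (b z - ∫ w, b w ∂P) = F z - b z + ∫ w, b w ∂P := fun z => by ring
      simp only [h4]
      simp only [integral_const, probReal_univ, one_smul] at h1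
      linarith
  refine ⟨⟨hinf, fun η hη => ?_⟩, fun h hh => ?_⟩
  · obtain ⟨r, hr0, hr⟩ := ENNReal.lt_iff_exists_nnreal_btwn.1 hη
    have hr0 : 0 < r := by exact_mod_cast hr0
    obtain ⟨b, hbs, hb, hbη⟩ := happrox _ hF hF0 ((r : ℝ) ^ 2) (by positivity)
    refine ⟨b, Submodule.subset_span hbs, lt_of_le_of_lt ?_ hr⟩
    have hm : MemLp ((fun z => f z - ψ P) - b) 2 P := hF.sub hb
    rw [hm.eLpNorm_eq_integral_rpow_norm (by norm_num) (by norm_num)]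
    refine ENNReal.ofReal_le_of_le_toReal ?_
    simp only [ENNReal.toReal_ofNat, Real.rpow_two, Pi.sub_apply, Real.norm_eq_abs, sq_abs,
      ← one_div, ← Real.sqrt_eq_rpow, ENNReal.coe_toReal]
    exact Real.sqrt_le_iff.2 ⟨r.2, hbη.le⟩
  · have hd : MemLp (fun z => h z - (f z - ψ P)) 2 P := hh.memLp.sub hF
    have hd0 : ∫ z, h z - (f z - ψ P) ∂P = 0 := by
      rw [integral_sub (hh.memLp.integrable (by norm_num)) (hF.integrable (by norm_num)), hF0,
        hh.mean_zero, sub_zero]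
    -- Along a submodel with score `b`, both influence functions give the same derivative, so their
    -- difference is orthogonal to `b`.
    have horth : ∀ b ∈ scoreSet R P, ∫ z, (h z - (f z - ψ P)) * b z ∂P = 0 := fun b hb => by
      obtain ⟨Q, hQR, hQ⟩ := hb
      simp only [sub_mul _ _ (b _)]
      have i1 : Integrable (fun z => h z * b z) P := hh.memLp.integrable_mul hQ.score_memLp
      have i2 : Integrable (fun z => (f z - ψ P) * b z) P := hF.integrable_mul hQ.score_memLp
      have := (hh.pathwise Q b hQR hQ).unique (hinf.pathwise Q b hQR hQ)
      have e : ∀ z, (h z - (f z - ψ P)) * b z = h z * b z - (f z - ψ P) * b z := fun z => by ring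
      simp only [← sub_mul]
      simp only [e]
      rw [integral_sub i1 i2, this, sub_self]
    set D := ∫ z, (h z - (f z - ψ P)) ^ 2 ∂P with hD
    -- Subtracting a nearby score does not change the inner product of the difference with itself,
    -- so `D ≤ √D √η` for every `η > 0`.
    have hDle : D = 0 := by
      refine le_antisymm (le_of_forall_pos_le_add fun η hη => ?_) (integral_nonneg fun z => sq_nonneg _)
      obtain ⟨b, hbs, hb, hbη⟩ := happrox _ hd hd0 η hη
      have h1 := abs_integral_mul_le_sqrt hd (hd.sub hb)
      simp only [Pi.sub_apply] at h1
      have h2 : ∫ z, (h z - (f z - ψ P)) * ((h z - (f z - ψ P)) - b z) ∂P = D := by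
        have i1 : Integrable (fun z => (h z - (f z - ψ P)) ^ 2) P := hd.integrable_sq
        have i2 : Integrable (fun z => (h z - (f z - ψ P)) * b z) P := hd.integrable_mul hb
        have e : ∀ z, (h z - (f z - ψ P)) * ((h z - (f z - ψ P)) - b z)
            = (h z - (f z - ψ P)) ^ 2 - (h z - (f z - ψ P)) * b z := fun z => by ring
        simp only [e]
        rw [integral_sub i1 i2, horth b hbs, sub_zero]
      rw [h2, ← hD] at h1
      have hD0 : 0 ≤ D := integral_nonneg fun z => sq_nonneg _
      have h3 : √D * √(∫ z, (h z - (f z - ψ P) - b z) ^ 2 ∂P) ≤ √D * √η := by gcongr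
      have h4 := (le_abs_self D).trans (h1.trans h3)
      nlinarith [Real.sq_sqrt hD0, Real.sq_sqrt hη.le, sq_nonneg (√D - √η)]
    have h5 := (integral_eq_zero_iff_of_nonneg (fun z => sq_nonneg _) hd.integrable_sq).1 hDle
    filter_upwards [h5] with z hz
    have : h z - (f z - ψ P) = 0 := by simpa using hz
    linarith

end Tangent

/-! ### Weighted regression functions -/

section Regression

variable {Ω : Type*} {m mX m0 : MeasurableSpace Ω} {P : Measure Ω}

/-- `r` is a version of the regression of `f` on `m` under `P`, with weight `w`. -/
structure IsRegr {Ω : Type*} {m0 : MeasurableSpace Ω} (P : Measure Ω) (m : MeasurableSpace Ω)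
    (w f r : Ω → ℝ) : Prop where
  meas : Measurable[m] r
  char : ∀ h : Ω → ℝ, Measurable[m] h → Integrable (fun z => h z * f z) P →
    ∫ z, w z * (h z * f z) ∂P = ∫ z, w z * (h z * r z) ∂P

lemma IsRegr.congr {w f r r' : Ω → ℝ} (h : IsRegr P m w f r) (hr' : Measurable[m] r')
    (hrr : r' =ᵐ[P] r) : IsRegr P m w f r' :=
  ⟨hr', fun k hk hki => (h.char k hk hki).trans
    (integral_congr_ae (by filter_upwards [hrr] with z hz; rw [hz]))⟩

lemma integrable_mul_mul_of_bdd {u v B : Ω → ℝ} {C : ℝ} (hu : MemLp u 2 P) (hv : MemLp v 2 P)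
    (hB : Measurable B) (hC : ∀ z, |B z| ≤ C) : Integrable (fun z => u z * v z * B z) P :=
  (hu.integrable_mul hv).mul_bdd (c := C) hB.aestronglyMeasurable (ae_of_all _ hC)

lemma memLp_mul_of_bdd {u B : Ω → ℝ} {C : ℝ} {p : ℝ≥0∞} (hu : MemLp u p P)
    (hB : Measurable B) (hC : ∀ z, |B z| ≤ C) : MemLp (fun z => B z * u z) p P :=
  hu.of_le_mul (c := C) (hB.aestronglyMeasurable.mul hu.1) (ae_of_all _ fun z => by
    rw [norm_mul]; exact mul_le_mul_of_nonneg_right (hC z) (norm_nonneg _))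

/-- A weighted integral of a residual, in terms of the regression and the propensity score. -/
lemma IsRegr.integral_weight_mul_sub {w p f r ν k : Ω → ℝ}
    (hp : IsRegr P m (fun _ => 1) w p) (hr : IsRegr P m w f r) (hw : Measurable w)
    (hw1 : ∀ z, |w z| ≤ 1) (hν : Measurable[m] ν) (hk : Measurable[m] k)
    (hk2 : MemLp k 2 P) (hf2 : MemLp f 2 P) (hr2 : MemLp r 2 P) (hν2 : MemLp ν 2 P) :
    ∫ z, w z * (k z * (f z - ν z)) ∂P = ∫ z, k z * (r z - ν z) * p z ∂P := by
  have i1 : Integrable (fun z => w z * (k z * f z)) P :=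
    (integrable_mul_mul_of_bdd hk2 hf2 hw hw1).congr (ae_of_all _ fun z => mul_comm _ _)
  have i2 : Integrable (fun z => w z * (k z * ν z)) P :=
    (integrable_mul_mul_of_bdd hk2 hν2 hw hw1).congr (ae_of_all _ fun z => mul_comm _ _)
  have i3 : Integrable (fun z => w z * (k z * r z)) P :=
    (integrable_mul_mul_of_bdd hk2 hr2 hw hw1).congr (ae_of_all _ fun z => mul_comm _ _)
  have h1 := hr.char k hk (hk2.integrable_mul hf2)
  have h2 := hp.char (fun z => k z * (r z - ν z)) (hk.mul (hr.meas.sub hν)) (by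
    refine (i3.sub i2).congr (ae_of_all _ fun z => ?_)
    simp only [Pi.sub_apply]; ring)
  simp only [one_mul] at h2
  rw [← h2]
  have e1 : ∀ z, w z * (k z * (f z - ν z)) = w z * (k z * f z) - w z * (k z * ν z) :=
    fun z => by ring
  have e2 : ∀ z, k z * (r z - ν z) * w z = w z * (k z * r z) - w z * (k z * ν z) :=
    fun z => by ring
  simp only [e1, e2]
  rw [integral_sub i1 i2, integral_sub i3 i2, h1]

lemma abs_div_le_of_bounds {x y δ : ℝ} (hδ : 0 < δ) (hx : |x| ≤ 1) (hy : δ ≤ y) :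
    |x / y| ≤ 1 / δ := by
  rw [abs_div, abs_of_pos (hδ.trans_le hy)]
  gcongr

/-- The von Mises identity for the squared norm of a difference of regressions, with arbitrary
approximations `q`, `ν`, `cb` of the nuisance functions. -/
lemma integral_gap_expansion [IsProbabilityMeasure P] (hmX : m ≤ mX) (hX0 : mX ≤ m0)
    {wa wb f pSa pXa pSb pXb μX μS c e qSa qXa qSb qXb νX νS cb : Ω → ℝ} {δ : ℝ} (hδ : 0 < δ)
    (hwa : Measurable wa) (hwb : Measurable wb) (hwa1 : ∀ z, |wa z| ≤ 1) (hwb1 : ∀ z, |wb z| ≤ 1)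
    (hpSa : IsRegr P m (fun _ => 1) wa pSa) (hpXa : IsRegr P mX (fun _ => 1) wa pXa)
    (hpSb : IsRegr P m (fun _ => 1) wb pSb) (hpXb : IsRegr P mX (fun _ => 1) wb pXb)
    (hpSa1 : ∀ z, |pSa z| ≤ 1) (hpXa1 : ∀ z, |pXa z| ≤ 1)
    (hpSb1 : ∀ z, |pSb z| ≤ 1) (hpXb1 : ∀ z, |pXb z| ≤ 1) (hpSbδ : ∀ z, δ ≤ pSb z)
    (hμS : IsRegr P m wa f μS) (hμX : IsRegr P mX wa f μX)
    (hc : IsRegr P m wb μX c) (he : IsRegr P m wb νX e)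
    (hqSa : Measurable[m] qSa) (hqXa : Measurable[mX] qXa)
    (hqSb : Measurable[m] qSb) (hqXb : Measurable[mX] qXb)
    (hqSaδ : ∀ z, δ ≤ qSa z) (hqXaδ : ∀ z, δ ≤ qXa z) (hqSbδ : ∀ z, δ ≤ qSb z)
    (hqXb1 : ∀ z, |qXb z| ≤ 1)
    (hνX : Measurable[mX] νX) (hνS : Measurable[m] νS) (hcb : Measurable[m] cb)
    (hf2 : MemLp f 2 P) (hμX2 : MemLp μX 2 P) (hμS2 : MemLp μS 2 P) (hc2 : MemLp c 2 P)
    (he2 : MemLp e 2 P) (hνX2 : MemLp νX 2 P) (hνS2 : MemLp νS 2 P) (hcb2 : MemLp cb 2 P) :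
    ∫ z, ((νS z - cb z) ^ 2 + 2 * (νS z - cb z) * (wa z / qSa z * (f z - νS z)
        - wa z / qXa z * (f z - νX z) * (qXb z / qSb z) - wb z / qSb z * (νX z - cb z))) ∂P
      = ∫ z, (μS z - c z) ^ 2 ∂P
        + ∫ z, (-((νS z - cb z) - (μS z - c z)) ^ 2 + 2 * ((νS z - cb z) *
          ((pSa z - qSa z) / qSa z * (μS z - νS z)
            - (pXa z - qXa z) / qXa z * (μX z - νX z) * (qXb z / qSb z)
            - (pSb z - qSb z) / qSb z * (e z - cb z)
            - (μX z - νX z) * (qXb z / qSb z - pXb z / pSb z)))) ∂P := by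
  have hS0 := hmX.trans hX0
  set φ : Ω → ℝ := fun z => νS z - cb z with hφ
  have hφm : Measurable[m] φ := hνS.sub hcb
  have hφ2 : MemLp φ 2 P := hνS2.sub hcb2
  have hqSam := hqSa.mono hS0 le_rfl
  have hqXam := hqXa.mono hX0 le_rfl
  have hqSbm := hqSb.mono hS0 le_rfl
  have hqXbm := hqXb.mono hX0 le_rfl
  have hpSam := hpSa.meas.mono hS0 le_rfl
  have hpXam := hpXa.meas.mono hX0 le_rfl
  have hpSbm := hpSb.meas.mono hS0 le_rfl
  have hpXbm := hpXb.meas.mono hX0 le_rfl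
  have ne1 : ∀ z, qSa z ≠ 0 := fun z => (hδ.trans_le (hqSaδ z)).ne'
  have ne2 : ∀ z, qXa z ≠ 0 := fun z => (hδ.trans_le (hqXaδ z)).ne'
  have ne3 : ∀ z, qSb z ≠ 0 := fun z => (hδ.trans_le (hqSbδ z)).ne'
  have ne4 : ∀ z, pSb z ≠ 0 := fun z => (hδ.trans_le (hpSbδ z)).ne'
  have hinv : ∀ x : ℝ, δ ≤ x → |1 / x| ≤ 1 / δ := fun x hx =>
    abs_div_le_of_bounds hδ (by simp) hx
  have hrat : ∀ z, |qXb z / qSb z| ≤ 1 / δ := fun z =>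
    abs_div_le_of_bounds hδ (hqXb1 z) (hqSbδ z)
  have hrat2 : ∀ z, |(1 / qXa z) * (qXb z / qSb z)| ≤ 1 / δ * (1 / δ) := fun z => by
    rw [abs_mul]
    exact mul_le_mul (hinv _ (hqXaδ z)) (hrat z) (abs_nonneg _) (by positivity)
  set k1 : Ω → ℝ := fun z => (1 / qSa z) * φ z with hk1
  set k2 : Ω → ℝ := fun z => ((1 / qXa z) * (qXb z / qSb z)) * φ z with hk2
  set k3 : Ω → ℝ := fun z => (1 / qSb z) * φ z with hk3
  set k4 : Ω → ℝ := fun z => (1 / pSb z) * φ z with hk4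
  have hk1m : Measurable[m] k1 := (measurable_const.div hqSa).mul hφm
  have hk2m : Measurable[mX] k2 := ((measurable_const.div hqXa).mul
    (hqXb.div (hqSb.mono hmX le_rfl))).mul (hφm.mono hmX le_rfl)
  have hk3m : Measurable[m] k3 := (measurable_const.div hqSb).mul hφm
  have hk4m : Measurable[m] k4 := (measurable_const.div hpSb.meas).mul hφm
  have hk12 : MemLp k1 2 P := memLp_mul_of_bdd hφ2 (measurable_const.div hqSam)
    fun z => hinv _ (hqSaδ z)
  have hk22 : MemLp k2 2 P := memLp_mul_of_bdd hφ2 ((measurable_const.div hqXam).mul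
    (hqXbm.div hqSbm)) hrat2
  have hk32 : MemLp k3 2 P := memLp_mul_of_bdd hφ2 (measurable_const.div hqSbm)
    fun z => hinv _ (hqSbδ z)
  have hk42 : MemLp k4 2 P := memLp_mul_of_bdd hφ2 (measurable_const.div hpSbm)
    fun z => hinv _ (hpSbδ z)
  have T1 := hpSa.integral_weight_mul_sub hμS hwa hwa1 hνS hk1m hk12 hf2 hμS2 hνS2
  have T2 := hpXa.integral_weight_mul_sub hμX hwa hwa1 hνX hk2m hk22 hf2 hμX2 hνX2
  have T3 := hpSb.integral_weight_mul_sub he hwb hwb1 hcb hk3m hk32 hνX2 he2 hcb2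
  -- A function already measurable in all covariates is its own regression, whatever the weight.
  -- This lets the weight `wb` be exchanged for `π_b(X)` in `T4`.
  have hXX : IsRegr P mX wb μX μX := ⟨hμX.meas, fun _ _ _ => rfl⟩
  have T4 := hpXb.integral_weight_mul_sub hXX hwb hwb1 hνX (hk4m.mono hmX le_rfl) hk42
    hμX2 hμX2 hνX2
  have iw : ∀ {w u v : Ω → ℝ}, Measurable w → (∀ z, |w z| ≤ 1) → MemLp u 2 P → MemLp v 2 P →
      Integrable (fun z => w z * (u z * v z)) P := fun hw hw1 hu hv =>
    (integrable_mul_mul_of_bdd hu hv hw hw1).congr (ae_of_all _ fun z => mul_comm _ _)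
  -- Dividing the test function by `π_b(X_{-S})` undoes the weight: regressing `μX` and `νX` in arm
  -- `b` gives `c` and `e`, and averaging the weight restores `π_b(X_{-S})`.
  have T5 : ∫ z, wb z * (k4 z * (μX z - νX z)) ∂P = ∫ z, φ z * (c z - e z) ∂P := by
    have h1 := hc.char k4 hk4m (hk42.integrable_mul hμX2)
    have h2 := he.char k4 hk4m (hk42.integrable_mul hνX2)
    have h3 := hpSb.char (fun z => k4 z * (c z - e z)) (hk4m.mul (hc.meas.sub he.meas))
      (((iw hwb hwb1 hk42 (hc2.sub he2))).congr (ae_of_all _ fun z => mul_comm _ _))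
    have h4 : ∫ z, φ z * (c z - e z) ∂P = ∫ z, 1 * (k4 z * (c z - e z) * pSb z) ∂P := by
      congr 1; ext z; have := ne4 z; simp only [hk4]; field_simp
    rw [h4, ← h3]
    have e1 : ∀ z, wb z * (k4 z * (μX z - νX z)) = wb z * (k4 z * μX z) - wb z * (k4 z * νX z) :=
      fun z => by ring
    have e2 : ∀ z, 1 * (k4 z * (c z - e z) * wb z) = wb z * (k4 z * c z) - wb z * (k4 z * e z) :=
      fun z => by ring
    simp only [e1, e2]
    rw [integral_sub (iw hwb hwb1 hk42 hμX2) (iw hwb hwb1 hk42 hνX2),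
      integral_sub (iw hwb hwb1 hk42 hc2) (iw hwb hwb1 hk42 he2), h1, h2]
  have hfS : MemLp (fun z => f z - νS z) 2 P := hf2.sub hνS2
  have hfX : MemLp (fun z => f z - νX z) 2 P := hf2.sub hνX2
  have hXc : MemLp (fun z => νX z - cb z) 2 P := hνX2.sub hcb2
  have hμνS : MemLp (fun z => μS z - νS z) 2 P := hμS2.sub hνS2
  have hμνX : MemLp (fun z => μX z - νX z) 2 P := hμX2.sub hνX2
  have hec : MemLp (fun z => e z - cb z) 2 P := he2.sub hcb2
  have hce : MemLp (fun z => c z - e z) 2 P := hc2.sub he2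
  have hμc : MemLp (fun z => μS z - c z) 2 P := hμS2.sub hc2
  have a1 : Integrable (fun z => wa z * (k1 z * (f z - νS z))) P := iw hwa hwa1 hk12 hfS
  have a2 : Integrable (fun z => wa z * (k2 z * (f z - νX z))) P := iw hwa hwa1 hk22 hfX
  have a3 : Integrable (fun z => wb z * (k3 z * (νX z - cb z))) P := iw hwb hwb1 hk32 hXc
  have b1 : Integrable (fun z => k1 z * (μS z - νS z) * pSa z) P :=
    integrable_mul_mul_of_bdd hk12 hμνS hpSam hpSa1
  have b2 : Integrable (fun z => k2 z * (μX z - νX z) * pXa z) P :=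
    integrable_mul_mul_of_bdd hk22 hμνX hpXam hpXa1
  have b3 : Integrable (fun z => k3 z * (e z - cb z) * pSb z) P :=
    integrable_mul_mul_of_bdd hk32 hec hpSbm hpSb1
  have b4 : Integrable (fun z => k4 z * (μX z - νX z) * pXb z) P :=
    integrable_mul_mul_of_bdd hk42 hμνX hpXbm hpXb1
  have b5 : Integrable (fun z => φ z * (c z - e z)) P := hφ2.integrable_mul hce
  have i0 : Integrable (fun z => φ z ^ 2) P := hφ2.integrable_sq
  have i1 : Integrable (fun z => (μS z - c z) ^ 2) P := hμc.integrable_sq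
  have L1 : ∀ z, φ z ^ 2 + 2 * φ z * (wa z / qSa z * (f z - νS z)
        - wa z / qXa z * (f z - νX z) * (qXb z / qSb z) - wb z / qSb z * (νX z - cb z))
      = φ z ^ 2 + 2 * (wa z * (k1 z * (f z - νS z)) - wa z * (k2 z * (f z - νX z))
        - wb z * (k3 z * (νX z - cb z))) := fun z => by
    simp only [hk1, hk2, hk3]; ring
  -- Once `φ = νS - cb` is substituted, the square and the `-1` parts of the error ratios leave `φ²
  -- - (μS - c)² - 2φ(c - e)`. The term in `c - e` has no counterpart on the other side; in the
  -- integral it cancels against the term with `pXb / pSb`, by `T4` and `T5`.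
  have L2 : ∀ z, -(φ z - (μS z - c z)) ^ 2 + 2 * (φ z *
          ((pSa z - qSa z) / qSa z * (μS z - νS z)
            - (pXa z - qXa z) / qXa z * (μX z - νX z) * (qXb z / qSb z)
            - (pSb z - qSb z) / qSb z * (e z - cb z)
            - (μX z - νX z) * (qXb z / qSb z - pXb z / pSb z)))
      = φ z ^ 2 - (μS z - c z) ^ 2 + 2 * (k1 z * (μS z - νS z) * pSa z
        - k2 z * (μX z - νX z) * pXa z - k3 z * (e z - cb z) * pSb z
        + k4 z * (μX z - νX z) * pXb z - φ z * (c z - e z)) := fun z => by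
    have := ne1 z; have := ne2 z; have := ne3 z; have := ne4 z
    have hφz : φ z = νS z - cb z := rfl
    have h1 : (pSa z - qSa z) / qSa z = pSa z / qSa z - 1 := by field_simp
    have h2 : (pXa z - qXa z) / qXa z = pXa z / qXa z - 1 := by field_simp
    have h3 : (pSb z - qSb z) / qSb z = pSb z / qSb z - 1 := by field_simp
    rw [h1, h2, h3]
    simp only [hk1, hk2, hk3, hk4]
    rw [hφz]
    ring
  refine (integral_congr_ae (ae_of_all _ L1)).trans (Eq.trans ?_
    (congrArg (∫ z, (μS z - c z) ^ 2 ∂P + ·) (integral_congr_ae (ae_of_all _ L2)).symm))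
  have a12 : Integrable (fun z => wa z * (k1 z * (f z - νS z)) - wa z * (k2 z * (f z - νX z))) P :=
    a1.sub a2
  have b12 : Integrable (fun z => k1 z * (μS z - νS z) * pSa z
      - k2 z * (μX z - νX z) * pXa z) P := b1.sub b2
  have b13 : Integrable (fun z => k1 z * (μS z - νS z) * pSa z
      - k2 z * (μX z - νX z) * pXa z - k3 z * (e z - cb z) * pSb z) P := b12.sub b3
  have b14 : Integrable (fun z => k1 z * (μS z - νS z) * pSa z
      - k2 z * (μX z - νX z) * pXa z - k3 z * (e z - cb z) * pSb z
      + k4 z * (μX z - νX z) * pXb z) P := b13.add b4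
  have a13 : Integrable (fun z => wa z * (k1 z * (f z - νS z)) - wa z * (k2 z * (f z - νX z))
      - wb z * (k3 z * (νX z - cb z))) P := a12.sub a3
  have b15 : Integrable (fun z => k1 z * (μS z - νS z) * pSa z
      - k2 z * (μX z - νX z) * pXa z - k3 z * (e z - cb z) * pSb z
      + k4 z * (μX z - νX z) * pXb z - φ z * (c z - e z)) P := b14.sub b5
  have i01 : Integrable (fun z => φ z ^ 2 - (μS z - c z) ^ 2) P := i0.sub i1
  rw [integral_add i0 (a13.const_mul 2), integral_const_mul, integral_sub a12 a3,
    integral_sub a1 a2, T1, T2, T3, integral_add i01 (b15.const_mul 2),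
    integral_sub i0 i1, integral_const_mul, integral_sub b14 b5, integral_add b13 b4,
    integral_sub b12 b3, integral_sub b1 b2, ← T4, T5]
  ring

end Regression

/-! ### Bounded functions -/

section BoundedFunctions

variable {Ω : Type*}

/-- The function `f` is bounded. -/
def Bdd (f : Ω → ℝ) : Prop := ∃ B : ℝ, ∀ z, |f z| ≤ B

lemma Bdd.add {f g : Ω → ℝ} (hf : Bdd f) (hg : Bdd g) : Bdd fun z => f z + g z := by
  obtain ⟨A, hA⟩ := hf
  obtain ⟨B, hB⟩ := hg
  exact ⟨A + B, fun z => (abs_add_le _ _).trans (add_le_add (hA z) (hB z))⟩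

lemma Bdd.sub {f g : Ω → ℝ} (hf : Bdd f) (hg : Bdd g) : Bdd fun z => f z - g z := by
  obtain ⟨A, hA⟩ := hf
  obtain ⟨B, hB⟩ := hg
  exact ⟨A + B, fun z => (abs_sub _ _).trans (add_le_add (hA z) (hB z))⟩

lemma Bdd.mul {f g : Ω → ℝ} (hf : Bdd f) (hg : Bdd g) : Bdd fun z => f z * g z := by
  obtain ⟨A, hA⟩ := hf
  obtain ⟨B, hB⟩ := hg
  exact ⟨A * B, fun z => by
    rw [abs_mul]
    exact mul_le_mul (hA z) (hB z) (abs_nonneg _) ((abs_nonneg _).trans (hA z))⟩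

lemma Bdd.pow {f : Ω → ℝ} (hf : Bdd f) (n : ℕ) : Bdd fun z => f z ^ n := by
  obtain ⟨A, hA⟩ := hf
  exact ⟨A ^ n, fun z => by rw [abs_pow]; exact pow_le_pow_left₀ (abs_nonneg _) (hA z) n⟩

lemma Bdd.memLp {m0 : MeasurableSpace Ω} {P : Measure Ω} [IsFiniteMeasure P] {f : Ω → ℝ}
    (hf : Bdd f) (hfm : Measurable f) (p : ℝ≥0∞) : MemLp f p P := by
  obtain ⟨A, hA⟩ := hf
  exact MemLp.of_bound hfm.aestronglyMeasurable A (ae_of_all _ hA)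

lemma Bdd.integrable {m0 : MeasurableSpace Ω} {P : Measure Ω} [IsFiniteMeasure P] {f : Ω → ℝ}
    (hf : Bdd f) (hfm : Measurable f) : Integrable f P :=
  memLp_one_iff_integrable.1 (hf.memLp hfm 1)

/-- A bound of order `|ε|^(-1/2)` is expressed as `f² |ε| ≤ 1`. At each fixed `ε ≠ 0` it makes `f`
bounded, which settles all integrability questions; only moment bounds uniform in `ε` remain to be
proved. -/
lemma Bdd.of_sq_mul_le {f : Ω → ℝ} {t : ℝ} (ht : 0 < t) (hf : ∀ z, f z ^ 2 * t ≤ 1) : Bdd f := by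
  refine ⟨1 + 1 / t, fun z => ?_⟩
  have h1 : f z ^ 2 ≤ 1 / t := by rw [le_div_iff₀ ht]; exact hf z
  rw [abs_le]
  constructor <;> nlinarith [sq_nonneg (f z - 1), sq_nonneg (f z + 1)]

end BoundedFunctions

/-! ### Second and fourth moments -/

section Moments

variable {Ω : Type*} {m0 : MeasurableSpace Ω} {P : Measure Ω}

lemma integral_sq_mul_sq_le_sqrt {u v : Ω → ℝ} (hu : MemLp (fun z => u z ^ 2) 2 P)
    (hv : MemLp (fun z => v z ^ 2) 2 P) :
    ∫ z, (u z * v z) ^ 2 ∂P ≤ √(∫ z, u z ^ 4 ∂P) * √(∫ z, v z ^ 4 ∂P) := by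
  have h := (le_abs_self _).trans (abs_integral_mul_le_sqrt hu hv)
  simpa only [← pow_mul, ← mul_pow] using h

lemma integral_sq_le_sqrt [IsProbabilityMeasure P] {u : Ω → ℝ}
    (hu : MemLp (fun z => u z ^ 2) 2 P) : ∫ z, u z ^ 2 ∂P ≤ √(∫ z, u z ^ 4 ∂P) := by
  simpa using integral_sq_mul_sq_le_sqrt hu (v := fun _ => 1) (memLp_const _)

lemma integral_sub_pow_four_le {u v : Ω → ℝ} (hu : Integrable (fun z => u z ^ 4) P)
    (hv : Integrable (fun z => v z ^ 4) P) :
    ∫ z, (u z - v z) ^ 4 ∂P ≤ 8 * ∫ z, u z ^ 4 ∂P + 8 * ∫ z, v z ^ 4 ∂P := by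
  rw [← integral_const_mul, ← integral_const_mul,
    ← integral_add (hu.const_mul 8) (hv.const_mul 8)]
  refine integral_mono_of_nonneg (ae_of_all _ fun z => by positivity)
    ((hu.const_mul 8).add (hv.const_mul 8)) (ae_of_all _ fun z => ?_)
  simp only
  have h1 : (u z - v z) ^ 2 ≤ 2 * (u z ^ 2 + v z ^ 2) := by nlinarith [sq_nonneg (u z + v z)]
  have h2 : ((u z - v z) ^ 2) ^ 2 ≤ (2 * (u z ^ 2 + v z ^ 2)) ^ 2 :=
    pow_le_pow_left₀ (sq_nonneg _) h1 2
  nlinarith [sq_nonneg (u z ^ 2 - v z ^ 2)]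

end Moments

/-! ### Moment bounds for regressions under positivity -/

section Contraction

variable {Ω : Type*} {m m0 : MeasurableSpace Ω} {P : Measure Ω} {w f r : Ω → ℝ} {δ : ℝ}

/-- The weight `w` has conditional mean at least `δ` given `m`. -/
def WeightPos {Ω : Type*} {m0 : MeasurableSpace Ω} (δ : ℝ) (P : Measure Ω)
    (m : MeasurableSpace Ω) (w : Ω → ℝ) : Prop :=
  ∀ k : Ω → ℝ, Measurable[m] k → (∀ z, 0 ≤ k z) → Integrable k P →
    δ * ∫ z, k z ∂P ≤ ∫ z, w z * k z ∂P

/-- Testing with `r` itself gives `∫ w r² = ∫ w r f ≤ ½ ∫ w r² + ½ ∫ f²`, and positivity of the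
weight bounds `∫ w r²` below by `δ ∫ r²`. -/
lemma IsRegr.integral_sq_le (hr : IsRegr P m w f r) (hpos : WeightPos δ P m w)
    (hw : Measurable w) (hw0 : ∀ z, 0 ≤ w z) (hw1 : ∀ z, w z ≤ 1) (hf : MemLp f 2 P)
    (hr2 : MemLp r 2 P) : δ * ∫ z, r z ^ 2 ∂P ≤ ∫ z, f z ^ 2 ∂P := by
  have hwa : ∀ z, |w z| ≤ 1 := fun z => by rw [abs_of_nonneg (hw0 z)]; exact hw1 z
  have h1 := hr.char r hr.meas (hr2.integrable_mul hf)
  have h2 := hpos (fun z => r z ^ 2) (hr.meas.pow_const 2) (fun z => sq_nonneg _) hr2.integrable_sq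
  have i1 : Integrable (fun z => w z * (r z * r z)) P :=
    (integrable_mul_mul_of_bdd hr2 hr2 hw hwa).congr (ae_of_all _ fun z => mul_comm _ _)
  have h3 : ∫ z, w z * (r z * f z) ∂P
      ≤ ∫ z, (1 / 2 * (w z * (r z * r z)) + 1 / 2 * f z ^ 2) ∂P := by
    refine integral_mono ((integrable_mul_mul_of_bdd hr2 hf hw hwa).congr
      (ae_of_all _ fun z => mul_comm _ _)) ((i1.const_mul _).add (hf.integrable_sq.const_mul _))
      fun z => ?_
    simp only
    nlinarith [mul_nonneg (hw0 z) (sq_nonneg (r z - f z)),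
      mul_nonneg (sub_nonneg.2 (hw1 z)) (sq_nonneg (f z))]
  rw [integral_add (i1.const_mul _) (hf.integrable_sq.const_mul _), integral_const_mul,
    integral_const_mul] at h3
  simp only [sq (r _)] at h2 ⊢
  linarith

/-- The test function is now `r³`, and Young's inequality `r³ f ≤ ¾ r⁴ + ¼ f⁴` replaces the
quadratic one. -/
lemma IsRegr.integral_pow_four_le [IsFiniteMeasure P] (hm : m ≤ m0) (hr : IsRegr P m w f r)
    (hpos : WeightPos δ P m w) (hw : Measurable w) (hw0 : ∀ z, 0 ≤ w z) (hw1 : ∀ z, w z ≤ 1)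
    (hfm : Measurable f) (hf : Bdd f) (hrb : Bdd r) :
    δ * ∫ z, r z ^ 4 ∂P ≤ ∫ z, f z ^ 4 ∂P := by
  have hrm : Measurable r := hr.meas.mono hm le_rfl
  have hwb : Bdd w := ⟨1, fun z => by rw [abs_of_nonneg (hw0 z)]; exact hw1 z⟩
  have h1 := hr.char (fun z => r z ^ 3) (hr.meas.pow_const 3)
    (((hrb.pow 3).mul hf).integrable ((hrm.pow_const 3).mul hfm))
  have h2 := hpos (fun z => r z ^ 4) (hr.meas.pow_const 4) (fun z => by positivity)
    ((hrb.pow 4).integrable (hrm.pow_const 4))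
  have i1 : Integrable (fun z => w z * (r z ^ 3 * r z)) P :=
    (hwb.mul ((hrb.pow 3).mul hrb)).integrable (hw.mul ((hrm.pow_const 3).mul hrm))
  have i2 : Integrable (fun z => f z ^ 4) P := (hf.pow 4).integrable (hfm.pow_const 4)
  have h3 : ∫ z, w z * (r z ^ 3 * f z) ∂P
      ≤ ∫ z, (3 / 4 * (w z * (r z ^ 3 * r z)) + 1 / 4 * f z ^ 4) ∂P := by
    refine integral_mono ((hwb.mul ((hrb.pow 3).mul hf)).integrable
      (hw.mul ((hrm.pow_const 3).mul hfm))) ((i1.const_mul _).add (i2.const_mul _)) fun z => ?_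
    simp only
    have h4 : r z ^ 3 * f z ≤ 3 / 4 * r z ^ 4 + 1 / 4 * f z ^ 4 := by
      nlinarith [sq_nonneg (r z * (r z - f z)), sq_nonneg (r z ^ 2 - f z ^ 2),
        mul_self_nonneg (r z - f z), sq_nonneg ((r z - f z) * (r z + f z)),
        sq_nonneg ((r z - f z) ^ 2)]
    have h5 := mul_le_mul_of_nonneg_left h4 (hw0 z)
    have h6 : w z * (1 / 4 * f z ^ 4) ≤ 1 * (1 / 4 * f z ^ 4) :=
      mul_le_mul_of_nonneg_right (hw1 z) (by positivity)
    nlinarith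
  rw [integral_add (i1.const_mul _) (i2.const_mul _), integral_const_mul,
    integral_const_mul] at h3
  have e : ∀ z, r z ^ 3 * r z = r z ^ 4 := fun z => by ring
  simp only [e] at h1 h3
  linarith

end Contraction

/-! ### Stability of regressions along a submodel -/

section Perturbation

variable {Ω : Type*} {m m0 : MeasurableSpace Ω} {P : Measure Ω} {Q : ℝ → Measure Ω} {g : Ω → ℝ}
  {w : Ω → ℝ} {δ : ℝ}

lemma tendsto_abs_nhdsNE_nhds_zero : Tendsto (fun ε : ℝ => |ε|) (𝓝[≠] 0) (𝓝 0) := by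
  simpa using (tendsto_nhdsWithin_of_tendsto_nhds (continuous_abs.tendsto (0 : ℝ)))

/-- Along a smooth submodel, regressions of functions bounded by `|ε|^(-1/2)` with bounded fourth
moments change by `o(|ε|^(1/2))` in mean square. -/
lemma IsSmoothSubmodel.tendsto_regression_sub (h : IsSmoothSubmodel P Q g) (hm : m ≤ m0)
    (hw : Measurable w) (hw0 : ∀ z, 0 ≤ w z) (hw1 : ∀ z, w z ≤ 1) (hδ : 0 < δ) {C : ℝ}
    (hC : 0 ≤ C) {f rP rQ : ℝ → Ω → ℝ}
    (hf : ∀ᶠ ε in 𝓝[≠] (0 : ℝ), Measurable (f ε) ∧ (∀ z, f ε z ^ 2 * |ε| ≤ 1) ∧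
      ∫ z, f ε z ^ 4 ∂P ≤ C ∧ ∫ z, f ε z ^ 4 ∂(Q ε) ≤ C)
    (hrP : ∀ᶠ ε in 𝓝[≠] (0 : ℝ), WeightPos δ P m w ∧ IsRegr P m w (f ε) (rP ε) ∧
      ∀ z, rP ε z ^ 2 * |ε| ≤ 1)
    (hrQ : ∀ᶠ ε in 𝓝[≠] (0 : ℝ), WeightPos δ (Q ε) m w ∧ IsRegr (Q ε) m w (f ε) (rQ ε) ∧
      ∀ z, rQ ε z ^ 2 * |ε| ≤ 1) :
    Tendsto (fun ε => (∫ z, (rP ε z - rQ ε z) ^ 2 ∂(Q ε)) / ε) (𝓝[≠] 0) (𝓝 0) := by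
  have := h.isProbabilityMeasure
  have := h.isProb
  obtain ⟨K, hK, hH⟩ := h.exists_abs_integral_sub_le
  obtain ⟨C', hC', hT⟩ := h.exists_integral_pow_four_le (C := C / δ) (by positivity)
  set D := 16 * (C + C / δ + C') with hD
  have hD0 : 0 ≤ D := by positivity
  have hwb : Bdd w := ⟨1, fun z => by rw [abs_of_nonneg (hw0 z)]; exact hw1 z⟩
  -- With `k = rP - rQ`, the function `F = w k (rP - f)` has mean zero under `P`, while under `Q ε`
  -- its mean is `∫ w k² ≥ δ ∫ k²`. So the squared error is controlled by the change of one
  -- expectation. The Lipschitz bound first gives `O(|ε|)`; this forces `F → 0` in `L¹(P)`, and the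
  -- slope lemma then improves the bound to `o(ε)`.
  set F : ℝ → Ω → ℝ := fun ε z => w z * ((rP ε z - rQ ε z) * (rP ε z - f ε z)) with hF
  have main : ∀ᶠ ε in 𝓝[≠] (0 : ℝ), (Measurable (F ε) ∧ MemLp (F ε) 2 P ∧ MemLp (F ε) 2 (Q ε) ∧
      ∫ z, F ε z ^ 2 ∂P ≤ D ∧ ∫ z, F ε z ^ 2 ∂(Q ε) ≤ D) ∧
      (∫ z, |F ε z - (fun _ => (0 : ℝ)) z| ∂P
        ≤ √(2 * K * √D / δ * |ε| + 2 * K * √D * |ε|) * √(√D)) ∧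
      δ * ∫ z, (rP ε z - rQ ε z) ^ 2 ∂(Q ε) ≤ |∫ z, F ε z ∂(Q ε) - ∫ z, F ε z ∂P| := by
    filter_upwards [hf, hrP, hrQ, hH, hT, self_mem_nhdsWithin] with ε ⟨hfm, hfε, hfP, hfQ⟩
      ⟨hPpos, hrP, hrPε⟩ ⟨hQpos, hrQ, hrQε⟩ hH hT hε0
    have hε0 : 0 < |ε| := abs_pos.2 hε0
    have hfb := Bdd.of_sq_mul_le hε0 hfε
    have hpb := Bdd.of_sq_mul_le hε0 hrPε
    have hqb := Bdd.of_sq_mul_le hε0 hrQε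
    have hpm : Measurable (rP ε) := hrP.meas.mono hm le_rfl
    have hqm : Measurable (rQ ε) := hrQ.meas.mono hm le_rfl
    have hp4 : ∫ z, rP ε z ^ 4 ∂P ≤ C / δ := by
      rw [le_div_iff₀' hδ]
      exact (hrP.integral_pow_four_le hm hPpos hw hw0 hw1 hfm hfb hpb).trans hfP
    have hq4 : ∫ z, rQ ε z ^ 4 ∂(Q ε) ≤ C / δ := by
      rw [le_div_iff₀' hδ]
      exact (hrQ.integral_pow_four_le hm hQpos hw hw0 hw1 hfm hfb hqb).trans hfQ
    have hp4Q := (hT _ hpm hrPε).1 hp4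
    have hq4P := (hT _ hqm hrQε).2 hq4
    have hkb : Bdd fun z => rP ε z - rQ ε z := hpb.sub hqb
    have hkm : Measurable fun z => rP ε z - rQ ε z := hpm.sub hqm
    have heb : Bdd fun z => rP ε z - f ε z := hpb.sub hfb
    have hem : Measurable fun z => rP ε z - f ε z := hpm.sub hfm
    have hCδ : 0 ≤ C / δ := by positivity
    have hdiff : ∀ (ρ : Measure Ω) [IsProbabilityMeasure ρ] {u v : Ω → ℝ} {A B : ℝ}, Bdd u →
        Bdd v → Measurable u → Measurable v → ∫ z, u z ^ 4 ∂ρ ≤ A → ∫ z, v z ^ 4 ∂ρ ≤ B →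
        8 * A + 8 * B ≤ D → ∫ z, (u z - v z) ^ 4 ∂ρ ≤ D := by
      intro ρ _ u v A B hu hv hum hvm huA hvB hAB
      have := integral_sub_pow_four_le (P := ρ) ((hu.pow 4).integrable (hum.pow_const 4))
        ((hv.pow 4).integrable (hvm.pow_const 4))
      linarith
    have hkP : ∫ z, (rP ε z - rQ ε z) ^ 4 ∂P ≤ D := hdiff P hpb hqb hpm hqm hp4 hq4P (by linarith)
    have hkQ : ∫ z, (rP ε z - rQ ε z) ^ 4 ∂(Q ε) ≤ D :=
      hdiff (Q ε) hpb hqb hpm hqm hp4Q hq4 (by linarith)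
    have heP : ∫ z, (rP ε z - f ε z) ^ 4 ∂P ≤ D := hdiff P hpb hfb hpm hfm hp4 hfP (by linarith)
    have heQ : ∫ z, (rP ε z - f ε z) ^ 4 ∂(Q ε) ≤ D :=
      hdiff (Q ε) hpb hfb hpm hfm hp4Q hfQ (by linarith)
    have hFm : Measurable (F ε) := hw.mul (hkm.mul hem)
    have hFb : Bdd (F ε) := hwb.mul (hkb.mul heb)
    have hFsq : ∀ (ρ : Measure Ω) [IsProbabilityMeasure ρ], ∫ z, (rP ε z - rQ ε z) ^ 4 ∂ρ ≤ D →
        ∫ z, (rP ε z - f ε z) ^ 4 ∂ρ ≤ D → ∫ z, F ε z ^ 2 ∂ρ ≤ D := by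
      intro ρ _ h1 h2
      calc ∫ z, F ε z ^ 2 ∂ρ ≤ ∫ z, ((rP ε z - rQ ε z) * (rP ε z - f ε z)) ^ 2 ∂ρ := by
            refine integral_mono ((hFb.pow 2).integrable (hFm.pow_const 2))
              (((hkb.mul heb).pow 2).integrable ((hkm.mul hem).pow_const 2)) fun z => ?_
            simp only [hF]
            rw [mul_pow (w z)]
            exact mul_le_of_le_one_left (sq_nonneg _) (pow_le_one₀ (hw0 z) (hw1 z))
        _ ≤ _ := integral_sq_mul_sq_le_sqrt ((hkb.pow 2).memLp (hkm.pow_const 2) 2)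
            ((heb.pow 2).memLp (hem.pow_const 2) 2)
        _ ≤ √D * √D := mul_le_mul (Real.sqrt_le_sqrt h1) (Real.sqrt_le_sqrt h2)
            (Real.sqrt_nonneg _) (Real.sqrt_nonneg _)
        _ = D := Real.mul_self_sqrt hD0
    have hFP := hFsq P hkP heP
    have hFQ := hFsq (Q ε) hkQ heQ
    have hFH : |∫ z, F ε z ∂(Q ε) - ∫ z, F ε z ∂P| ≤ 2 * K * √D * |ε| := by
      refine (hH _ hFm (hFb.memLp hFm 2) (hFb.memLp hFm 2)).trans ?_
      have h1 := Real.sqrt_le_sqrt hFP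
      have h2 := Real.sqrt_le_sqrt hFQ
      nlinarith [mul_le_mul_of_nonneg_left (add_le_add h2 h1) (mul_pos hK hε0).le]
    have split : ∀ (ρ : Measure Ω) [IsProbabilityMeasure ρ] {r : Ω → ℝ}, IsRegr ρ m w (f ε) r →
        Bdd r → ∫ z, F ε z ∂ρ = ∫ z, w z * ((rP ε z - rQ ε z) * (rP ε z - r z)) ∂ρ := by
      intro ρ _ r hr hrb
      have hrm : Measurable r := hr.meas.mono hm le_rfl
      have h1 := hr.char (fun z => rP ε z - rQ ε z) (hrP.meas.sub hrQ.meas)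
        ((hkb.mul hfb).integrable (hkm.mul hfm))
      have e1 : ∀ z, F ε z = w z * ((rP ε z - rQ ε z) * rP ε z)
          - w z * ((rP ε z - rQ ε z) * f ε z) := fun z => by simp only [hF]; ring
      have e2 : ∀ z, w z * ((rP ε z - rQ ε z) * (rP ε z - r z))
          = w z * ((rP ε z - rQ ε z) * rP ε z) - w z * ((rP ε z - rQ ε z) * r z) :=
        fun z => by ring
      simp only [e1, e2]
      have i1 : ∀ {u : Ω → ℝ}, Bdd u → Measurable u →
          Integrable (fun z => w z * ((rP ε z - rQ ε z) * u z)) ρ := fun hu hum =>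
        (hwb.mul (hkb.mul hu)).integrable (hw.mul (hkm.mul hum))
      rw [integral_sub (i1 hpb hpm) (i1 hfb hfm), integral_sub (i1 hpb hpm) (i1 hrb hrm), h1]
    have hF0 : ∫ z, F ε z ∂P = 0 := by rw [split P hrP hpb]; simp
    have hkQ2 : δ * ∫ z, (rP ε z - rQ ε z) ^ 2 ∂(Q ε) ≤ |∫ z, F ε z ∂(Q ε) - ∫ z, F ε z ∂P| := by
      refine le_trans ?_ (le_abs_self _)
      rw [hF0, sub_zero, split (Q ε) hrQ hqb]
      have h1 := hQpos (fun z => (rP ε z - rQ ε z) ^ 2) ((hrP.meas.sub hrQ.meas).pow_const 2)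
        (fun z => sq_nonneg _) ((hkb.pow 2).integrable (hkm.pow_const 2))
      simpa only [sq] using h1
    refine ⟨⟨hFm, hFb.memLp hFm 2, hFb.memLp hFm 2, hFP, hFQ⟩, ?_, hkQ2⟩
    have hkQ3 : ∫ z, (rP ε z - rQ ε z) ^ 2 ∂(Q ε) ≤ 2 * K * √D / δ * |ε| := by
      rw [div_mul_eq_mul_div, le_div_iff₀' hδ]
      exact hkQ2.trans hFH
    -- The Lipschitz bound applied to `k²` carries the estimate from `Q ε` to `P`, since the fourth
    -- moments of `k` are bounded under both laws.
    have hkP2 : ∫ z, (rP ε z - rQ ε z) ^ 2 ∂P ≤ 2 * K * √D / δ * |ε| + 2 * K * √D * |ε| := by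
      have h1 := hH (fun z => (rP ε z - rQ ε z) ^ 2) (hkm.pow_const 2)
        ((hkb.pow 2).memLp (hkm.pow_const 2) 2) ((hkb.pow 2).memLp (hkm.pow_const 2) 2)
      simp only [← pow_mul] at h1
      have h2 := Real.sqrt_le_sqrt hkP
      have h3 := Real.sqrt_le_sqrt hkQ
      have h4 := (abs_le.1 h1).1
      norm_num at h4
      nlinarith [mul_le_mul_of_nonneg_left (add_le_add h3 h2) (mul_pos hK hε0).le]
    have heP2 : ∫ z, (rP ε z - f ε z) ^ 2 ∂P ≤ √D :=
      (integral_sq_le_sqrt ((heb.pow 2).memLp (hem.pow_const 2) 2)).trans (Real.sqrt_le_sqrt heP)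
    calc ∫ z, |F ε z - 0| ∂P ≤ ∫ z, |(rP ε z - rQ ε z) * (rP ε z - f ε z)| ∂P := by
          refine integral_mono (by simpa using (hFb.integrable hFm).norm)
            ((hkb.mul heb).integrable (hkm.mul hem)).norm fun z => ?_
          simp only [hF, sub_zero]
          rw [abs_mul (w z), abs_of_nonneg (hw0 z)]
          exact mul_le_of_le_one_left (abs_nonneg _) (hw1 z)
      _ ≤ _ := integral_abs_mul_le_sqrt (hkb.memLp hkm 2) (heb.memLp hem 2)
      _ ≤ _ := mul_le_mul (Real.sqrt_le_sqrt hkP2) (Real.sqrt_le_sqrt heP2)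
            (Real.sqrt_nonneg _) (Real.sqrt_nonneg _)
  have hL1 : Tendsto (fun ε => ∫ z, |F ε z - (fun _ => (0 : ℝ)) z| ∂P) (𝓝[≠] 0) (𝓝 0) := by
    refine squeeze_zero' (Eventually.of_forall fun ε => integral_nonneg fun z => abs_nonneg _)
      (main.mono fun ε hε => hε.2.1) ?_
    have := (((tendsto_abs_nhdsNE_nhds_zero.const_mul (2 * K * √D / δ)).add
      (tendsto_abs_nhdsNE_nhds_zero.const_mul (2 * K * √D))).sqrt).mul_const (√(√D))
    simpa using this
  have hslope := h.tendsto_slope_integral ⟨D, hD0, main.mono fun ε hε => hε.1⟩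
    (memLp_const (0 : ℝ)) hL1
  simp only [zero_mul, integral_zero] at hslope
  refine squeeze_zero_norm' ?_ (by simpa using hslope.norm.div_const δ)
  filter_upwards [main] with ε hε
  rw [Real.norm_eq_abs, abs_div, div_right_comm]
  refine div_le_div_of_nonneg_right ?_ (abs_nonneg _)
  rw [le_div_iff₀' hδ, abs_of_nonneg (integral_nonneg fun z => sq_nonneg _)]
  exact hε.2.2

/-- Along a smooth submodel, regressions of a function with values in `[0, 1]` change by `O(ε)` in
mean square. -/
lemma IsSmoothSubmodel.exists_integral_regression_sub_sq_le (h : IsSmoothSubmodel P Q g)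
    (hm : m ≤ m0) (hw : Measurable w) (hw0 : ∀ z, 0 ≤ w z) (hw1 : ∀ z, w z ≤ 1) :
    ∃ C : ℝ, 0 ≤ C ∧ ∀ᶠ ε in 𝓝[≠] (0 : ℝ), ∀ rP rQ : Ω → ℝ, IsRegr P m (fun _ => 1) w rP →
      IsRegr (Q ε) m (fun _ => 1) w rQ → (∀ z, 0 ≤ rP z ∧ rP z ≤ 1) → (∀ z, 0 ≤ rQ z ∧ rQ z ≤ 1) →
      ∫ z, (rP z - rQ z) ^ 2 ∂(Q ε) ≤ C * ε ^ 2 := by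
  have := h.isProbabilityMeasure
  have := h.isProb
  obtain ⟨K, hK, hH⟩ := h.exists_abs_integral_sub_le
  refine ⟨9 * K ^ 2, by positivity, ?_⟩
  filter_upwards [hH] with ε hH rP rQ hrP hrQ hrP1 hrQ1
  have hpm : Measurable rP := hrP.meas.mono hm le_rfl
  have hqm : Measurable rQ := hrQ.meas.mono hm le_rfl
  have hpb : Bdd rP := ⟨1, fun z => abs_le.2 ⟨by linarith [(hrP1 z).1], (hrP1 z).2⟩⟩
  have hqb : Bdd rQ := ⟨1, fun z => abs_le.2 ⟨by linarith [(hrQ1 z).1], (hrQ1 z).2⟩⟩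
  have hwb : Bdd w := ⟨1, fun z => abs_le.2 ⟨by linarith [hw0 z], hw1 z⟩⟩
  set k : Ω → ℝ := fun z => rP z - rQ z with hk
  have hkm : Measurable k := hpm.sub hqm
  have hkb : Bdd k := hpb.sub hqb
  have hk1 : ∀ z, |k z| ≤ 1 := fun z => abs_le.2
    ⟨by simp only [hk]; linarith [(hrP1 z).1, (hrQ1 z).2],
     by simp only [hk]; linarith [(hrP1 z).2, (hrQ1 z).1]⟩
  have he1 : ∀ z, |rP z - w z| ≤ 1 := fun z => abs_le.2
    ⟨by linarith [(hrP1 z).1, hw1 z], by linarith [(hrP1 z).2, hw0 z]⟩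
  -- Again the mean vanishes under `P` and equals `∫ k²` under `Q ε`. As all functions take values
  -- in `[0, 1]`, both `|F|` and `k²` are at most `|k|`, so the Lipschitz bounds involve only the
  -- `L²` norms of `k` and become self-improving.
  set F : Ω → ℝ := fun z => k z * (rP z - w z) with hF
  have hFm : Measurable F := hkm.mul (hpm.sub hw)
  have hFb : Bdd F := hkb.mul (hpb.sub hwb)
  have split : ∀ (ρ : Measure Ω) [IsProbabilityMeasure ρ] {r : Ω → ℝ},
      IsRegr ρ m (fun _ => 1) w r → Bdd r → ∫ z, F z ∂ρ = ∫ z, k z * (rP z - r z) ∂ρ := by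
    intro ρ _ r hr hrb
    have hrm : Measurable r := hr.meas.mono hm le_rfl
    have h1 := hr.char k (hrP.meas.sub hrQ.meas) ((hkb.mul hwb).integrable (hkm.mul hw))
    simp only [one_mul] at h1
    simp only [hF, mul_sub]
    rw [integral_sub ((hkb.mul hpb).integrable (hkm.mul hpm))
      ((hkb.mul hwb).integrable (hkm.mul hw)), integral_sub ((hkb.mul hpb).integrable
      (hkm.mul hpm)) ((hkb.mul hrb).integrable (hkm.mul hrm)), h1]
  have hF0 : ∫ z, F z ∂P = 0 := by rw [split P hrP hpb]; simp
  have hFQ : ∫ z, F z ∂(Q ε) = ∫ z, k z ^ 2 ∂(Q ε) := by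
    rw [split (Q ε) hrQ hqb]; simp only [sq, hk]
  have hle : ∀ (ρ : Measure Ω) [IsProbabilityMeasure ρ] {u : Ω → ℝ}, Measurable u →
      (∀ z, |u z| ≤ |k z|) → √(∫ z, u z ^ 2 ∂ρ) ≤ √(∫ z, k z ^ 2 ∂ρ) := by
    intro ρ _ u hum hu
    refine Real.sqrt_le_sqrt (integral_mono_of_nonneg (ae_of_all _ fun z => sq_nonneg _)
      ((hkb.pow 2).integrable (hkm.pow_const 2)) (ae_of_all _ fun z => sq_le_sq.2 (hu z)))
  have hFk : ∀ z, |F z| ≤ |k z| := fun z => by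
    simp only [hF]; rw [abs_mul]; exact mul_le_of_le_one_right (abs_nonneg _) (he1 z)
  have hkk : ∀ z, |k z ^ 2| ≤ |k z| := fun z => by
    rw [sq, abs_mul]; exact mul_le_of_le_one_right (abs_nonneg _) (hk1 z)
  have h1 := hH F hFm (hFb.memLp hFm 2) (hFb.memLp hFm 2)
  have h2 := hH (fun z => k z ^ 2) (hkm.pow_const 2) ((hkb.pow 2).memLp (hkm.pow_const 2) 2)
    ((hkb.pow 2).memLp (hkm.pow_const 2) 2)
  have hx0 : 0 ≤ ∫ z, k z ^ 2 ∂P := integral_nonneg fun z => sq_nonneg _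
  have hy0 : 0 ≤ ∫ z, k z ^ 2 ∂(Q ε) := integral_nonneg fun z => sq_nonneg _
  rw [hF0, sub_zero, hFQ, abs_of_nonneg hy0] at h1
  have h3 := h1.trans (mul_le_mul_of_nonneg_left (add_le_add (hle (Q ε) hFm hFk) (hle P hFm hFk))
    (by positivity))
  have h4 := h2.trans (mul_le_mul_of_nonneg_left (add_le_add
    (hle (Q ε) (hkm.pow_const 2) hkk) (hle P (hkm.pow_const 2) hkk)) (by positivity))
  have hsx := Real.sq_sqrt hx0
  have hsy := Real.sq_sqrt hy0
  set x := √(∫ z, k z ^ 2 ∂P)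
  set y := √(∫ z, k z ^ 2 ∂(Q ε))
  have hx : 0 ≤ x := Real.sqrt_nonneg _
  have hy : 0 ≤ y := Real.sqrt_nonneg _
  set κ := K * |ε| with hκ
  have hκ0 : 0 ≤ κ := by positivity
  have hκ2 : 9 * K ^ 2 * ε ^ 2 = 9 * κ ^ 2 := by rw [hκ, mul_pow, sq_abs]; ring
  rw [← hsy] at h3
  rw [← hsy, ← hsx] at h4
  -- The norms satisfy `y² ≤ κ(x + y)` and `|y² - x²| ≤ κ(x + y)`. Dividing the second by `x + y`
  -- gives `x ≤ y + κ`, and then `y² ≤ 2κy + κ²` yields `y ≤ 3κ`.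
  have h5 : x ≤ y + κ := by
    by_contra hlt
    push Not at hlt
    have := (abs_le.1 h4).1
    have hxy : 0 < y + x := by linarith
    nlinarith [mul_lt_mul_of_pos_right hlt hxy]
  have h6 : y ≤ 3 * κ := by
    by_contra hlt
    push Not at hlt
    nlinarith [mul_le_mul_of_nonneg_left h5 hκ0]
  rw [hκ2, ← hsy]
  nlinarith

end Perturbation

/-! ### Observations -/

section Observations

variable {d : ℕ}

lemma measurable_covOmit (S : Finset (Fin d)) : Measurable (covOmit S) :=
  measurable_pi_iff.2 fun j => (measurable_pi_apply (j : Fin d)).comp measurable_fst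

lemma covSigma_le (S : Finset (Fin d)) :
    covSigma S ≤ (inferInstance : MeasurableSpace (Obs d)) := (measurable_covOmit S).comap_le

lemma covSigma_le_covSigma_empty (S : Finset (Fin d)) : covSigma S ≤ covSigma (∅ : Finset (Fin d)) := by
  let r : ({j : Fin d // j ∉ (∅ : Finset (Fin d))} → ℝ) → {j : Fin d // j ∉ S} → ℝ :=
    fun x j => x ⟨j, Finset.notMem_empty _⟩
  have hr : Measurable r := by fun_prop
  have h : covSigma S = MeasurableSpace.comap (covOmit ∅) (MeasurableSpace.comap r inferInstance) :=
    (MeasurableSpace.comap_comp (f := r) (g := covOmit ∅)).symm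
  rw [h]
  exact MeasurableSpace.comap_mono hr.comap_le

lemma measurableSet_arm (b : Fin 2) : MeasurableSet {z : Obs d | z.2.1 = b} :=
  (measurable_fst.comp measurable_snd) (measurableSet_singleton b)

lemma expInd_eq_indicator (b : Fin 2) :
    (expInd b : Obs d → ℝ) = {z : Obs d | z.2.1 = b}.indicator fun _ => 1 := by
  ext z; simp [expInd, Set.indicator_apply]

lemma measurable_expInd (b : Fin 2) : Measurable (expInd b : Obs d → ℝ) := by
  rw [expInd_eq_indicator]; exact measurable_const.indicator (measurableSet_arm b)

lemma measurable_outcome : Measurable (outcome : Obs d → ℝ) := measurable_snd.comp measurable_snd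

lemma expInd_nonneg (b : Fin 2) (z : Obs d) : 0 ≤ expInd b z := by unfold expInd; split_ifs <;> simp

lemma expInd_le_one (b : Fin 2) (z : Obs d) : expInd b z ≤ 1 := by unfold expInd; split_ifs <;> simp

lemma abs_expInd_le_one (b : Fin 2) (z : Obs d) : |expInd b z| ≤ 1 := by
  rw [abs_of_nonneg (expInd_nonneg b z)]; exact expInd_le_one b z

lemma bdd_expInd (b : Fin 2) : Bdd (expInd b : Obs d → ℝ) := ⟨1, abs_expInd_le_one b⟩

lemma expInd_zero_add_one (z : Obs d) : expInd 0 z + expInd 1 z = 1 := by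
  unfold expInd
  rcases Fin.exists_fin_two.1 ⟨z.2.1, rfl⟩ with h | h <;> simp [h]

lemma integral_cond_arm (P : Measure (Obs d)) (b : Fin 2) (F : Obs d → ℝ) :
    ∫ z, F z ∂(cond P {z : Obs d | z.2.1 = b})
      = ((P {z : Obs d | z.2.1 = b})⁻¹).toReal * ∫ z, expInd b z * F z ∂P := by
  rw [ProbabilityTheory.cond, integral_smul_measure, smul_eq_mul,
    ← integral_indicator (measurableSet_arm b), expInd_eq_indicator]
  congr 2
  ext z
  by_cases hz : z ∈ {z : Obs d | z.2.1 = b} <;> simp [hz]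

variable {P : Measure (Obs d)} [IsProbabilityMeasure P] {δ : ℝ}

lemma isRegr_propScore (b : Fin 2) (S : Finset (Fin d)) :
    IsRegr P (covSigma S) (fun _ => 1) (expInd b) (propScore P b S) := by
  refine ⟨stronglyMeasurable_condExp.measurable, fun h hh hi => ?_⟩
  have h1 := condExp_mul_of_stronglyMeasurable_left (μ := P) hh.stronglyMeasurable hi
    ((bdd_expInd b).integrable (measurable_expInd b))
  have h2 := integral_condExp (μ := P) (covSigma_le S) (f := h * expInd b)
  simp only [one_mul]
  rw [integral_congr_ae h1] at h2
  exact h2.symm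

/-- Measurable factors are pulled out under the conditional law on the arm, and an integral under
that law is a constant times the integral weighted by `1(A = b)`. On a null arm the weight vanishes
almost everywhere and both sides are zero. -/
lemma isRegr_regr (b : Fin 2) (S : Finset (Fin d)) {f : Obs d → ℝ} (hf : Integrable f P) :
    IsRegr P (covSigma S) (expInd b) f (regr P b S f) := by
  refine ⟨stronglyMeasurable_condExp.measurable, fun h hh hi => ?_⟩
  by_cases h0 : P {z : Obs d | z.2.1 = b} = 0
  · have hz : ∀ᵐ z ∂P, expInd b z = 0 := by
      rw [expInd_eq_indicator]
      filter_upwards [compl_mem_ae_iff.2 h0] with z hz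
      simpa using hz
    exact integral_congr_ae (by filter_upwards [hz] with z hz; simp [hz])
  · have := cond_isProbabilityMeasure (μ := P) h0
    have hint : ∀ {F : Obs d → ℝ}, Integrable F P →
        Integrable F (cond P {z : Obs d | z.2.1 = b}) := fun hF =>
      hF.restrict.smul_measure (ENNReal.inv_ne_top.2 h0)
    have h1 := condExp_mul_of_stronglyMeasurable_left (μ := cond P {z : Obs d | z.2.1 = b})
      hh.stronglyMeasurable (hint hi) (hint hf)
    have h2 := integral_condExp (μ := cond P {z : Obs d | z.2.1 = b}) (covSigma_le S) (f := h * f)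
    rw [integral_congr_ae h1] at h2
    simp only [Pi.mul_apply] at h2
    rw [integral_cond_arm, integral_cond_arm] at h2
    have hc : ((P {z : Obs d | z.2.1 = b})⁻¹).toReal ≠ 0 :=
      (ENNReal.toReal_pos (ENNReal.inv_ne_zero.2 (measure_ne_top _ _)) (ENNReal.inv_ne_top.2 h0)).ne'
    exact (mul_left_cancel₀ hc h2).symm

lemma propScore_nonneg_le_one (b : Fin 2) (S : Finset (Fin d)) :
    ∀ᵐ z ∂P, 0 ≤ propScore P b S z ∧ propScore P b S z ≤ 1 := by
  have hi : Integrable (expInd b : Obs d → ℝ) P := (bdd_expInd b).integrable (measurable_expInd b)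
  have h0 : 0 ≤ᵐ[P] propScore P b S := condExp_nonneg (ae_of_all _ (expInd_nonneg b))
  have h1 := condExp_mono (m := covSigma S) hi (integrable_const (1 : ℝ))
    (ae_of_all P (expInd_le_one b))
  rw [condExp_const (covSigma_le S)] at h1
  filter_upwards [h0, h1] with z hz0 hz1 using ⟨hz0, hz1⟩

lemma propScore_zero_add_one (S : Finset (Fin d)) :
    ∀ᵐ z ∂P, propScore P 0 S z + propScore P 1 S z = 1 := by
  have hi : ∀ b, Integrable (expInd b : Obs d → ℝ) P := fun b =>
    (bdd_expInd b).integrable (measurable_expInd b)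
  have h1 := condExp_add (hi 0) (hi 1) (covSigma S)
  have h2 : (expInd 0 + expInd 1 : Obs d → ℝ) = fun _ => 1 := funext expInd_zero_add_one
  rw [h2, condExp_const (covSigma_le _)] at h1
  exact h1.symm

/-- The other arm is handled by `π₀ + π₁ = 1`, and smaller sets of covariates by the tower property,
which preserves constant lower bounds. -/
lemma PositivityWith.le_propScore (h : PositivityWith δ P) (b : Fin 2) (S : Finset (Fin d)) :
    ∀ᵐ z ∂P, δ ≤ propScore P b S z := by
  have hX : ∀ᵐ z ∂P, δ ≤ propScore P b ∅ z := by
    filter_upwards [h, propScore_zero_add_one (P := P) ∅] with z hz hs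
    rcases Fin.exists_fin_two.1 ⟨b, rfl⟩ with hb | hb <;> subst hb <;> linarith [hz.1, hz.2]
  have h1 := condExp_mono (m := covSigma S) (integrable_const δ)
    (integrable_condExp (m := covSigma (∅ : Finset (Fin d))) (μ := P) (f := expInd b)) hX
  rw [condExp_const (covSigma_le S)] at h1
  filter_upwards [h1, condExp_condExp_of_le (μ := P) (f := expInd b) (covSigma_le_covSigma_empty S)
    (covSigma_le _)] with z hz1 hz2
  rw [hz2] at hz1
  exact hz1

lemma PositivityWith.le_one (h : PositivityWith δ P) : δ ≤ 1 := by
  obtain ⟨z, hz1, hz2⟩ := ((h.le_propScore 0 ∅).and (propScore_nonneg_le_one 0 ∅)).exists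
  linarith [hz2.2]

lemma PositivityWith.weightPos (h : PositivityWith δ P) (b : Fin 2) (S : Finset (Fin d)) :
    WeightPos δ P (covSigma S) (expInd b) := by
  intro k hk hk0 hki
  have h1 := (isRegr_propScore (P := P) b S).char k hk (by
    exact hki.mul_bdd (c := 1) (measurable_expInd b).aestronglyMeasurable
      (ae_of_all _ (abs_expInd_le_one b)))
  simp only [one_mul, mul_comm (k _)] at h1
  rw [h1, ← integral_const_mul]
  have hb := propScore_nonneg_le_one (P := P) b S
  refine integral_mono_ae (hki.const_mul δ) (hki.bdd_mul (c := 1)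
    (stronglyMeasurable_condExp.mono (covSigma_le S)).aestronglyMeasurable ?_) ?_
  · filter_upwards [hb] with z hz
    rw [Real.norm_eq_abs, abs_of_nonneg hz.1]; exact hz.2
  · filter_upwards [h.le_propScore b S] with z hz
    exact mul_le_mul_of_nonneg_right hz (hk0 z)

/-- Positivity gives `δ P(s) ≤ P(A = b, s)` for events `s` of the covariates, and conditioning only
divides by a number at most `1`. This domination carries almost-everywhere and `L^p` statements
about `regr` from the conditional law, where it is defined, to `P`. -/
lemma PositivityWith.trim_le_cond (h : PositivityWith δ P) (hδ : 0 < δ) (b : Fin 2)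
    (S : Finset (Fin d)) :
    P.trim (covSigma_le S)
      ≤ ENNReal.ofReal δ⁻¹ • (cond P {z : Obs d | z.2.1 = b}).trim (covSigma_le S) := by
  refine Measure.le_iff.2 fun s hs => ?_
  have hs' := covSigma_le S s hs
  rw [Measure.smul_apply, trim_measurableSet_eq _ hs, trim_measurableSet_eq _ hs, smul_eq_mul,
    cond_apply (measurableSet_arm b)]
  have h1 := h.weightPos b S (s.indicator fun _ => 1) (measurable_const.indicator hs)
    (fun z => Set.indicator_nonneg (fun _ _ => zero_le_one) z)
    ((integrable_const (1 : ℝ)).indicator hs')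
  have h2 : ∀ z, expInd b z * s.indicator (fun _ => (1 : ℝ)) z
      = ({z : Obs d | z.2.1 = b} ∩ s).indicator (fun _ => 1) z := fun z => by
    rw [expInd_eq_indicator]
    by_cases ha : z.2.1 = b <;> by_cases hz : z ∈ s <;> simp [ha, hz]
  simp only [h2] at h1
  rw [integral_indicator_const _ hs', integral_indicator_const _ ((measurableSet_arm b).inter hs'),
    smul_eq_mul, smul_eq_mul, mul_one, mul_one] at h1
  have h3 : P s ≤ ENNReal.ofReal δ⁻¹ * P ({z : Obs d | z.2.1 = b} ∩ s) := by
    rw [← ofReal_measureReal (μ := P) (s := s), ← ofReal_measureReal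
      (μ := P) (s := {z : Obs d | z.2.1 = b} ∩ s), ← ENNReal.ofReal_mul (by positivity)]
    refine ENNReal.ofReal_le_ofReal ?_
    rw [inv_mul_eq_div, le_div_iff₀' hδ]
    exact h1
  refine h3.trans ?_
  gcongr
  exact le_mul_of_one_le_left zero_le (ENNReal.one_le_inv.2 prob_le_one)

lemma PositivityWith.ae_of_ae_cond (h : PositivityWith δ P) (hδ : 0 < δ) {b : Fin 2}
    {S : Finset (Fin d)} {p : Obs d → Prop} (hp : MeasurableSet[covSigma S] {z | p z})
    (hc : ∀ᵐ z ∂(cond P {z : Obs d | z.2.1 = b}), p z) : ∀ᵐ z ∂P, p z := by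
  have h1 := h.trim_le_cond hδ b S {z | p z}ᶜ
  rw [Measure.smul_apply, trim_measurableSet_eq _ hp.compl, trim_measurableSet_eq _ hp.compl] at h1
  have h2 : cond P {z : Obs d | z.2.1 = b} {z | p z}ᶜ = 0 := hc
  rw [h2, smul_zero] at h1
  exact le_antisymm h1 zero_le

lemma PositivityWith.ae_eq_of_ae_eq_cond (h : PositivityWith δ P) (hδ : 0 < δ) {b : Fin 2}
    {S : Finset (Fin d)} {r r' : Obs d → ℝ} (hr : Measurable[covSigma S] r)
    (hr' : Measurable[covSigma S] r') (hc : r =ᵐ[cond P {z : Obs d | z.2.1 = b}] r') :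
    r =ᵐ[P] r' :=
  h.ae_of_ae_cond hδ (measurableSet_eq_fun hr hr') hc

lemma memLp_cond {P : Measure (Obs d)} {b : Fin 2} {f : Obs d → ℝ} {p : ℝ≥0∞} (hf : MemLp f p P)
    (h0 : P {z : Obs d | z.2.1 = b} ≠ 0) : MemLp f p (cond P {z : Obs d | z.2.1 = b}) :=
  hf.restrict _ |>.smul_measure (ENNReal.inv_ne_top.2 h0)

lemma PositivityWith.measure_arm_ne_zero (h : PositivityWith δ P) (hδ : 0 < δ) (b : Fin 2) :
    P {z : Obs d | z.2.1 = b} ≠ 0 := by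
  intro h0
  -- Conditioning on a null arm gives the zero measure, under which even `False` holds almost
  -- everywhere; transferring this to the probability measure `P` is absurd.
  have h1 := h.ae_of_ae_cond hδ (b := b) (S := ∅) (p := fun _ => False) (by simp)
    (by rw [cond_eq_zero_of_meas_eq_zero h0]; simp)
  exact h1.exists.elim fun _ h => h

lemma measurable_regr (P : Measure (Obs d)) (b : Fin 2) (S : Finset (Fin d)) (f : Obs d → ℝ) :
    Measurable[covSigma S] (regr P b S f) := stronglyMeasurable_condExp.measurable

lemma measurable_propScore (P : Measure (Obs d)) (b : Fin 2) (S : Finset (Fin d)) :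
    Measurable[covSigma S] (propScore P b S) := stronglyMeasurable_condExp.measurable

lemma PositivityWith.memLp_regr (h : PositivityWith δ P) (hδ : 0 < δ) (b : Fin 2)
    (S : Finset (Fin d)) {f : Obs d → ℝ} {p : ℝ≥0∞} (hp : 1 ≤ p) (hf : MemLp f p P) :
    MemLp (regr P b S f) p P := by
  have h1 : MemLp (regr P b S f) p (cond P {z : Obs d | z.2.1 = b}) :=
    (memLp_cond hf (h.measure_arm_ne_zero hδ b)).condExp hp
  have hm : StronglyMeasurable[covSigma S] (regr P b S f) := stronglyMeasurable_condExp
  have h2 : MemLp (regr P b S f) p ((cond P {z : Obs d | z.2.1 = b}).trim (covSigma_le S)) :=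
    ⟨hm.aestronglyMeasurable, by rw [eLpNorm_trim _ hm]; exact h1.2⟩
  exact memLp_of_memLp_trim _ (h2.of_measure_le_smul ENNReal.ofReal_ne_top (h.trim_le_cond hδ b S))

lemma PositivityWith.regr_sub (h : PositivityWith δ P) (hδ : 0 < δ) (b : Fin 2)
    (S : Finset (Fin d)) {f f' : Obs d → ℝ} (hf : Integrable f P) (hf' : Integrable f' P) :
    regr P b S (fun z => f z - f' z) =ᵐ[P] fun z => regr P b S f z - regr P b S f' z := by
  have h0 := h.measure_arm_ne_zero hδ b
  refine h.ae_eq_of_ae_eq_cond hδ (b := b) (measurable_regr _ _ _ _)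
    ((measurable_regr _ _ _ _).sub (measurable_regr _ _ _ _)) ?_
  exact condExp_sub (memLp_one_iff_integrable.1 (memLp_cond (memLp_one_iff_integrable.2 hf) h0))
    (memLp_one_iff_integrable.1 (memLp_cond (memLp_one_iff_integrable.2 hf') h0)) _

lemma PositivityWith.abs_regr_le (h : PositivityWith δ P) (hδ : 0 < δ) (b : Fin 2)
    (S : Finset (Fin d)) {f : Obs d → ℝ} {M : ℝ} (hf : ∀ z, |f z| ≤ M) :
    ∀ᵐ z ∂P, |regr P b S f z| ≤ M :=
  h.ae_of_ae_cond hδ (measurableSet_le ((measurable_regr P b S f).max (measurable_regr P b S f).neg)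
      measurable_const)
    (ae_bdd_abs_condExp_of_ae_bdd_abs (ae_of_all _ hf))

/-- The point of `[l, u]` nearest to `x`. -/
def clip (l u x : ℝ) : ℝ := max l (min u x)

lemma clip_mem {l u : ℝ} (h : l ≤ u) (x : ℝ) : l ≤ clip l u x ∧ clip l u x ≤ u :=
  ⟨le_max_left _ _, max_le h (min_le_left _ _)⟩

lemma clip_eq_self {l u x : ℝ} (hl : l ≤ x) (hu : x ≤ u) : clip l u x = x := by
  rw [clip, min_eq_right hu, max_eq_right hl]

lemma abs_clip_le {M : ℝ} (hM : 0 ≤ M) (x : ℝ) : |clip (-M) M x| ≤ M :=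
  abs_le.2 (clip_mem (by linarith) x)

lemma abs_clip_le_abs {M : ℝ} (hM : 0 ≤ M) (x : ℝ) : |clip (-M) M x| ≤ |x| := by
  unfold clip
  rcases le_total M x with h | h
  · rw [min_eq_left h, max_eq_right (by linarith), abs_of_nonneg hM]; exact h.trans (le_abs_self x)
  · rw [min_eq_right h]
    rcases le_total (-M) x with h' | h'
    · rw [max_eq_right h']
    · rw [max_eq_left h', abs_neg, abs_of_nonneg hM, abs_of_nonpos (by linarith)]; linarith

lemma measurable_clip (l u : ℝ) : Measurable (clip l u) := by unfold clip; fun_prop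

/-- The propensity score, clipped to `[l, 1]`. -/
def clippedPropScore (l : ℝ) (P : Measure (Obs d)) (b : Fin 2) (S : Finset (Fin d)) (z : Obs d) :
    ℝ := clip l 1 (propScore P b S z)

/-- The regression function, clipped to `[-M, M]`. -/
def clippedRegr (M : ℝ) (P : Measure (Obs d)) (b : Fin 2) (S : Finset (Fin d)) (f : Obs d → ℝ)
    (z : Obs d) : ℝ := clip (-M) M (regr P b S f z)

lemma measurable_clippedPropScore (l : ℝ) (P : Measure (Obs d)) (b : Fin 2) (S : Finset (Fin d)) :
    Measurable[covSigma S] (clippedPropScore l P b S) :=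
  (measurable_clip l 1).comp (measurable_propScore P b S)

lemma measurable_clippedRegr (M : ℝ) (P : Measure (Obs d)) (b : Fin 2) (S : Finset (Fin d))
    (f : Obs d → ℝ) : Measurable[covSigma S] (clippedRegr M P b S f) :=
  (measurable_clip (-M) M).comp (measurable_regr P b S f)

/-- Clipped versions satisfy their bounds at every point, under any measure, while agreeing almost
everywhere with the originals. Level `0` needs no positivity; level `δ` also makes division safe. -/
lemma clippedPropScore_zero_ae_eq (b : Fin 2) (S : Finset (Fin d)) :
    clippedPropScore 0 P b S =ᵐ[P] propScore P b S := by
  filter_upwards [propScore_nonneg_le_one (P := P) b S] with z hz using clip_eq_self hz.1 hz.2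

lemma PositivityWith.clippedPropScore_ae_eq (h : PositivityWith δ P) (b : Fin 2)
    (S : Finset (Fin d)) : clippedPropScore δ P b S =ᵐ[P] propScore P b S := by
  filter_upwards [propScore_nonneg_le_one (P := P) b S, h.le_propScore b S] with z hz hz'
    using clip_eq_self hz' hz.2

lemma PositivityWith.clippedRegr_ae_eq (h : PositivityWith δ P) (hδ : 0 < δ) (b : Fin 2)
    (S : Finset (Fin d)) {f : Obs d → ℝ} {M : ℝ} (hf : ∀ z, |f z| ≤ M) :
    clippedRegr M P b S f =ᵐ[P] regr P b S f := by
  filter_upwards [h.abs_regr_le hδ b S hf] with z hz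
    using clip_eq_self (abs_le.1 hz).1 (abs_le.1 hz).2

lemma isRegr_clippedPropScore_zero (b : Fin 2) (S : Finset (Fin d)) :
    IsRegr P (covSigma S) (fun _ => 1) (expInd b) (clippedPropScore 0 P b S) :=
  (isRegr_propScore b S).congr (measurable_clippedPropScore _ _ _ _)
    (clippedPropScore_zero_ae_eq b S)

lemma PositivityWith.isRegr_clippedPropScore (h : PositivityWith δ P) (b : Fin 2)
    (S : Finset (Fin d)) :
    IsRegr P (covSigma S) (fun _ => 1) (expInd b) (clippedPropScore δ P b S) :=
  (isRegr_propScore b S).congr (measurable_clippedPropScore _ _ _ _)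
    (h.clippedPropScore_ae_eq b S)

lemma PositivityWith.isRegr_clippedRegr (h : PositivityWith δ P) (hδ : 0 < δ) (b : Fin 2)
    (S : Finset (Fin d)) {f : Obs d → ℝ} {M : ℝ} (hf : ∀ z, |f z| ≤ M) (hfm : Measurable f) :
    IsRegr P (covSigma S) (expInd b) f (clippedRegr M P b S f) :=
  (isRegr_regr b S (Bdd.integrable ⟨M, hf⟩ hfm)).congr (measurable_clippedRegr _ _ _ _ _)
    (h.clippedRegr_ae_eq hδ b S hf)

end Observations

/-! ### The squared norm of the propensity score -/

section Propensity

variable {d : ℕ} {P : Measure (Obs d)}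

lemma abs_clippedPropScore_le_one (P : Measure (Obs d)) {l : ℝ} (hl0 : 0 ≤ l) (hl : l ≤ 1)
    (b : Fin 2) (S : Finset (Fin d)) (z : Obs d) : |clippedPropScore l P b S z| ≤ 1 :=
  abs_le.2 ⟨by linarith [show l ≤ clippedPropScore l P b S z from (clip_mem hl _).1],
    (clip_mem hl _).2⟩

/-- An event of `covSigma S` is the preimage of a set of covariate values, so its null sets depend
only on the law of `X`. -/
lemma ae_of_map_fst_absolutelyContinuous {P' : Measure (Obs d)}
    (hac : P.map Prod.fst ≪ P'.map Prod.fst) {S : Finset (Fin d)} {p : Obs d → Prop}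
    (hp : MeasurableSet[covSigma S] {z | p z}) (h : ∀ᵐ z ∂P', p z) : ∀ᵐ z ∂P, p z := by
  obtain ⟨T, hT, hTp⟩ := hp
  have hr : Measurable fun (x : Fin d → ℝ) (j : {j : Fin d // j ∉ S}) => x j := by fun_prop
  have hU := hr hT
  have e : {z | p z} = Prod.fst ⁻¹' ((fun (x : Fin d → ℝ) (j : {j : Fin d // j ∉ S}) => x j) ⁻¹' T) :=
    hTp.symm
  have h1 : P'.map Prod.fst ((fun (x : Fin d → ℝ) (j : {j : Fin d // j ∉ S}) => x j) ⁻¹' T)ᶜ = 0 := by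
    rw [Measure.map_apply measurable_fst hU.compl, Set.preimage_compl, ← e]; exact h
  have h2 := hac h1
  rw [Measure.map_apply measurable_fst hU.compl, Set.preimage_compl, ← e] at h2
  exact h2

lemma ae_eq_of_map_fst_absolutelyContinuous {P' : Measure (Obs d)}
    (hac : P.map Prod.fst ≪ P'.map Prod.fst) {S : Finset (Fin d)} {r r' : Obs d → ℝ}
    (hr : Measurable[covSigma S] r) (hr' : Measurable[covSigma S] r') (h : r =ᵐ[P'] r') :
    r =ᵐ[P] r' :=
  ae_of_map_fst_absolutelyContinuous hac (measurableSet_eq_fun hr hr') h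

variable [IsProbabilityMeasure P]

/-- The expansion of `propNormSq` with an arbitrary approximation `q` of the propensity score. -/
lemma integral_propensity_expansion (a : Fin 2) {q : Obs d → ℝ} (hq : Measurable[covSigma ∅] q)
    (hq1 : ∀ z, |q z| ≤ 1) :
    ∫ z, (q z ^ 2 + 2 * q z * (expInd a z - q z)) ∂P
      = propNormSq a P - ∫ z, (q z - clippedPropScore 0 P a ∅ z) ^ 2 ∂P := by
  set π := clippedPropScore 0 P a ∅ with hπ
  have hr : IsRegr P (covSigma ∅) (fun _ => 1) (expInd a) π := isRegr_clippedPropScore_zero a ∅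
  have hψ : propNormSq a P = ∫ z, π z ^ 2 ∂P := integral_congr_ae (by
    filter_upwards [clippedPropScore_zero_ae_eq (P := P) a ∅] with z hz; rw [hπ, hz])
  have hqb : Bdd q := ⟨1, hq1⟩
  have hqm : Measurable q := hq.mono (covSigma_le _) le_rfl
  have hπb : Bdd π := ⟨1, abs_clippedPropScore_le_one P le_rfl zero_le_one a ∅⟩
  have hπm : Measurable π := hr.meas.mono (covSigma_le _) le_rfl
  have hem := measurable_expInd (d := d) a
  have i1 : Integrable (fun z => q z ^ 2) P := (hqb.pow 2).integrable (hqm.pow_const 2)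
  have i2 : Integrable (fun z => q z * expInd a z) P :=
    (hqb.mul (bdd_expInd a)).integrable (hqm.mul hem)
  have i3 : Integrable (fun z => q z * π z) P := (hqb.mul hπb).integrable (hqm.mul hπm)
  have i4 : Integrable (fun z => π z ^ 2) P := (hπb.pow 2).integrable (hπm.pow_const 2)
  have h1 := hr.char q hq i2
  simp only [one_mul] at h1
  have e1 : ∀ z, q z ^ 2 + 2 * q z * (expInd a z - q z) = 2 * (q z * expInd a z) - q z ^ 2 :=
    fun z => by ring
  have e2 : ∀ z, (q z - π z) ^ 2 = π z ^ 2 - (2 * (q z * π z) - q z ^ 2) := fun z => by ring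
  have i5 : Integrable (fun z => 2 * (q z * π z) - q z ^ 2) P := (i3.const_mul 2).sub i1
  simp only [e1, e2]
  rw [integral_sub (i2.const_mul 2) i1, integral_sub i4 i5, integral_sub (i3.const_mul 2) i1,
    integral_const_mul, integral_const_mul, h1, hψ]
  ring

lemma vonMisesRemainder_propNormSq (a : Fin 2) {P' : Measure (Obs d)} [IsProbabilityMeasure P']
    (hac : P.map Prod.fst ≪ P'.map Prod.fst) :
    vonMisesRemainder (propNormSq a) (xiEIF a) P' P =
      -∫ z, (propScore P' a ∅ z - propScore P a ∅ z) ^ 2 ∂P := by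
  have hP' : clippedPropScore 0 P' a ∅ =ᵐ[P'] propScore P' a ∅ := clippedPropScore_zero_ae_eq a ∅
  have hP : clippedPropScore 0 P' a ∅ =ᵐ[P] propScore P' a ∅ :=
    ae_eq_of_map_fst_absolutelyContinuous hac (measurable_clippedPropScore _ _ _ _)
      (measurable_propScore _ _ _) hP'
  have h1 := integral_propensity_expansion (P := P) a (measurable_clippedPropScore 0 P' a ∅)
    (abs_clippedPropScore_le_one P' le_rfl zero_le_one a ∅)
  have h2 := integral_propensity_expansion (P := P') a (measurable_clippedPropScore 0 P' a ∅)
    (abs_clippedPropScore_le_one P' le_rfl zero_le_one a ∅)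
  have e1 : ∫ z, xiEIF a P' z ∂P = ∫ z, (clippedPropScore 0 P' a ∅ z ^ 2
      + 2 * clippedPropScore 0 P' a ∅ z * (expInd a z - clippedPropScore 0 P' a ∅ z)) ∂P :=
    integral_congr_ae (by filter_upwards [hP] with z hz; rw [hz, xiEIF])
  have e2 : ∫ z, xiEIF a P' z ∂P' = ∫ z, (clippedPropScore 0 P' a ∅ z ^ 2
      + 2 * clippedPropScore 0 P' a ∅ z * (expInd a z - clippedPropScore 0 P' a ∅ z)) ∂P' :=
    integral_congr_ae (by filter_upwards [hP'] with z hz; rw [hz, xiEIF])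
  have e3 : ∫ z, (propScore P' a ∅ z - propScore P a ∅ z) ^ 2 ∂P
      = ∫ z, (clippedPropScore 0 P' a ∅ z - clippedPropScore 0 P a ∅ z) ^ 2 ∂P :=
    integral_congr_ae (by
      filter_upwards [hP, clippedPropScore_zero_ae_eq (P := P) a ∅] with z hz hz'; rw [hz, hz'])
  rw [vonMisesRemainder, e1, e2, e3, h1, h2]
  simp

lemma hasDerivAt_zero_of_expansion {ψ A r : ℝ → ℝ} {L : ℝ}
    (h : ∀ᶠ ε in 𝓝[≠] (0 : ℝ), ψ ε - ψ 0 = A ε + r ε)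
    (hA : Tendsto (fun ε => A ε / ε) (𝓝[≠] 0) (𝓝 L))
    (hr : Tendsto (fun ε => r ε / ε) (𝓝[≠] 0) (𝓝 0)) : HasDerivAt ψ L 0 := by
  rw [hasDerivAt_iff_tendsto_slope]
  have := hA.add hr
  rw [add_zero] at this
  refine this.congr' ?_
  filter_upwards [h] with ε hε
  rw [slope_def_field, hε, sub_zero, add_div]

/-- The expansion under `Q ε` with `q = π_a` of `P` has remainder `∫ (π - π_ε)² dQ_ε = O(ε²)`, and
`ξ_a` agrees almost everywhere with a bounded function, so no truncation is needed. -/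
lemma isUncenteredEIF_propNormSq (a : Fin 2) :
    IsUncenteredEIF (fun _ => True) (propNormSq a) P (xiEIF a P) := by
  set π := clippedPropScore 0 P a ∅ with hπ
  have hπm' : Measurable[covSigma ∅] π := measurable_clippedPropScore _ _ _ _
  have hπm : Measurable π := hπm'.mono (covSigma_le _) le_rfl
  have hπ1 : ∀ z, |π z| ≤ 1 := abs_clippedPropScore_le_one P le_rfl zero_le_one a ∅
  have hπb : Bdd π := ⟨1, hπ1⟩
  set ξ : Obs d → ℝ := fun z => π z ^ 2 + 2 * π z * (expInd a z - π z) with hξ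
  have hξm : Measurable ξ := by
    have := measurable_expInd (d := d) a
    fun_prop
  have hξb : Bdd ξ := (hπb.pow 2).add ((Bdd.mul (f := fun _ => 2) ⟨2, by simp⟩ hπb).mul
    ((bdd_expInd a).sub hπb))
  have hξξ : xiEIF a P =ᵐ[P] ξ := by
    filter_upwards [clippedPropScore_zero_ae_eq (P := P) a ∅] with z hz
    simp only [hξ, hπ, hz, xiEIF]
  have h0 : ∫ z, ξ z ∂P = propNormSq a P := by
    have := integral_propensity_expansion (P := P) a hπm' hπ1
    rw [← hπ] at this
    simpa using this
  refine isUncenteredEIF_of_pathwise (fun b N hb hN hb0 => ⟨tilt P b N, trivial,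
    isSmoothSubmodel_tilt hb hN hb0⟩) ((hξb.memLp hξm 2).ae_eq hξξ.symm)
    ((integral_congr_ae hξξ).trans h0) fun Q g _ hQ => ?_
  have := hQ.isProb
  have hg : ∫ z, xiEIF a P z * g z ∂P = ∫ z, ξ z * g z ∂P :=
    integral_congr_ae (by filter_upwards [hξξ] with z hz; rw [hz])
  rw [hg]
  obtain ⟨B, hB⟩ := hξb
  have hslope := hQ.tendsto_slope_integral (f := fun _ => ξ) (f₀ := ξ)
    (L2Bounded.of_abs_le (C := B) (fun _ => hξm) (fun _ => hB)) (Bdd.memLp ⟨B, hB⟩ hξm 2) (by simp)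
  obtain ⟨C, hC, hrem⟩ := hQ.exists_integral_regression_sub_sq_le (covSigma_le ∅)
    (measurable_expInd a) (expInd_nonneg a) (expInd_le_one a)
  refine hasDerivAt_zero_of_expansion
    (r := fun ε => ∫ z, (π z - clippedPropScore 0 (Q ε) a ∅ z) ^ 2 ∂(Q ε))
    (Eventually.of_forall fun ε => ?_) hslope ?_
  · have := integral_propensity_expansion (P := Q ε) a hπm' hπ1
    rw [h0, hQ.base]
    linarith
  · have hlim : Tendsto (fun ε : ℝ => C * |ε|) (𝓝[≠] 0) (𝓝 0) := by
      simpa using tendsto_abs_nhdsNE_nhds_zero.const_mul C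
    refine squeeze_zero_norm' ?_ hlim
    filter_upwards [hrem, self_mem_nhdsWithin] with ε hε hε0
    have hε0 : 0 < |ε| := abs_pos.2 hε0
    rw [Real.norm_eq_abs, abs_div, abs_of_nonneg (integral_nonneg fun z => sq_nonneg _),
      div_le_iff₀ hε0, mul_assoc, ← sq, sq_abs]
    exact hε _ _ (isRegr_clippedPropScore_zero a ∅) (isRegr_clippedPropScore_zero a ∅)
      (fun z => clip_mem zero_le_one _) (fun z => clip_mem zero_le_one _)

end Propensity

/-! ### The von Mises remainder of `gapNormSq` -/

section GapRemainder

variable {d : ℕ}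

lemma PositivityWith.mono {P : Measure (Obs d)} {δ δ' : ℝ} (h : PositivityWith δ P) (hδ : δ' ≤ δ) : PositivityWith δ' P := by
  filter_upwards [h] with z hz
  constructor <;> linarith [hz.1, hz.2]

variable {P : Measure (Obs d)} [IsProbabilityMeasure P] {δ : ℝ}

/-- The expansion of `gapNormSq`, with propensity scores and regressions `ν` of `P'`. -/
lemma PositivityWith.integral_lambdaEIF (h : PositivityWith δ P) (hδ : 0 < δ)
    {P' : Measure (Obs d)} [IsProbabilityMeasure P'] (h' : PositivityWith δ P')
    (hac : P.map Prod.fst ≪ P'.map Prod.fst) (a : Fin 2) (S : Finset (Fin d))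
    (hY : MemLp outcome 2 P) (hX : MemLp (outReg P' a ∅) 2 P) (hS : MemLp (outReg P' a S) 2 P)
    (hc : MemLp (crossReg P' a S) 2 P) :
    ∫ z, lambdaEIF a S P' z ∂P = gapNormSq a S P
      + ∫ z, (-(outGap P' a S z - outGap P a S z) ^ 2 + 2 * errorProducts a S P' P z) ∂P := by
  have hδ1 := h.le_one
  have hq : ∀ b T, clippedPropScore δ P' b T =ᵐ[P] propScore P' b T := fun b T =>
    ae_eq_of_map_fst_absolutelyContinuous hac (measurable_clippedPropScore _ _ _ _)
      (measurable_propScore _ _ _) (h'.clippedPropScore_ae_eq b T)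
  have hp : ∀ b T, clippedPropScore δ P b T =ᵐ[P] propScore P b T := fun b T =>
    h.clippedPropScore_ae_eq b T
  have b1 : ∀ (R : Measure (Obs d)) b T z, |clippedPropScore δ R b T z| ≤ 1 := fun R b T z =>
    abs_clippedPropScore_le_one R hδ.le hδ1 b T z
  have b2 : ∀ (R : Measure (Obs d)) b T z, δ ≤ clippedPropScore δ R b T z := fun R b T z =>
    (clip_mem hδ1 _).1
  have hμX : MemLp (outReg P a ∅) 2 P := h.memLp_regr hδ a ∅ one_le_two hY
  have hμS : MemLp (outReg P a S) 2 P := h.memLp_regr hδ a S one_le_two hY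
  have key := integral_gap_expansion (P := P) (covSigma_le_covSigma_empty S) (covSigma_le ∅)
    (f := outcome) hδ (measurable_expInd a) (measurable_expInd (1 - a)) (abs_expInd_le_one a)
    (abs_expInd_le_one (1 - a)) (h.isRegr_clippedPropScore a S) (h.isRegr_clippedPropScore a ∅)
    (h.isRegr_clippedPropScore (1 - a) S) (h.isRegr_clippedPropScore (1 - a) ∅)
    (b1 _ _ _) (b1 _ _ _) (b1 _ _ _) (b1 _ _ _) (b2 _ _ _)
    (isRegr_regr a S (hY.integrable one_le_two)) (isRegr_regr a ∅ (hY.integrable one_le_two))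
    (isRegr_regr (1 - a) S (hμX.integrable one_le_two))
    (isRegr_regr (1 - a) S (hX.integrable one_le_two))
    (measurable_clippedPropScore δ P' a S) (measurable_clippedPropScore δ P' a ∅)
    (measurable_clippedPropScore δ P' (1 - a) S) (measurable_clippedPropScore δ P' (1 - a) ∅)
    (b2 _ _ _) (b2 _ _ _) (b2 _ _ _) (b1 _ _ _) (measurable_regr P' a ∅ outcome)
    (measurable_regr P' a S outcome) (measurable_regr P' (1 - a) S (outReg P' a ∅))
    hY hμX hμS (h.memLp_regr hδ _ _ one_le_two hμX) (h.memLp_regr hδ _ _ one_le_two hX) hX hS hc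
  refine Eq.trans (integral_congr_ae ?_) (key.trans ?_)
  · filter_upwards [hq a S, hq a ∅, hq (1 - a) S, hq (1 - a) ∅] with z h1 h2 h3 h4
    simp only [h1, h2, h3, h4]
    rfl
  · congr 1
    refine integral_congr_ae ?_
    filter_upwards [hq a S, hq a ∅, hq (1 - a) S, hq (1 - a) ∅, hp a S, hp a ∅, hp (1 - a) S,
      hp (1 - a) ∅] with z h1 h2 h3 h4 h5 h6 h7 h8
    simp only [h1, h2, h3, h4, h5, h6, h7, h8]
    rfl

lemma PositivityWith.integral_lambdaEIF_self (h : PositivityWith δ P) (hδ : 0 < δ) (a : Fin 2)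
    (S : Finset (Fin d)) (hY : MemLp outcome 2 P) :
    ∫ z, lambdaEIF a S P z ∂P = gapNormSq a S P := by
  have hX : MemLp (outReg P a ∅) 2 P := h.memLp_regr hδ a ∅ one_le_two hY
  rw [h.integral_lambdaEIF hδ h (Measure.AbsolutelyContinuous.refl _) a S hY hX
    (h.memLp_regr hδ a S one_le_two hY) (h.memLp_regr hδ _ S one_le_two hX)]
  have : ∀ z, errorProducts a S P P z = 0 := fun z => by
    simp only [errorProducts, crossReg]; ring
  simp [this]

lemma vonMisesRemainder_gapNormSq {P' : Measure (Obs d)} [IsProbabilityMeasure P']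
    (hpos : Positivity P) (hpos' : Positivity P') (hac : P.map Prod.fst ≪ P'.map Prod.fst)
    (a : Fin 2) (S : Finset (Fin d)) (hY : MemLp outcome 2 P) (hY' : MemLp outcome 2 P')
    (hX : MemLp (outReg P' a ∅) 2 P) (hS : MemLp (outReg P' a S) 2 P)
    (hc : MemLp (crossReg P' a S) 2 P) :
    vonMisesRemainder (gapNormSq a S) (lambdaEIF a S) P' P =
      ∫ z, (-(outGap P' a S z - outGap P a S z) ^ 2 + 2 * errorProducts a S P' P z) ∂P := by
  obtain ⟨δ₁, hδ₁, h₁⟩ := hpos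
  obtain ⟨δ₂, hδ₂, h₂⟩ := hpos'
  -- The expansion clips the propensity scores of both laws at one common level.
  have hδ : 0 < min δ₁ δ₂ := lt_min hδ₁ hδ₂
  have h := h₁.mono (min_le_left δ₁ δ₂)
  have h' := h₂.mono (min_le_right δ₁ δ₂)
  rw [vonMisesRemainder, h.integral_lambdaEIF hδ h' hac a S hY hX hS hc,
    h'.integral_lambdaEIF_self hδ a S hY']
  ring

end GapRemainder

/-! ### Regular submodels -/

section Regular

variable {d : ℕ} {P : Measure (Obs d)} [IsProbabilityMeasure P] {δ : ℝ}

lemma le_propScore_of_forall_le (b : Fin 2) (S : Finset (Fin d))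
    (h : ∀ s, MeasurableSet[covSigma S] s → δ * P.real s ≤ ∫ z in s, expInd b z ∂P) :
    ∀ᵐ z ∂P, δ ≤ propScore P b S z := by
  have hm := covSigma_le S
  refine ae_of_ae_trim hm (ae_le_of_forall_setIntegral_le (integrable_const δ)
    (integrable_condExp.trim hm stronglyMeasurable_condExp) fun s hs _ => ?_)
  unfold propScore
  rw [← setIntegral_trim hm stronglyMeasurable_condExp hs,
    ← setIntegral_trim hm stronglyMeasurable_const hs, setIntegral_condExp hm ((bdd_expInd b).integrable (measurable_expInd b)) hs]
  simpa [mul_comm] using h s hs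

/-- The density of the tilt lies between `1/2` and `3/2`, so conditional probabilities shrink at
most by the factor `(1/2) / (3/2) = 1/3`. -/
lemma PositivityWith.tilt (h : PositivityWith δ P) (hδ : 0 < δ) {g : Obs d → ℝ} {N : ℝ}
    (hg : Measurable g) (hN : ∀ z, |g z| ≤ N) (h0 : ∫ z, g z ∂P = 0) (ε : ℝ) :
    PositivityWith (δ / 3) (tilt P g N ε) := by
  have hprob := (isSmoothSubmodel_tilt hg hN h0).isProb ε
  have hpm : Measurable (tiltDensity g N ε) := measurable_tiltDensity hg ε
  have hp0 := tiltDensity_bounds hN ε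
  have hint : ∀ F : Obs d → ℝ, ∫ z, F z ∂(_root_.tilt P g N ε)
      = ∫ z, tiltDensity g N ε z * F z ∂P := fun F => by
    rw [_root_.tilt, integral_withDensity_eq_integral_toReal_smul (by fun_prop) (by simp)]
    refine integral_congr_ae (ae_of_all _ fun z => ?_)
    simp only [smul_eq_mul]
    rw [ENNReal.toReal_ofReal (by linarith [(hp0 z).1])]
  have hpb : Bdd (tiltDensity g N ε) :=
    ⟨3 / 2, fun z => abs_le.2 ⟨by linarith [(hp0 z).1], (hp0 z).2⟩⟩
  have hb : ∀ b : Fin 2, ∀ᵐ z ∂(_root_.tilt P g N ε), δ / 3 ≤ propScore (_root_.tilt P g N ε) b ∅ z := by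
    intro b
    refine le_propScore_of_forall_le b ∅ fun s hs => ?_
    have hs' := covSigma_le _ s hs
    set I : Obs d → ℝ := s.indicator fun _ => 1 with hI
    have hIm : Measurable I := measurable_const.indicator hs'
    have hI0 : ∀ z, 0 ≤ I z := fun z => Set.indicator_nonneg (fun _ _ => zero_le_one) z
    have hIb : Bdd I := ⟨1, fun z => by by_cases hz : z ∈ s <;> simp [hI, hz]⟩
    have e1 : (_root_.tilt P g N ε).real s = ∫ z, tiltDensity g N ε z * I z ∂P := by
      rw [← hint, hI, integral_indicator_const _ hs', smul_eq_mul, mul_one]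
    have e2 : ∫ z in s, expInd b z ∂(_root_.tilt P g N ε)
        = ∫ z, tiltDensity g N ε z * (expInd b z * I z) ∂P := by
      rw [← hint, ← integral_indicator hs']
      congr 1; ext z
      by_cases hz : z ∈ s <;> simp [hI, hz]
    have h1 := h.weightPos b ∅ I (measurable_const.indicator hs) hI0 (hIb.integrable hIm)
    have i1 : Integrable (fun z => expInd b z * I z) P :=
      ((bdd_expInd b).mul hIb).integrable ((measurable_expInd b).mul hIm)
    have h2 : ∫ z, tiltDensity g N ε z * I z ∂P ≤ 3 / 2 * ∫ z, I z ∂P := by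
      rw [← integral_const_mul]
      exact integral_mono ((hpb.mul hIb).integrable (hpm.mul hIm))
        ((hIb.integrable hIm).const_mul _) fun z => mul_le_mul_of_nonneg_right (hp0 z).2 (hI0 z)
    have h3 : 1 / 2 * ∫ z, expInd b z * I z ∂P
        ≤ ∫ z, tiltDensity g N ε z * (expInd b z * I z) ∂P := by
      rw [← integral_const_mul]
      exact integral_mono (i1.const_mul _) ((hpb.mul ((bdd_expInd b).mul hIb)).integrable
        (hpm.mul ((measurable_expInd b).mul hIm))) fun z =>
        mul_le_mul_of_nonneg_right (hp0 z).1 (mul_nonneg (expInd_nonneg b z) (hI0 z))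
    rw [e1, e2]
    nlinarith
  filter_upwards [hb 0, hb 1, propScore_zero_add_one (P := _root_.tilt P g N ε) ∅] with z h1 h2 h3
  constructor <;> linarith

/-- Restricting the class of submodels does not shrink the tangent space: tilts keep positivity with
`δ / 3`, and domination by `3/2` times `P` bounds the fourth moment of `Y`. -/
lemma mem_scoreSet_locallyRegular (hpos : Positivity P) (hY : MemLp outcome 4 P) {g : Obs d → ℝ}
    {N : ℝ} (hg : Measurable g) (hN : ∀ z, |g z| ≤ N) (h0 : ∫ z, g z ∂P = 0) :
    g ∈ scoreSet LocallyRegular P := by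
  obtain ⟨δ, hδ, h⟩ := hpos
  have hle : ∀ ε, tilt P g N ε ≤ ENNReal.ofReal (3 / 2) • P := fun ε => by
    rw [← withDensity_const]
    exact withDensity_mono (ae_of_all _ fun z =>
      ENNReal.ofReal_le_ofReal (tiltDensity_bounds hN ε z).2)
  set C := ENNReal.ofReal (3 / 2) ^ (1 / (4 : ℝ≥0∞)).toReal • eLpNorm outcome 4 P with hC
  have hCtop : C ≠ ∞ := by
    rw [hC, smul_eq_mul]
    exact ENNReal.mul_ne_top (ENNReal.rpow_ne_top_of_nonneg (by positivity) ENNReal.ofReal_ne_top)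
      hY.2.ne
  refine ⟨tilt P g N, ⟨δ / 3, C.toNNReal, by positivity, Eventually.of_forall fun ε =>
    ⟨h.tilt hδ hg hN h0 ε, ?_⟩⟩, isSmoothSubmodel_tilt hg hN h0⟩
  rw [ENNReal.coe_toNNReal hCtop]
  exact eLpNorm_le_of_measure_le_smul (p := 4) (f := outcome) (hle ε)

end Regular

/-! ### Truncated outcomes -/

section Truncation

variable {d : ℕ}

/-- The outcome, clipped to `[-M, M]`. -/
def truncOutcome (M : ℝ) (z : Obs d) : ℝ := clip (-M) M (outcome z)

/-- The outcome regression of the truncated outcome. -/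
def truncOutReg (M : ℝ) (P : Measure (Obs d)) (a : Fin 2) (S : Finset (Fin d)) : Obs d → ℝ :=
  clippedRegr M P a S (truncOutcome M)

/-- The regression of `truncOutReg` in the opposite arm. -/
def truncCrossReg (M : ℝ) (P : Measure (Obs d)) (a : Fin 2) (S : Finset (Fin d)) : Obs d → ℝ :=
  clippedRegr M P (1 - a) S (truncOutReg M P a ∅)

/-- `outGap` for the truncated outcome. -/
def truncGap (M : ℝ) (P : Measure (Obs d)) (a : Fin 2) (S : Finset (Fin d)) (z : Obs d) : ℝ :=
  truncOutReg M P a S z - truncCrossReg M P a S z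

/-- The event that truncation at `M` changes the outcome. -/
def truncEvent (d : ℕ) (M : ℝ) : Set (Obs d) := {z | M < |outcome z|}

lemma measurable_truncOutcome (M : ℝ) : Measurable (truncOutcome M : Obs d → ℝ) :=
  (measurable_clip _ _).comp measurable_outcome

lemma measurableSet_truncEvent (M : ℝ) : MeasurableSet (truncEvent d M) :=
  measurableSet_lt measurable_const measurable_outcome.abs

lemma measurable_truncOutReg (M : ℝ) (P : Measure (Obs d)) (a : Fin 2) (S : Finset (Fin d)) :
    Measurable[covSigma S] (truncOutReg M P a S) := measurable_clippedRegr _ _ _ _ _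

lemma measurable_truncCrossReg (M : ℝ) (P : Measure (Obs d)) (a : Fin 2) (S : Finset (Fin d)) :
    Measurable[covSigma S] (truncCrossReg M P a S) := measurable_clippedRegr _ _ _ _ _

lemma Measurable.of_covSigma {S : Finset (Fin d)} {f : Obs d → ℝ} (hf : Measurable[covSigma S] f) :
    Measurable f := hf.mono (covSigma_le S) le_rfl

lemma measurable_truncGap (M : ℝ) (P : Measure (Obs d)) (a : Fin 2) (S : Finset (Fin d)) :
    Measurable (truncGap M P a S) :=
  (measurable_truncOutReg M P a S).of_covSigma.sub (measurable_truncCrossReg M P a S).of_covSigma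

variable {M : ℝ}

lemma abs_truncOutcome_le (hM : 0 ≤ M) (z : Obs d) : |truncOutcome M z| ≤ M := abs_clip_le hM _

lemma abs_clippedRegr_le (hM : 0 ≤ M) (P : Measure (Obs d)) (b : Fin 2) (S : Finset (Fin d)) (f : Obs d → ℝ)
    (z : Obs d) : |clippedRegr M P b S f z| ≤ M := abs_clip_le hM _

lemma bdd_clippedRegr (hM : 0 ≤ M) (P : Measure (Obs d)) (b : Fin 2) (S : Finset (Fin d)) (f : Obs d → ℝ) :
    Bdd (clippedRegr M P b S f) := ⟨M, abs_clippedRegr_le hM P b S f⟩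

lemma bdd_truncOutcome (hM : 0 ≤ M) : Bdd (truncOutcome M : Obs d → ℝ) := ⟨M, abs_truncOutcome_le hM⟩

lemma abs_truncOutcome_le_abs (hM : 0 ≤ M) (z : Obs d) : |truncOutcome M z| ≤ |outcome z| :=
  abs_clip_le_abs hM _

lemma abs_outcome_sub_truncOutcome_le (hM : 0 ≤ M) (z : Obs d) :
    |outcome z - truncOutcome M z| ≤ |outcome z| * (truncEvent d M).indicator (fun _ => 1) z := by
  by_cases hz : z ∈ truncEvent d M
  · rw [Set.indicator_of_mem hz, mul_one, truncOutcome, clip]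
    have hz' : M < |outcome z| := hz
    rcases le_total 0 (outcome z) with h | h
    · rw [abs_of_nonneg h] at hz' ⊢
      rw [min_eq_left hz'.le, max_eq_right (by linarith), abs_le]
      constructor <;> linarith
    · rw [abs_of_nonpos h] at hz' ⊢
      rw [min_eq_right (by linarith), max_eq_left (by linarith), abs_le]
      constructor <;> linarith
  · have hz' : |outcome z| ≤ M := not_lt.1 hz
    rw [truncOutcome, clip_eq_self (abs_le.1 hz').1 (abs_le.1 hz').2]
    simp [hz]

lemma memLp_sq_of_memLp_four {P : Measure (Obs d)} {f : Obs d → ℝ} (hf : MemLp f 4 P) :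
    MemLp (fun z => f z ^ 2) 2 P := by
  refine (memLp_two_iff_integrable_sq (hf.1.pow 2)).2 ?_
  have := hf.integrable_norm_rpow (by norm_num) (by norm_num)
  refine this.congr (ae_of_all _ fun z => ?_)
  have h4 : (4 : ℝ≥0∞).toReal = ((4 : ℕ) : ℝ) := by norm_num
  simp only [h4, Real.rpow_natCast, Real.norm_eq_abs]
  rw [Pi.pow_apply, ← pow_mul, ← abs_pow, abs_of_nonneg (by positivity)]

variable {P : Measure (Obs d)} [IsProbabilityMeasure P] {δ : ℝ}

/-- By linearity the difference is the regression of `f - f'`, to which the `L²` bound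
`IsRegr.integral_sq_le` applies. -/
lemma PositivityWith.integral_sub_regr_sq_le (h : PositivityWith δ P) (hδ : 0 < δ) (b : Fin 2)
    (S : Finset (Fin d)) {f f' : Obs d → ℝ} (hf : MemLp f 2 P) (hf' : MemLp f' 2 P) :
    ∫ z, (regr P b S f z - regr P b S f' z) ^ 2 ∂P ≤ (∫ z, (f z - f' z) ^ 2 ∂P) / δ := by
  have hd : MemLp (fun z => f z - f' z) 2 P := hf.sub hf'
  have h1 := (isRegr_regr b S (hd.integrable one_le_two)).integral_sq_le (h.weightPos b S)
    (measurable_expInd b) (expInd_nonneg b) (expInd_le_one b) hd (h.memLp_regr hδ b S one_le_two hd)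
  rw [le_div_iff₀' hδ]
  refine le_trans (le_of_eq ?_) h1
  congr 1
  refine integral_congr_ae ?_
  filter_upwards [h.regr_sub hδ b S (hf.integrable one_le_two) (hf'.integrable one_le_two)] with z hz
  rw [hz]

lemma integrable_outcome_pow_four {P : Measure (Obs d)} (hY : MemLp outcome 4 P) :
    Integrable (fun z => outcome z ^ 4) P := by
  have := (memLp_sq_of_memLp_four hY).integrable_sq
  simpa only [← pow_mul] using this

lemma integral_truncOutcome_pow_four_le {P : Measure (Obs d)} (hM : 0 ≤ M) (hY : MemLp outcome 4 P) :
    ∫ z, truncOutcome M z ^ 4 ∂P ≤ ∫ z, outcome z ^ 4 ∂P :=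
  integral_mono_of_nonneg (ae_of_all _ fun z => by positivity) (integrable_outcome_pow_four hY)
    (ae_of_all _ fun z => by
      have := pow_le_pow_left₀ (abs_nonneg _) (abs_truncOutcome_le_abs hM z) 4
      simpa [Even.pow_abs (n := 4) (by decide)] using this)

lemma PositivityWith.integral_clippedRegr_pow_four_le (h : PositivityWith δ P) (hδ : 0 < δ)
    (hM : 0 ≤ M) (b : Fin 2) (S : Finset (Fin d)) {f : Obs d → ℝ} (hf : ∀ z, |f z| ≤ M)
    (hfm : Measurable f) {C : ℝ} (hC : ∫ z, f z ^ 4 ∂P ≤ C) :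
    ∫ z, clippedRegr M P b S f z ^ 4 ∂P ≤ C / δ := by
  rw [le_div_iff₀' hδ]
  exact ((h.isRegr_clippedRegr hδ b S hf hfm).integral_pow_four_le (covSigma_le S)
    (h.weightPos b S) (measurable_expInd b) (expInd_nonneg b) (expInd_le_one b) hfm ⟨M, hf⟩
    (bdd_clippedRegr hM P b S f)).trans hC

lemma PositivityWith.integral_truncOutReg_pow_four_le (h : PositivityWith δ P) (hδ : 0 < δ)
    (hM : 0 ≤ M) (hY : MemLp outcome 4 P) {C : ℝ} (hC : ∫ z, outcome z ^ 4 ∂P ≤ C) (a : Fin 2)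
    (S : Finset (Fin d)) : ∫ z, truncOutReg M P a S z ^ 4 ∂P ≤ C / δ :=
  h.integral_clippedRegr_pow_four_le hδ hM a S (abs_truncOutcome_le hM) (measurable_truncOutcome M)
    ((integral_truncOutcome_pow_four_le hM hY).trans hC)

lemma PositivityWith.integral_truncCrossReg_pow_four_le (h : PositivityWith δ P) (hδ : 0 < δ)
    (hM : 0 ≤ M) (hY : MemLp outcome 4 P) {C : ℝ} (hC : ∫ z, outcome z ^ 4 ∂P ≤ C) (a : Fin 2)
    (S : Finset (Fin d)) : ∫ z, truncCrossReg M P a S z ^ 4 ∂P ≤ C / δ / δ :=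
  h.integral_clippedRegr_pow_four_le hδ hM _ S (abs_clippedRegr_le hM _ _ _ _)
    (measurable_truncOutReg M P a ∅).of_covSigma
    (h.integral_truncOutReg_pow_four_le hδ hM hY hC a ∅)

lemma integral_sq_mul_indicator_le (hY : MemLp outcome 4 P) :
    ∫ z, outcome z ^ 2 * (truncEvent d M).indicator (fun _ => 1) z ∂P
      ≤ √(∫ z, outcome z ^ 4 ∂P) * √(P.real (truncEvent d M)) := by
  have h1 := (le_abs_self _).trans (abs_integral_mul_le_sqrt (memLp_sq_of_memLp_four hY)
    ((memLp_const (μ := P) (p := 2) (1 : ℝ)).indicator (measurableSet_truncEvent (d := d) M)))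
  have h2 : ∀ z, (truncEvent d M).indicator (fun _ => (1 : ℝ)) z ^ 2
      = (truncEvent d M).indicator (fun _ => 1) z := fun z => by
    by_cases hz : z ∈ truncEvent d M <;> simp [hz]
  simp only [h2, ← pow_mul] at h1
  rwa [integral_indicator_const _ (measurableSet_truncEvent M), smul_eq_mul, mul_one] at h1

lemma memLp_outcome_two (hY : MemLp outcome 4 P) : MemLp outcome 2 P := hY.mono_exponent (by norm_num)

lemma memLp_truncOutcome (hM : 0 ≤ M) (p : ℝ≥0∞) : MemLp (truncOutcome M) p P :=
  (bdd_truncOutcome hM).memLp (measurable_truncOutcome M) p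

lemma integral_outcome_sub_truncOutcome_sq_le (hM : 0 ≤ M) (hY : MemLp outcome 4 P) :
    ∫ z, (outcome z - truncOutcome M z) ^ 2 ∂P
      ≤ √(∫ z, outcome z ^ 4 ∂P) * √(P.real (truncEvent d M)) := by
  refine le_trans (integral_mono ((memLp_outcome_two hY).sub (memLp_truncOutcome hM 2)).integrable_sq
    ((memLp_outcome_two hY).integrable_sq.mul_bdd (c := 1)
      (measurable_const.indicator (measurableSet_truncEvent (d := d) M)).aestronglyMeasurable
      (ae_of_all _ fun z => ?_)) fun z => ?_) (integral_sq_mul_indicator_le hY)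
  · by_cases hz : z ∈ truncEvent d M <;> simp [hz]
  · have h1 := abs_outcome_sub_truncOutcome_le hM z
    rw [← sq_abs]
    refine (pow_le_pow_left₀ (abs_nonneg _) h1 2).trans (le_of_eq ?_)
    by_cases hz : z ∈ truncEvent d M <;> simp [hz]

/-- The influence function with nuisance functions of the truncated outcome. -/
def truncInfluence (δ M : ℝ) (P : Measure (Obs d)) (a : Fin 2) (S : Finset (Fin d)) (z : Obs d) :
    ℝ :=
  (truncOutReg M P a S z - truncCrossReg M P a S z) ^ 2
    + 2 * (truncOutReg M P a S z - truncCrossReg M P a S z) *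
      (expInd a z / clippedPropScore δ P a S z * (truncOutcome M z - truncOutReg M P a S z)
        - expInd a z / clippedPropScore δ P a ∅ z * (truncOutcome M z - truncOutReg M P a ∅ z)
            * (clippedPropScore δ P (1 - a) ∅ z / clippedPropScore δ P (1 - a) S z)
        - expInd (1 - a) z / clippedPropScore δ P (1 - a) S z
            * (truncOutReg M P a ∅ z - truncCrossReg M P a S z))

/-- The second-order remainder between `ρ` and `P` for the truncated outcome. -/
def truncRemainder (δ M : ℝ) (P ρ : Measure (Obs d)) (a : Fin 2) (S : Finset (Fin d)) (z : Obs d) :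
    ℝ :=
  -((truncOutReg M P a S z - truncCrossReg M P a S z)
      - (truncOutReg M ρ a S z - truncCrossReg M ρ a S z)) ^ 2
    + 2 * ((truncOutReg M P a S z - truncCrossReg M P a S z) *
      ((clippedPropScore δ ρ a S z - clippedPropScore δ P a S z) / clippedPropScore δ P a S z
          * (truncOutReg M ρ a S z - truncOutReg M P a S z)
        - (clippedPropScore δ ρ a ∅ z - clippedPropScore δ P a ∅ z) / clippedPropScore δ P a ∅ z
          * (truncOutReg M ρ a ∅ z - truncOutReg M P a ∅ z)
          * (clippedPropScore δ P (1 - a) ∅ z / clippedPropScore δ P (1 - a) S z)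
        - (clippedPropScore δ ρ (1 - a) S z - clippedPropScore δ P (1 - a) S z)
            / clippedPropScore δ P (1 - a) S z
          * (clippedRegr M ρ (1 - a) S (truncOutReg M P a ∅) z - truncCrossReg M P a S z)
        - (truncOutReg M ρ a ∅ z - truncOutReg M P a ∅ z)
          * (clippedPropScore δ P (1 - a) ∅ z / clippedPropScore δ P (1 - a) S z
            - clippedPropScore δ ρ (1 - a) ∅ z / clippedPropScore δ ρ (1 - a) S z)))

lemma memLp_truncOutReg (ρ : Measure (Obs d)) [IsFiniteMeasure ρ] (hM : 0 ≤ M)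
    (P : Measure (Obs d)) (a : Fin 2) (S : Finset (Fin d)) (p : ℝ≥0∞) :
    MemLp (truncOutReg M P a S) p ρ :=
  (bdd_clippedRegr hM _ _ _ _).memLp (measurable_truncOutReg M P a S).of_covSigma p

lemma memLp_truncCrossReg (ρ : Measure (Obs d)) [IsFiniteMeasure ρ] (hM : 0 ≤ M)
    (P : Measure (Obs d)) (a : Fin 2) (S : Finset (Fin d)) (p : ℝ≥0∞) :
    MemLp (truncCrossReg M P a S) p ρ :=
  (bdd_clippedRegr hM _ _ _ _).memLp (measurable_truncCrossReg M P a S).of_covSigma p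

lemma PositivityWith.integral_truncInfluence {ρ : Measure (Obs d)} [IsProbabilityMeasure ρ]
    (h : PositivityWith δ ρ) (hδ : 0 < δ) (hM : 0 ≤ M) (P : Measure (Obs d)) (a : Fin 2)
    (S : Finset (Fin d)) :
    ∫ z, truncInfluence δ M P a S z ∂ρ
      = ∫ z, truncGap M ρ a S z ^ 2 ∂ρ + ∫ z, truncRemainder δ M P ρ a S z ∂ρ := by
  have hδ1 := h.le_one
  have b1 : ∀ (T : Measure (Obs d)) b U z, |clippedPropScore δ T b U z| ≤ 1 := fun T b U z =>
    abs_clippedPropScore_le_one T hδ.le hδ1 b U z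
  have b2 : ∀ (T : Measure (Obs d)) b U z, δ ≤ clippedPropScore δ T b U z := fun T b U z =>
    (clip_mem hδ1 _).1
  have hXm := fun T : Measure (Obs d) => (measurable_truncOutReg M T a ∅).of_covSigma
  have hXb := fun T : Measure (Obs d) => abs_clippedRegr_le hM T a ∅ (truncOutcome M)
  exact integral_gap_expansion (P := ρ) (covSigma_le_covSigma_empty S) (covSigma_le ∅)
    (f := truncOutcome M) (c := truncCrossReg M ρ a S)
    (e := clippedRegr M ρ (1 - a) S (truncOutReg M P a ∅)) hδ (measurable_expInd a)
    (measurable_expInd (1 - a)) (abs_expInd_le_one a)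
    (abs_expInd_le_one (1 - a)) (h.isRegr_clippedPropScore a S) (h.isRegr_clippedPropScore a ∅)
    (h.isRegr_clippedPropScore (1 - a) S) (h.isRegr_clippedPropScore (1 - a) ∅)
    (b1 _ _ _) (b1 _ _ _) (b1 _ _ _) (b1 _ _ _) (b2 _ _ _)
    (h.isRegr_clippedRegr hδ a S (abs_truncOutcome_le hM) (measurable_truncOutcome M))
    (h.isRegr_clippedRegr hδ a ∅ (abs_truncOutcome_le hM) (measurable_truncOutcome M))
    (h.isRegr_clippedRegr hδ (1 - a) S (hXb ρ) (hXm ρ))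
    (h.isRegr_clippedRegr hδ (1 - a) S (hXb P) (hXm P))
    (measurable_clippedPropScore δ P a S) (measurable_clippedPropScore δ P a ∅)
    (measurable_clippedPropScore δ P (1 - a) S) (measurable_clippedPropScore δ P (1 - a) ∅)
    (b2 _ _ _) (b2 _ _ _) (b2 _ _ _) (b1 _ _ _) (measurable_truncOutReg M P a ∅)
    (measurable_truncOutReg M P a S) (measurable_truncCrossReg M P a S)
    (memLp_truncOutcome hM 2) (memLp_truncOutReg ρ hM ρ a ∅ 2) (memLp_truncOutReg ρ hM ρ a S 2)
    (memLp_truncCrossReg ρ hM ρ a S 2)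
    ((bdd_clippedRegr hM _ _ _ _).memLp (measurable_clippedRegr _ _ _ _ _).of_covSigma 2)
    (memLp_truncOutReg ρ hM P a ∅ 2) (memLp_truncOutReg ρ hM P a S 2)
    (memLp_truncCrossReg ρ hM P a S 2)

lemma PositivityWith.integral_truncInfluence_self (h : PositivityWith δ P) (hδ : 0 < δ)
    (hM : 0 ≤ M) (a : Fin 2) (S : Finset (Fin d)) :
    ∫ z, truncInfluence δ M P a S z ∂P = ∫ z, truncGap M P a S z ^ 2 ∂P := by
  rw [h.integral_truncInfluence hδ hM]
  have : ∀ z, truncRemainder δ M P P a S z = 0 := fun z => by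
    simp only [truncRemainder, truncCrossReg]; ring
  simp [this]

end Truncation

/-! ### The effect of truncation on the functional -/

section TruncationError

variable {d : ℕ} {P : Measure (Obs d)} [IsProbabilityMeasure P] {δ M C : ℝ}

lemma PositivityWith.integral_outReg_sub_truncOutReg_sq_le (h : PositivityWith δ P) (hδ : 0 < δ)
    (hM : 0 ≤ M) (hY : MemLp outcome 2 P) (a : Fin 2) (S : Finset (Fin d)) :
    ∫ z, (outReg P a S z - truncOutReg M P a S z) ^ 2 ∂P
      ≤ (∫ z, (outcome z - truncOutcome M z) ^ 2 ∂P) / δ := by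
  refine le_trans (le_of_eq (integral_congr_ae ?_))
    (h.integral_sub_regr_sq_le hδ a S hY (memLp_truncOutcome hM 2))
  filter_upwards [h.clippedRegr_ae_eq hδ a S (abs_truncOutcome_le hM)] with z hz
  rw [truncOutReg, hz, outReg]

lemma PositivityWith.integral_crossReg_sub_truncCrossReg_sq_le (h : PositivityWith δ P)
    (hδ : 0 < δ) (hM : 0 ≤ M) (hY : MemLp outcome 2 P) (a : Fin 2) (S : Finset (Fin d)) :
    ∫ z, (crossReg P a S z - truncCrossReg M P a S z) ^ 2 ∂P
      ≤ (∫ z, (outcome z - truncOutcome M z) ^ 2 ∂P) / δ / δ := by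
  refine le_trans (le_of_eq (integral_congr_ae ?_))
    ((h.integral_sub_regr_sq_le hδ (1 - a) S (h.memLp_regr hδ a ∅ one_le_two hY)
      (memLp_truncOutReg P hM P a ∅ 2)).trans (div_le_div_of_nonneg_right
        (h.integral_outReg_sub_truncOutReg_sq_le hδ hM hY a ∅) hδ.le))
  filter_upwards [h.clippedRegr_ae_eq hδ (1 - a) S (abs_clippedRegr_le hM P a ∅ (truncOutcome M))]
    with z hz
  simp only [crossReg, truncCrossReg, truncOutReg, hz, outReg]

lemma PositivityWith.integral_outGap_sub_truncGap_sq_le (h : PositivityWith δ P) (hδ : 0 < δ)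
    (hM : 0 ≤ M) (hY : MemLp outcome 2 P) (a : Fin 2) (S : Finset (Fin d)) :
    ∫ z, (outGap P a S z - truncGap M P a S z) ^ 2 ∂P
      ≤ (2 / δ + 2 / δ / δ) * ∫ z, (outcome z - truncOutcome M z) ^ 2 ∂P := by
  have hX : MemLp (outReg P a ∅) 2 P := h.memLp_regr hδ a ∅ one_le_two hY
  have hS : MemLp (outReg P a S) 2 P := h.memLp_regr hδ a S one_le_two hY
  have hc : MemLp (crossReg P a S) 2 P := h.memLp_regr hδ _ S one_le_two hX
  have h1 : MemLp (fun z => outReg P a S z - truncOutReg M P a S z) 2 P :=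
    hS.sub (memLp_truncOutReg P hM P a S 2)
  have h2 : MemLp (fun z => crossReg P a S z - truncCrossReg M P a S z) 2 P :=
    hc.sub (memLp_truncCrossReg P hM P a S 2)
  have h3 := integral_sub_sq_le h1 h2
  have h4 : ∀ z, outGap P a S z - truncGap M P a S z = (outReg P a S z - truncOutReg M P a S z)
      - (crossReg P a S z - truncCrossReg M P a S z) := fun z => by
    simp only [outGap, truncGap]; ring
  simp only [h4]
  refine h3.trans ?_
  have h5 := h.integral_outReg_sub_truncOutReg_sq_le hδ hM hY a S
  have h6 := h.integral_crossReg_sub_truncCrossReg_sq_le hδ hM hY a S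
  set I := ∫ z, (outcome z - truncOutcome M z) ^ 2 ∂P
  have : (2 / δ + 2 / δ / δ) * I = 2 * (I / δ) + 2 * (I / δ / δ) := by ring
  rw [this]
  linarith

lemma bdd_div_clippedPropScore (hδ : 0 < δ) (hδ1 : δ ≤ 1) {f : Obs d → ℝ} (hf : ∀ z, |f z| ≤ 1)
    (ρ : Measure (Obs d)) (b : Fin 2) (S : Finset (Fin d)) :
    ∀ z, |f z / clippedPropScore δ ρ b S z| ≤ 1 / δ := fun z =>
  abs_div_le_of_bounds hδ (hf z) (clip_mem hδ1 _).1

/-- The weight of the outcome in the influence function. -/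
def gapWeight (δ : ℝ) (P : Measure (Obs d)) (a : Fin 2) (S : Finset (Fin d)) (z : Obs d) : ℝ :=
  expInd a z / clippedPropScore δ P a S z - expInd a z / clippedPropScore δ P a ∅ z
    * (clippedPropScore δ P (1 - a) ∅ z / clippedPropScore δ P (1 - a) S z)

lemma measurable_gapWeight (P : Measure (Obs d)) (a : Fin 2) (S : Finset (Fin d)) :
    Measurable (gapWeight δ P a S) := by
  have h1 := fun b T => (measurable_clippedPropScore δ P b T).of_covSigma
  have h2 := fun b => measurable_expInd (d := d) b
  exact ((h2 a).div (h1 a S)).sub (((h2 a).div (h1 a ∅)).mul ((h1 (1 - a) ∅).div (h1 (1 - a) S)))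

lemma abs_gapWeight_le (hδ : 0 < δ) (hδ1 : δ ≤ 1) (P : Measure (Obs d)) (a : Fin 2)
    (S : Finset (Fin d)) (z : Obs d) : |gapWeight δ P a S z| ≤ 1 / δ + 1 / δ * (1 / δ) := by
  refine (abs_sub _ _).trans (add_le_add
    (bdd_div_clippedPropScore hδ hδ1 (abs_expInd_le_one a) P a S z) ?_)
  rw [abs_mul]
  exact mul_le_mul (bdd_div_clippedPropScore hδ hδ1 (abs_expInd_le_one a) P a ∅ z)
    (bdd_div_clippedPropScore hδ hδ1 (abs_clippedPropScore_le_one P hδ.le hδ1 (1 - a) ∅) P _ S z)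
    (abs_nonneg _) (by positivity)

lemma bdd_truncGap (hM : 0 ≤ M) (P : Measure (Obs d)) (a : Fin 2) (S : Finset (Fin d)) :
    Bdd (truncGap M P a S) := (bdd_clippedRegr hM _ _ _ _).sub (bdd_clippedRegr hM _ _ _ _)

lemma measurable_truncInfluence (δ M : ℝ) (P : Measure (Obs d)) (a : Fin 2) (S : Finset (Fin d)) :
    Measurable (truncInfluence δ M P a S) := by
  have h1 := fun b T => (measurable_clippedPropScore δ P b T).of_covSigma
  have h2 := fun b => measurable_expInd (d := d) b
  have h3 := fun T => (measurable_truncOutReg M P a T).of_covSigma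
  have h4 := (measurable_truncCrossReg M P a S).of_covSigma
  have h5 := measurable_truncOutcome (d := d) M
  exact (((h3 S).sub h4).pow_const 2).add ((measurable_const.mul ((h3 S).sub h4)).mul
    (((((h2 a).div (h1 a S)).mul (h5.sub (h3 S))).sub ((((h2 a).div (h1 a ∅)).mul
      (h5.sub (h3 ∅))).mul ((h1 (1 - a) ∅).div (h1 (1 - a) S)))).sub
      (((h2 (1 - a)).div (h1 (1 - a) S)).mul ((h3 ∅).sub h4))))

lemma bdd_truncInfluence (hδ : 0 < δ) (hδ1 : δ ≤ 1) (hM : 0 ≤ M) (P : Measure (Obs d))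
    (a : Fin 2) (S : Finset (Fin d)) : Bdd (truncInfluence δ M P a S) := by
  have h1 : ∀ b c T, Bdd fun z => expInd b z / clippedPropScore δ P c T z := fun b c T =>
    ⟨_, bdd_div_clippedPropScore hδ hδ1 (abs_expInd_le_one b) P c T⟩
  have h2 : Bdd fun z => clippedPropScore δ P (1 - a) ∅ z / clippedPropScore δ P (1 - a) S z :=
    ⟨_, bdd_div_clippedPropScore hδ hδ1 (abs_clippedPropScore_le_one P hδ.le hδ1 (1 - a) ∅) P _ S⟩
  have h3 : ∀ T, Bdd (truncOutReg M P a T) := fun T => bdd_clippedRegr hM _ _ _ _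
  have h4 : Bdd (truncCrossReg M P a S) := bdd_clippedRegr hM _ _ _ _
  have h5 : Bdd (truncOutcome M : Obs d → ℝ) := bdd_truncOutcome hM
  exact (((h3 S).sub h4).pow 2).add ((Bdd.mul (f := fun _ => 2) ⟨2, by simp⟩ ((h3 S).sub h4)).mul
    ((((h1 a a S).mul (h5.sub (h3 S))).sub (((h1 a a ∅).mul (h5.sub (h3 ∅))).mul h2)).sub
      ((h1 (1 - a) (1 - a) S).mul ((h3 ∅).sub h4))))

/-- A crude bound through `‖outGap - truncGap‖₂` would be only of the order of the fourth root of
the tail probability. Instead, the influence function with truncated nuisance functions is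
integrated twice, once with `Y` and once with the truncated `Y`. The propensity scores are exact, so
no product of errors survives, and what remains is a tail term linear in `Y` plus a square. -/
lemma PositivityWith.gapNormSq_sub_eq (h : PositivityWith δ P) (hδ : 0 < δ) (hM : 0 ≤ M)
    (hY : MemLp outcome 2 P) (a : Fin 2) (S : Finset (Fin d)) :
    gapNormSq a S P - ∫ z, truncGap M P a S z ^ 2 ∂P
      = ∫ z, truncGap M P a S z * (outcome z - truncOutcome M z)
          * (2 * gapWeight δ P a S z) ∂P
        + ∫ z, (outGap P a S z - truncGap M P a S z) ^ 2 ∂P := by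
  have hδ1 := h.le_one
  have b1 : ∀ b U z, |clippedPropScore δ P b U z| ≤ 1 := fun b U z =>
    abs_clippedPropScore_le_one P hδ.le hδ1 b U z
  have b2 : ∀ b U z, δ ≤ clippedPropScore δ P b U z := fun b U z => (clip_mem hδ1 _).1
  have hXm := (measurable_truncOutReg M P a ∅).of_covSigma
  have hXb := abs_clippedRegr_le hM P a ∅ (truncOutcome M)
  have hμX : MemLp (outReg P a ∅) 2 P := h.memLp_regr hδ a ∅ one_le_two hY
  have key := integral_gap_expansion (P := P) (covSigma_le_covSigma_empty S) (covSigma_le ∅)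
    (f := outcome) (c := crossReg P a S)
    -- Here `e` coincides with the approximation `cb`, because both regress the truncated outcome
    -- regression under the same law; the third error product vanishes.
    (e := truncCrossReg M P a S) hδ (measurable_expInd a)
    (measurable_expInd (1 - a)) (abs_expInd_le_one a)
    (abs_expInd_le_one (1 - a)) (h.isRegr_clippedPropScore a S) (h.isRegr_clippedPropScore a ∅)
    (h.isRegr_clippedPropScore (1 - a) S) (h.isRegr_clippedPropScore (1 - a) ∅)
    (b1 _ _) (b1 _ _) (b1 _ _) (b1 _ _) (b2 _ _)
    (isRegr_regr a S (hY.integrable one_le_two)) (isRegr_regr a ∅ (hY.integrable one_le_two))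
    (isRegr_regr (1 - a) S (hμX.integrable one_le_two))
    (h.isRegr_clippedRegr hδ (1 - a) S hXb hXm)
    (measurable_clippedPropScore δ P a S) (measurable_clippedPropScore δ P a ∅)
    (measurable_clippedPropScore δ P (1 - a) S) (measurable_clippedPropScore δ P (1 - a) ∅)
    (b2 _ _) (b2 _ _) (b2 _ _) (b1 _ _) (measurable_truncOutReg M P a ∅)
    (measurable_truncOutReg M P a S) (measurable_truncCrossReg M P a S)
    hY hμX (h.memLp_regr hδ a S one_le_two hY) (h.memLp_regr hδ _ S one_le_two hμX)
    (memLp_truncCrossReg P hM P a S 2)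
    (memLp_truncOutReg P hM P a ∅ 2) (memLp_truncOutReg P hM P a S 2)
    (memLp_truncCrossReg P hM P a S 2)
  have key' := h.integral_truncInfluence_self hδ hM a S
  have hD : MemLp (fun z => outcome z - truncOutcome M z) 2 P :=
    hY.sub (memLp_truncOutcome hM 2)
  have i1 : Integrable (fun z => truncGap M P a S z * (outcome z - truncOutcome M z)
      * (2 * gapWeight δ P a S z)) P :=
    integrable_mul_mul_of_bdd ((bdd_truncGap hM P a S).memLp (measurable_truncGap M P a S) 2) hD
      ((measurable_gapWeight P a S).const_mul 2) (C := 2 * (1 / δ + 1 / δ * (1 / δ))) fun z => by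
        rw [abs_mul, abs_two]
        exact mul_le_mul_of_nonneg_left (abs_gapWeight_le hδ hδ1 P a S z) zero_le_two
  have i2 : Integrable (fun z => truncInfluence δ M P a S z) P :=
    (bdd_truncInfluence hδ hδ1 hM P a S).integrable (measurable_truncInfluence δ M P a S)
  have e1 : ∀ z, truncInfluence δ M P a S z
      + truncGap M P a S z * (outcome z - truncOutcome M z) * (2 * gapWeight δ P a S z)
      = (truncOutReg M P a S z - truncCrossReg M P a S z) ^ 2
        + 2 * (truncOutReg M P a S z - truncCrossReg M P a S z) *
        (expInd a z / clippedPropScore δ P a S z * (outcome z - truncOutReg M P a S z)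
        - expInd a z / clippedPropScore δ P a ∅ z * (outcome z - truncOutReg M P a ∅ z)
            * (clippedPropScore δ P (1 - a) ∅ z / clippedPropScore δ P (1 - a) S z)
        - expInd (1 - a) z / clippedPropScore δ P (1 - a) S z
            * (truncOutReg M P a ∅ z - truncCrossReg M P a S z)) := fun z => by
    simp only [truncInfluence, truncGap, gapWeight]; ring
  rw [← integral_congr_ae (ae_of_all _ e1), integral_add i2 i1, key'] at key
  have e2 : ∫ z, (outGap P a S z - truncGap M P a S z) ^ 2 ∂P
      = -∫ z, (-((truncOutReg M P a S z - truncCrossReg M P a S z)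
        - (regr P a S outcome z - crossReg P a S z)) ^ 2
        + 2 * ((truncOutReg M P a S z - truncCrossReg M P a S z)
        * ((clippedPropScore δ P a S z - clippedPropScore δ P a S z) / clippedPropScore δ P a S z
            * (regr P a S outcome z - truncOutReg M P a S z)
          - (clippedPropScore δ P a ∅ z - clippedPropScore δ P a ∅ z) / clippedPropScore δ P a ∅ z
            * (regr P a ∅ outcome z - truncOutReg M P a ∅ z)
            * (clippedPropScore δ P (1 - a) ∅ z / clippedPropScore δ P (1 - a) S z)
          - (clippedPropScore δ P (1 - a) S z - clippedPropScore δ P (1 - a) S z)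
            / clippedPropScore δ P (1 - a) S z
            * (truncCrossReg M P a S z - truncCrossReg M P a S z)
          - (regr P a ∅ outcome z - truncOutReg M P a ∅ z)
            * (clippedPropScore δ P (1 - a) ∅ z / clippedPropScore δ P (1 - a) S z
              - clippedPropScore δ P (1 - a) ∅ z / clippedPropScore δ P (1 - a) S z)))) ∂P := by
    rw [← integral_neg]
    congr 1; ext z
    simp only [outGap, truncGap, outReg]
    ring
  rw [e2]
  change _ = gapNormSq a S P + _ at key
  linarith

lemma integral_truncGap_pow_four_le (h : PositivityWith δ P) (hδ : 0 < δ) (hM : 0 ≤ M)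
    (hY : MemLp outcome 4 P) (hC : ∫ z, outcome z ^ 4 ∂P ≤ C) (a : Fin 2) (S : Finset (Fin d)) :
    ∫ z, truncGap M P a S z ^ 4 ∂P ≤ 8 * (C / δ) + 8 * (C / δ / δ) := by
  have h1 := integral_sub_pow_four_le (P := P)
    (((bdd_clippedRegr hM P a S (truncOutcome M)).pow 4).integrable
      ((measurable_truncOutReg M P a S).of_covSigma.pow_const 4))
    (((bdd_clippedRegr hM P (1 - a) S (truncOutReg M P a ∅)).pow 4).integrable
      ((measurable_truncCrossReg M P a S).of_covSigma.pow_const 4))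
  have h2 := h.integral_truncOutReg_pow_four_le hδ hM hY hC a S
  have h3 := h.integral_truncCrossReg_pow_four_le hδ hM hY hC a S
  refine h1.trans (add_le_add (mul_le_mul_of_nonneg_left h2 (by norm_num))
    (mul_le_mul_of_nonneg_left h3 (by norm_num)))

/-- Truncating the outcome at `M` changes `gapNormSq` by the order of the root of the probability
of `truncEvent d M`. -/
lemma exists_abs_gapNormSq_sub_le (hδ : 0 < δ) (C : ℝ) :
    ∃ A : ℝ, ∀ (ρ : Measure (Obs d)), IsProbabilityMeasure ρ → PositivityWith δ ρ →
      MemLp outcome 4 ρ → ∫ z, outcome z ^ 4 ∂ρ ≤ C → ∀ M : ℝ, 0 ≤ M →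
      ∀ (a : Fin 2) (S : Finset (Fin d)),
      |gapNormSq a S ρ - ∫ z, truncGap M ρ a S z ^ 2 ∂ρ| ≤ A * √(ρ.real (truncEvent d M)) := by
  -- The first constant comes from Cauchy-Schwarz between `truncGap * Y`, bounded by fourth moments,
  -- and the indicator of the tail; the second from the squared truncation error of the gap.
  refine ⟨2 * (1 / δ + 1 / δ * (1 / δ)) * √(√(8 * (C / δ) + 8 * (C / δ / δ)) * √C)
    + (2 / δ + 2 / δ / δ) * √C, fun ρ _ h hY hC M hM a S => ?_⟩
  have hδ1 := h.le_one
  have hY2 := memLp_outcome_two hY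
  have hgm := measurable_truncGap M ρ a S
  have hgb := bdd_truncGap hM ρ a S
  have hD := integral_outcome_sub_truncOutcome_sq_le hM hY
  have hE := h.integral_outGap_sub_truncGap_sq_le hδ hM hY2 a S
  rw [h.gapNormSq_sub_eq hδ hM hY2 a S]
  have hsC : √(∫ z, outcome z ^ 4 ∂ρ) ≤ √C := Real.sqrt_le_sqrt hC
  set β := √(ρ.real (truncEvent d M)) with hβ
  have hβ0 : 0 ≤ β := Real.sqrt_nonneg _
  have hgY : MemLp (fun z => truncGap M ρ a S z * outcome z) 2 ρ := by
    obtain ⟨B, hB⟩ := hgb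
    exact memLp_mul_of_bdd hY2 hgm hB
  have hI : MemLp ((truncEvent d M).indicator fun _ => (1 : ℝ)) 2 ρ :=
    (memLp_const 1).indicator (measurableSet_truncEvent M)
  have hI2 : √(∫ z, (truncEvent d M).indicator (fun _ => (1 : ℝ)) z ^ 2 ∂ρ) = β := by
    have h2 : ∀ z, (truncEvent d M).indicator (fun _ => (1 : ℝ)) z ^ 2
        = (truncEvent d M).indicator (fun _ => 1) z := fun z => by
      by_cases hz : z ∈ truncEvent d M <;> simp [hz]
    simp only [h2]
    rw [integral_indicator_const _ (measurableSet_truncEvent M), smul_eq_mul, mul_one]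
  have h1 : |∫ z, truncGap M ρ a S z * (outcome z - truncOutcome M z)
      * (2 * gapWeight δ ρ a S z) ∂ρ|
      ≤ 2 * (1 / δ + 1 / δ * (1 / δ)) * √(√(8 * (C / δ) + 8 * (C / δ / δ)) * √C) * β := by
    refine abs_integral_le_integral_abs.trans ?_
    have h2 : ∫ z, |truncGap M ρ a S z * (outcome z - truncOutcome M z)
        * (2 * gapWeight δ ρ a S z)| ∂ρ ≤ ∫ z, 2 * (1 / δ + 1 / δ * (1 / δ)) *
          |truncGap M ρ a S z * outcome z * (truncEvent d M).indicator (fun _ => (1 : ℝ)) z| ∂ρ := by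
      refine integral_mono_of_nonneg (ae_of_all _ fun z => abs_nonneg _)
        ((hgY.integrable_mul hI).norm.const_mul _) (ae_of_all _ fun z => ?_)
      have h3 := abs_outcome_sub_truncOutcome_le hM z
      have h4 := abs_gapWeight_le hδ hδ1 ρ a S z
      have h5 : 0 ≤ (truncEvent d M).indicator (fun _ => (1 : ℝ)) z :=
        Set.indicator_nonneg (fun _ _ => zero_le_one) z
      simp only [abs_mul, abs_two, abs_of_nonneg h5]
      set ι := (truncEvent d M).indicator (fun _ => (1 : ℝ)) z
      calc |truncGap M ρ a S z| * |outcome z - truncOutcome M z| * (2 * |gapWeight δ ρ a S z|)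
          ≤ |truncGap M ρ a S z| * (|outcome z| * ι) * (2 * (1 / δ + 1 / δ * (1 / δ))) := by gcongr
        _ = _ := by ring
    refine h2.trans ?_
    rw [integral_const_mul, mul_assoc _ _ β]
    refine mul_le_mul_of_nonneg_left ?_ (by positivity)
    refine (integral_abs_mul_le_sqrt hgY hI).trans ?_
    rw [hI2]
    refine mul_le_mul_of_nonneg_right (Real.sqrt_le_sqrt ?_) hβ0
    refine (integral_sq_mul_sq_le_sqrt ((hgb.pow 2).memLp (hgm.pow_const 2) 2)
      (memLp_sq_of_memLp_four hY)).trans ?_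
    exact mul_le_mul (Real.sqrt_le_sqrt (integral_truncGap_pow_four_le h hδ hM hY hC a S)) hsC
      (Real.sqrt_nonneg _) (Real.sqrt_nonneg _)
  have h2 : |∫ z, (outGap ρ a S z - truncGap M ρ a S z) ^ 2 ∂ρ|
      ≤ (2 / δ + 2 / δ / δ) * √C * β := by
    rw [abs_of_nonneg (integral_nonneg fun z => sq_nonneg _), mul_assoc]
    refine hE.trans (mul_le_mul_of_nonneg_left (hD.trans ?_) (by positivity))
    exact mul_le_mul_of_nonneg_right hsC hβ0
  rw [add_mul]
  exact (abs_add_le _ _).trans (add_le_add h1 h2)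

end TruncationError

/-! ### Truncation levels -/

section Levels

variable {d : ℕ}

/-- The truncation level used at `ε`. -/
def truncLevel (ε : ℝ) : ℝ := (√|ε|)⁻¹

lemma truncLevel_nonneg (ε : ℝ) : 0 ≤ truncLevel ε := by unfold truncLevel; positivity

lemma sq_mul_abs_le_one_of_abs_le {x ε : ℝ} (hx : |x| ≤ truncLevel ε) : x ^ 2 * |ε| ≤ 1 := by
  have h1 : x ^ 2 ≤ truncLevel ε ^ 2 := by
    rw [← sq_abs x]; exact pow_le_pow_left₀ (abs_nonneg _) hx 2
  rw [truncLevel, inv_pow, Real.sq_sqrt (abs_nonneg _)] at h1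
  calc x ^ 2 * |ε| ≤ |ε|⁻¹ * |ε| := by gcongr
    _ ≤ 1 := inv_mul_le_one

lemma tendsto_truncLevel : Tendsto truncLevel (𝓝[≠] 0) atTop := by
  have h1 : Tendsto (fun ε : ℝ => √|ε|) (𝓝[≠] 0) (𝓝[>] 0) := by
    refine tendsto_nhdsWithin_iff.2 ⟨by simpa using tendsto_abs_nhdsNE_nhds_zero.sqrt, ?_⟩
    filter_upwards [self_mem_nhdsWithin] with ε hε
    exact Real.sqrt_pos.2 (abs_pos.2 hε)
  exact tendsto_inv_nhdsGT_zero.comp h1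

variable {P : Measure (Obs d)} [IsProbabilityMeasure P]

/-- On the event `|Y| > |ε|^(-1/2)` one has `ε⁻² ≤ Y⁴`, so the quotient is at most the integral of
`Y⁴` over that event, which tends to `0` by dominated convergence. Markov's inequality alone would
give only `O(1)`. -/
lemma tendsto_measureReal_truncEvent_div_sq (hY : MemLp outcome 4 P) :
    Tendsto (fun ε => P.real (truncEvent d (truncLevel ε)) / ε ^ 2) (𝓝[≠] 0) (𝓝 0) := by
  have hi := integrable_outcome_pow_four hY
  have h1 : Tendsto (fun ε : ℝ => ∫ z, (truncEvent d (truncLevel ε)).indicator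
      (fun z => outcome z ^ 4) z ∂P) (𝓝[≠] 0) (𝓝 (∫ z : Obs d, (0 : ℝ) ∂P)) := by
    refine tendsto_integral_filter_of_dominated_convergence (fun z => outcome z ^ 4)
      (Eventually.of_forall fun ε => ((measurable_outcome.pow_const 4).indicator
        (measurableSet_truncEvent _)).aestronglyMeasurable)
      (Eventually.of_forall fun ε => ae_of_all _ fun z => ?_) hi (ae_of_all _ fun z => ?_)
    · have h4 : 0 ≤ outcome z ^ 4 := by positivity
      rw [Real.norm_eq_abs, abs_of_nonneg (Set.indicator_nonneg (fun z _ => by positivity) z)]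
      exact Set.indicator_le_self' (fun z _ => by positivity) z
    · refine tendsto_const_nhds.congr' ?_
      filter_upwards [tendsto_truncLevel.eventually_ge_atTop |outcome z|] with ε hε
      have hz : z ∉ truncEvent d (truncLevel ε) := not_lt.2 hε
      exact (Set.indicator_of_notMem hz _).symm
  rw [integral_zero] at h1
  refine squeeze_zero' (Eventually.of_forall fun ε => by positivity) ?_ h1
  filter_upwards [self_mem_nhdsWithin] with ε hε0
  have hε0 : 0 < |ε| := abs_pos.2 hε0
  have h2 : P.real (truncEvent d (truncLevel ε)) / ε ^ 2
      = ∫ z, (truncEvent d (truncLevel ε)).indicator (fun _ => (ε ^ 2)⁻¹) z ∂P := by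
    rw [integral_indicator_const _ (measurableSet_truncEvent _), smul_eq_mul, div_eq_mul_inv]
  rw [h2]
  refine integral_mono ((integrable_const _).indicator (measurableSet_truncEvent _))
    (hi.indicator (measurableSet_truncEvent _)) fun z => ?_
  by_cases hz : z ∈ truncEvent d (truncLevel ε)
  · rw [Set.indicator_of_mem hz, Set.indicator_of_mem hz]
    have h3 : (√|ε|)⁻¹ ^ 4 ≤ |outcome z| ^ 4 :=
      pow_le_pow_left₀ (by positivity) (le_of_lt hz) 4
    have h4 : (√|ε|)⁻¹ ^ 4 = (ε ^ 2)⁻¹ := by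
      rw [inv_pow, ← sq_abs ε]
      congr 1
      rw [show 4 = 2 * 2 from rfl, pow_mul, Real.sq_sqrt hε0.le]
    rwa [h4, Even.pow_abs (by decide)] at h3
  · rw [Set.indicator_of_notMem hz, Set.indicator_of_notMem hz]

lemma tendsto_sqrt_div_of_tendsto_div_sq {f : ℝ → ℝ}
    (h : Tendsto (fun ε => f ε / ε ^ 2) (𝓝[≠] 0) (𝓝 0)) :
    Tendsto (fun ε => √(f ε) / |ε|) (𝓝[≠] 0) (𝓝 0) := by
  have := h.sqrt
  rw [Real.sqrt_zero] at this
  refine this.congr fun ε => ?_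
  rw [Real.sqrt_div' _ (sq_nonneg ε), Real.sqrt_sq_eq_abs]

lemma memLp_outcome_of_eLpNorm_le {P : Measure (Obs d)} {C : ℝ≥0} (h : eLpNorm outcome 4 P ≤ C) :
    MemLp outcome 4 P ∧ ∫ z, outcome z ^ 4 ∂P ≤ (C : ℝ) ^ 4 := by
  have hY : MemLp outcome 4 P :=
    ⟨measurable_outcome.aestronglyMeasurable, h.trans_lt ENNReal.coe_lt_top⟩
  refine ⟨hY, ?_⟩
  have h1 := hY.eLpNorm_eq_integral_rpow_norm (by norm_num) (by norm_num)
  have h4 : (4 : ℝ≥0∞).toReal = ((4 : ℕ) : ℝ) := by norm_num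
  have h5 : ∀ z : Obs d, ‖outcome z‖ ^ 4 = outcome z ^ 4 := fun z => by
    rw [Real.norm_eq_abs, Even.pow_abs (by decide)]
  have h6 : 0 ≤ ∫ z, outcome z ^ 4 ∂P := integral_nonneg fun z => by positivity
  simp only [h4, Real.rpow_natCast, h5] at h1
  rw [h1, ← ENNReal.ofReal_coe_nnreal, ENNReal.ofReal_le_ofReal_iff C.coe_nonneg] at h
  have h7 := pow_le_pow_left₀ (Real.rpow_nonneg h6 _) h 4
  rwa [Real.rpow_inv_natCast_pow h6 (by norm_num)] at h7

end Levels

/-! ### Convergence of the influence functions -/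

section MeanSquare

variable {Ω : Type*} [MeasurableSpace Ω] {P : Measure Ω}

/-- Mean square convergence as `ε → 0`, `ε ≠ 0`. -/
def TendstoL2 (P : Measure Ω) (f : ℝ → Ω → ℝ) (f₀ : Ω → ℝ) : Prop :=
  (∀ ε, MemLp (f ε) 2 P) ∧ MemLp f₀ 2 P ∧
    Tendsto (fun ε => ∫ z, (f₀ z - f ε z) ^ 2 ∂P) (𝓝[≠] 0) (𝓝 0)

lemma TendstoL2.sub {f k : ℝ → Ω → ℝ} {f₀ k₀ : Ω → ℝ} (hf : TendstoL2 P f f₀)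
    (hk : TendstoL2 P k k₀) : TendstoL2 P (fun ε z => f ε z - k ε z) fun z => f₀ z - k₀ z := by
  refine ⟨fun ε => (hf.1 ε).sub (hk.1 ε), hf.2.1.sub hk.2.1, ?_⟩
  refine squeeze_zero (fun ε => integral_nonneg fun z => sq_nonneg _) (fun ε => ?_)
    (by simpa using (hf.2.2.const_mul 2).add (hk.2.2.const_mul 2))
  refine le_trans (le_of_eq ?_) (integral_sub_sq_le (hf.2.1.sub (hf.1 ε)) (hk.2.1.sub (hk.1 ε)))
  refine integral_congr_ae (ae_of_all _ fun z => ?_)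
  simp only; ring

lemma TendstoL2.bdd_mul {f : ℝ → Ω → ℝ} {f₀ B : Ω → ℝ} {C : ℝ} (hf : TendstoL2 P f f₀)
    (hB : Measurable B) (hC : ∀ z, |B z| ≤ C) :
    TendstoL2 P (fun ε z => B z * f ε z) fun z => B z * f₀ z := by
  have hC2 : ∀ z, B z ^ 2 ≤ C ^ 2 := fun z => sq_le_sq.2 ((hC z).trans (le_abs_self C))
  refine ⟨fun ε => memLp_mul_of_bdd (hf.1 ε) hB hC, memLp_mul_of_bdd hf.2.1 hB hC, ?_⟩
  refine squeeze_zero (fun ε => integral_nonneg fun z => sq_nonneg _) (fun ε => ?_)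
    (by simpa using hf.2.2.const_mul (C ^ 2))
  rw [← integral_const_mul]
  refine integral_mono_of_nonneg (ae_of_all _ fun z => sq_nonneg _)
    ((hf.2.1.sub (hf.1 ε)).integrable_sq.const_mul _) (ae_of_all _ fun z => ?_)
  simp only [← mul_sub, mul_pow]
  exact mul_le_mul_of_nonneg_right (hC2 z) (sq_nonneg _)

lemma TendstoL2.tendsto_integral_abs_mul_sub {f k : ℝ → Ω → ℝ} {f₀ k₀ : Ω → ℝ}
    (hf : TendstoL2 P f f₀) (hk : TendstoL2 P k k₀) :
    Tendsto (fun ε => ∫ z, |f ε z * k ε z - f₀ z * k₀ z| ∂P) (𝓝[≠] 0) (𝓝 0) := by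
  have hlim : Tendsto (fun ε => √(∫ z, (f₀ z - f ε z) ^ 2 ∂P) * √(∫ z, (k₀ z - k ε z) ^ 2 ∂P)
      + √(∫ z, (f₀ z - f ε z) ^ 2 ∂P) * √(∫ z, k₀ z ^ 2 ∂P)
      + √(∫ z, f₀ z ^ 2 ∂P) * √(∫ z, (k₀ z - k ε z) ^ 2 ∂P)) (𝓝[≠] 0) (𝓝 0) := by
    have := ((hf.2.2.sqrt.mul hk.2.2.sqrt).add (hf.2.2.sqrt.mul_const (√(∫ z, k₀ z ^ 2 ∂P)))).add
      (hk.2.2.sqrt.const_mul (√(∫ z, f₀ z ^ 2 ∂P)))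
    simpa using this
  refine squeeze_zero (fun ε => integral_nonneg fun z => abs_nonneg _) (fun ε => ?_) hlim
  have hfd : MemLp (fun z => f₀ z - f ε z) 2 P := hf.2.1.sub (hf.1 ε)
  have hkd : MemLp (fun z => k₀ z - k ε z) 2 P := hk.2.1.sub (hk.1 ε)
  have i1 : Integrable (fun z => |(f₀ z - f ε z) * (k₀ z - k ε z)|) P :=
    (hfd.integrable_mul hkd).norm
  have i2 : Integrable (fun z => |(f₀ z - f ε z) * k₀ z|) P := (hfd.integrable_mul hk.2.1).norm
  have i3 : Integrable (fun z => |f₀ z * (k₀ z - k ε z)|) P := (hf.2.1.integrable_mul hkd).norm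
  refine le_trans ?_ (add_le_add (add_le_add (integral_abs_mul_le_sqrt hfd hkd)
    (integral_abs_mul_le_sqrt hfd hk.2.1)) (integral_abs_mul_le_sqrt hf.2.1 hkd))
  have i12 : Integrable (fun z => |(f₀ z - f ε z) * (k₀ z - k ε z)| + |(f₀ z - f ε z) * k₀ z|) P :=
    i1.add i2
  rw [← integral_add i1 i2, ← integral_add i12 i3]
  refine integral_mono_of_nonneg (ae_of_all _ fun z => abs_nonneg _) (i12.add i3)
    (ae_of_all _ fun z => ?_)
  have : f ε z * k ε z - f₀ z * k₀ z = (f₀ z - f ε z) * (k₀ z - k ε z)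
      - (f₀ z - f ε z) * k₀ z - f₀ z * (k₀ z - k ε z) := by ring
  simp only
  rw [this]
  exact (abs_sub _ _).trans (add_le_add_left (abs_sub _ _) _)

end MeanSquare

/-! ### Convergence and moments of the truncated influence function -/

section Influence

variable {d : ℕ} {P : Measure (Obs d)} [IsProbabilityMeasure P] {δ M C : ℝ}

lemma tendstoL2_truncOutcome (hY : MemLp outcome 4 P) :
    TendstoL2 P (fun ε => truncOutcome (truncLevel ε)) outcome := by
  refine ⟨fun ε => memLp_truncOutcome (truncLevel_nonneg ε) 2, memLp_outcome_two hY, ?_⟩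
  have h1 := (tendsto_sqrt_div_of_tendsto_div_sq (tendsto_measureReal_truncEvent_div_sq hY)).mul
    tendsto_abs_nhdsNE_nhds_zero
  rw [zero_mul] at h1
  have h2 : Tendsto (fun ε => √(P.real (truncEvent d (truncLevel ε)))) (𝓝[≠] 0) (𝓝 0) := by
    refine h1.congr' ?_
    filter_upwards [self_mem_nhdsWithin] with ε hε
    exact div_mul_cancel₀ _ (abs_ne_zero.2 hε)
  refine squeeze_zero (fun ε => integral_nonneg fun z => sq_nonneg _)
    (fun ε => integral_outcome_sub_truncOutcome_sq_le (truncLevel_nonneg ε) hY)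
    (by simpa using h2.const_mul (√(∫ z, outcome z ^ 4 ∂P)))

lemma PositivityWith.tendstoL2_truncOutReg (h : PositivityWith δ P) (hδ : 0 < δ)
    (hY : MemLp outcome 4 P) (a : Fin 2) (S : Finset (Fin d)) :
    TendstoL2 P (fun ε => truncOutReg (truncLevel ε) P a S) (outReg P a S) :=
  ⟨fun ε => memLp_truncOutReg P (truncLevel_nonneg ε) P a S 2,
    h.memLp_regr hδ a S one_le_two (memLp_outcome_two hY),
    squeeze_zero (fun ε => integral_nonneg fun z => sq_nonneg _)
      (fun ε => h.integral_outReg_sub_truncOutReg_sq_le hδ (truncLevel_nonneg ε)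
        (memLp_outcome_two hY) a S)
      (by simpa using (tendstoL2_truncOutcome hY).2.2.div_const δ)⟩

lemma PositivityWith.tendstoL2_truncCrossReg (h : PositivityWith δ P) (hδ : 0 < δ)
    (hY : MemLp outcome 4 P) (a : Fin 2) (S : Finset (Fin d)) :
    TendstoL2 P (fun ε => truncCrossReg (truncLevel ε) P a S) (crossReg P a S) :=
  ⟨fun ε => memLp_truncCrossReg P (truncLevel_nonneg ε) P a S 2,
    h.memLp_regr hδ _ S one_le_two (h.memLp_regr hδ a ∅ one_le_two (memLp_outcome_two hY)),
    squeeze_zero (fun ε => integral_nonneg fun z => sq_nonneg _)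
      (fun ε => h.integral_crossReg_sub_truncCrossReg_sq_le hδ (truncLevel_nonneg ε)
        (memLp_outcome_two hY) a S)
      (by simpa using ((tendstoL2_truncOutcome hY).2.2.div_const δ).div_const δ)⟩

/-- The cofactor of `outGap` in the influence function. -/
def gapCofactor (δ : ℝ) (P : Measure (Obs d)) (a : Fin 2) (S : Finset (Fin d))
    (y μS μX c : Obs d → ℝ) (z : Obs d) : ℝ :=
  μS z - c z - (2 * (expInd (1 - a) z / clippedPropScore δ P (1 - a) S z) * (μX z - c z)
    - (2 * (expInd a z / clippedPropScore δ P a S z) * (y z - μS z)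
      - 2 * (expInd a z / clippedPropScore δ P a ∅ z * (clippedPropScore δ P (1 - a) ∅ z
        / clippedPropScore δ P (1 - a) S z)) * (y z - μX z)))

/-- Both factors are linear in the outcome and the regressions, with bounded weights that do not
depend on the truncation level. Mean square convergence of the ingredients therefore gives `L¹`
convergence of the product. -/
lemma truncInfluence_eq (δ M : ℝ) (P : Measure (Obs d)) (a : Fin 2) (S : Finset (Fin d))
    (z : Obs d) : truncInfluence δ M P a S z = truncGap M P a S z *
      gapCofactor δ P a S (truncOutcome M) (truncOutReg M P a S) (truncOutReg M P a ∅)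
        (truncCrossReg M P a S) z := by
  simp only [truncInfluence, truncGap, gapCofactor]; ring

lemma PositivityWith.lambdaEIF_ae_eq (h : PositivityWith δ P) (a : Fin 2) (S : Finset (Fin d)) :
    lambdaEIF a S P =ᵐ[P] fun z => outGap P a S z *
      gapCofactor δ P a S outcome (outReg P a S) (outReg P a ∅) (crossReg P a S) z := by
  filter_upwards [h.clippedPropScore_ae_eq a S, h.clippedPropScore_ae_eq a ∅,
    h.clippedPropScore_ae_eq (1 - a) S, h.clippedPropScore_ae_eq (1 - a) ∅] with z h1 h2 h3 h4
  simp only [lambdaEIF, gapCofactor, h1, h2, h3, h4, outGap]; ring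

lemma abs_armWeight_le (hδ : 0 < δ) (hδ1 : δ ≤ 1) (P : Measure (Obs d)) (b c : Fin 2)
    (S : Finset (Fin d)) (z : Obs d) :
    |2 * (expInd b z / clippedPropScore δ P c S z)| ≤ 2 * (1 / δ) := by
  rw [abs_mul, abs_two]
  exact mul_le_mul_of_nonneg_left (bdd_div_clippedPropScore hδ hδ1 (abs_expInd_le_one b) P c S z)
    zero_le_two

lemma measurable_armWeight (P : Measure (Obs d)) (b c : Fin 2) (S : Finset (Fin d)) :
    Measurable fun z => 2 * (expInd b z / clippedPropScore δ P c S z) :=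
  ((measurable_expInd b).div (measurable_clippedPropScore δ P c S).of_covSigma).const_mul 2

lemma abs_ratioWeight_le (hδ : 0 < δ) (hδ1 : δ ≤ 1) (P : Measure (Obs d)) (a : Fin 2)
    (S : Finset (Fin d)) (z : Obs d) :
    |2 * (expInd a z / clippedPropScore δ P a ∅ z * (clippedPropScore δ P (1 - a) ∅ z
        / clippedPropScore δ P (1 - a) S z))| ≤ 2 * (1 / δ * (1 / δ)) := by
  rw [abs_mul, abs_two, abs_mul]
  exact mul_le_mul_of_nonneg_left (mul_le_mul
    (bdd_div_clippedPropScore hδ hδ1 (abs_expInd_le_one a) P a ∅ z)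
    (bdd_div_clippedPropScore hδ hδ1 (abs_clippedPropScore_le_one P hδ.le hδ1 (1 - a) ∅) P _ S z)
    (abs_nonneg _) (by positivity)) zero_le_two

lemma measurable_ratioWeight (P : Measure (Obs d)) (a : Fin 2) (S : Finset (Fin d)) :
    Measurable fun z => 2 * (expInd a z / clippedPropScore δ P a ∅ z
      * (clippedPropScore δ P (1 - a) ∅ z / clippedPropScore δ P (1 - a) S z)) :=
  (((measurable_expInd a).div (measurable_clippedPropScore δ P a ∅).of_covSigma).mul
    ((measurable_clippedPropScore δ P (1 - a) ∅).of_covSigma.div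
      (measurable_clippedPropScore δ P (1 - a) S).of_covSigma)).const_mul 2

lemma PositivityWith.tendsto_integral_abs_truncInfluence_sub (h : PositivityWith δ P) (hδ : 0 < δ)
    (hY : MemLp outcome 4 P) (a : Fin 2) (S : Finset (Fin d)) :
    Tendsto (fun ε => ∫ z, |truncInfluence δ (truncLevel ε) P a S z - lambdaEIF a S P z| ∂P)
      (𝓝[≠] 0) (𝓝 0) := by
  have hδ1 := h.le_one
  have hy := tendstoL2_truncOutcome hY
  have hS := h.tendstoL2_truncOutReg hδ hY a S
  have hX := h.tendstoL2_truncOutReg hδ hY a ∅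
  have hc := h.tendstoL2_truncCrossReg hδ hY a S
  have hV := (hS.sub hc).sub ((((hX.sub hc).bdd_mul (measurable_armWeight P (1 - a) (1 - a) S)
    (abs_armWeight_le hδ hδ1 P _ _ S))).sub (((hy.sub hS).bdd_mul (measurable_armWeight P a a S)
    (abs_armWeight_le hδ hδ1 P a a S)).sub ((hy.sub hX).bdd_mul (measurable_ratioWeight P a S)
    (abs_ratioWeight_le hδ hδ1 P a S))))
  refine ((hS.sub hc).tendsto_integral_abs_mul_sub hV).congr fun ε => integral_congr_ae ?_
  filter_upwards [h.lambdaEIF_ae_eq a S] with z hz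
  rw [hz, truncInfluence_eq]
  rfl

lemma memLp_mul_of_memLp_four {P : Measure (Obs d)} {u v : Obs d → ℝ} (hu : MemLp u 4 P)
    (hv : MemLp v 4 P) : MemLp (fun z => u z * v z) 2 P := by
  refine ((memLp_sq_of_memLp_four hu).add (memLp_sq_of_memLp_four hv)).mono (hu.1.mul hv.1)
    (ae_of_all _ fun z => ?_)
  simp only [Pi.add_apply, Real.norm_eq_abs]
  rw [abs_mul, abs_of_nonneg (by positivity : (0 : ℝ) ≤ u z ^ 2 + v z ^ 2), ← sq_abs (u z),
    ← sq_abs (v z)]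
  nlinarith [sq_nonneg (|u z| - |v z|), sq_nonneg (|u z|), sq_nonneg (|v z|)]

/-- Four moments of `Y` are used here: the gap and its cofactor lie in `L⁴`, so their product lies
in `L²`. -/
lemma PositivityWith.memLp_lambdaEIF (h : PositivityWith δ P) (hδ : 0 < δ)
    (hY : MemLp outcome 4 P) (a : Fin 2) (S : Finset (Fin d)) : MemLp (lambdaEIF a S P) 2 P := by
  have hδ1 := h.le_one
  have h14 : (1 : ℝ≥0∞) ≤ 4 := by norm_num
  have hS : MemLp (outReg P a S) 4 P := h.memLp_regr hδ a S h14 hY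
  have hX : MemLp (outReg P a ∅) 4 P := h.memLp_regr hδ a ∅ h14 hY
  have hc : MemLp (crossReg P a S) 4 P := h.memLp_regr hδ _ S h14 hX
  refine MemLp.ae_eq (h.lambdaEIF_ae_eq a S).symm (memLp_mul_of_memLp_four (hS.sub hc) ?_)
  exact (hS.sub hc).sub ((memLp_mul_of_bdd (hX.sub hc) (measurable_armWeight P (1 - a) (1 - a) S)
    (abs_armWeight_le hδ hδ1 P _ _ S)).sub ((memLp_mul_of_bdd (hY.sub hS)
    (measurable_armWeight P a a S) (abs_armWeight_le hδ hδ1 P a a S)).sub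
    (memLp_mul_of_bdd (hY.sub hX) (measurable_ratioWeight P a S)
    (abs_ratioWeight_le hδ hδ1 P a S))))

/-- Gap times cofactor is at most `10 δ⁻²` times a sum of four squares. Squaring that sum costs a
further factor `4`, hence `400`. -/
lemma truncInfluence_sq_le (hδ : 0 < δ) (hδ1 : δ ≤ 1) (M : ℝ) (P : Measure (Obs d)) (a : Fin 2)
    (S : Finset (Fin d)) (z : Obs d) :
    truncInfluence δ M P a S z ^ 2 ≤ 400 * (1 / δ * (1 / δ)) ^ 2 * (truncOutcome M z ^ 4
      + truncOutReg M P a S z ^ 4 + truncOutReg M P a ∅ z ^ 4 + truncCrossReg M P a S z ^ 4) := by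
  rw [truncInfluence_eq]
  have w1 := abs_armWeight_le hδ hδ1 P (1 - a) (1 - a) S z
  have w2 := abs_armWeight_le hδ hδ1 P a a S z
  have w3 := abs_ratioWeight_le hδ hδ1 P a S z
  simp only [truncGap, gapCofactor]
  set y := truncOutcome M z
  set s := truncOutReg M P a S z
  set x := truncOutReg M P a ∅ z
  set c := truncCrossReg M P a S z
  set W1 := 2 * (expInd (1 - a) z / clippedPropScore δ P (1 - a) S z)
  set W2 := 2 * (expInd a z / clippedPropScore δ P a S z)
  set W3 := 2 * (expInd a z / clippedPropScore δ P a ∅ z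
    * (clippedPropScore δ P (1 - a) ∅ z / clippedPropScore δ P (1 - a) S z))
  have hκ : 1 ≤ 1 / δ := by rw [le_div_iff₀ hδ]; linarith
  set κ := 1 / δ * (1 / δ) with hκ'
  have hκ1 : 1 / δ ≤ κ := by rw [hκ']; nlinarith
  have hκ0 : 1 ≤ κ := hκ.trans hκ1
  have h1 : |s - c - (W1 * (x - c) - (W2 * (y - s) - W3 * (y - x)))|
      ≤ κ * (4 * |y| + 3 * |s| + 4 * |x| + 3 * |c|) := by
    have e1 : |W1 * (x - c)| ≤ 2 * κ * (|x| + |c|) := by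
      rw [abs_mul]; exact mul_le_mul (w1.trans (by linarith)) (abs_sub _ _) (abs_nonneg _)
        (by linarith)
    have e2 : |W2 * (y - s)| ≤ 2 * κ * (|y| + |s|) := by
      rw [abs_mul]; exact mul_le_mul (w2.trans (by linarith)) (abs_sub _ _) (abs_nonneg _)
        (by linarith)
    have e3 : |W3 * (y - x)| ≤ 2 * κ * (|y| + |x|) := by
      rw [abs_mul]; exact mul_le_mul w3 (abs_sub _ _) (abs_nonneg _) (by linarith)
    have e4 : |s - c| ≤ κ * (|s| + |c|) := (abs_sub _ _).trans
      (le_mul_of_one_le_left (by positivity) hκ0)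
    have e5 := abs_sub (s - c) (W1 * (x - c) - (W2 * (y - s) - W3 * (y - x)))
    have e6 := abs_sub (W1 * (x - c)) (W2 * (y - s) - W3 * (y - x))
    have e7 := abs_sub (W2 * (y - s)) (W3 * (y - x))
    linarith
  have h2 : |(s - c) * (s - c - (W1 * (x - c) - (W2 * (y - s) - W3 * (y - x))))|
      ≤ κ * (10 * (y ^ 2 + s ^ 2 + x ^ 2 + c ^ 2)) := by
    rw [abs_mul]
    refine (mul_le_mul (abs_sub _ _) h1 (abs_nonneg _) (by positivity)).trans ?_
    rw [mul_left_comm]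
    refine mul_le_mul_of_nonneg_left ?_ (by linarith)
    rw [← sq_abs y, ← sq_abs s, ← sq_abs x, ← sq_abs c]
    nlinarith [sq_nonneg (|s| - |c|), sq_nonneg (|s| - |y|), sq_nonneg (|s| - |x|),
      sq_nonneg (|c| - |y|), sq_nonneg (|c| - |x|), sq_nonneg (|y|), sq_nonneg (|x|)]
  rw [← sq_abs]
  refine (pow_le_pow_left₀ (abs_nonneg _) h2 2).trans ?_
  rw [mul_pow, mul_comm (400 : ℝ), mul_assoc]
  refine mul_le_mul_of_nonneg_left ?_ (sq_nonneg _)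
  nlinarith [sq_nonneg (y ^ 2 - s ^ 2), sq_nonneg (y ^ 2 - x ^ 2), sq_nonneg (y ^ 2 - c ^ 2),
    sq_nonneg (s ^ 2 - x ^ 2), sq_nonneg (s ^ 2 - c ^ 2), sq_nonneg (x ^ 2 - c ^ 2)]

lemma integral_truncInfluence_sq_le (hδ : 0 < δ) (hδ1 : δ ≤ 1) (hM : 0 ≤ M)
    {P' : Measure (Obs d)} (a : Fin 2) (S : Finset (Fin d))
    (h1 : ∫ z, truncOutcome M z ^ 4 ∂P ≤ C) (h2 : ∫ z, truncOutReg M P' a S z ^ 4 ∂P ≤ C)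
    (h3 : ∫ z, truncOutReg M P' a ∅ z ^ 4 ∂P ≤ C)
    (h4 : ∫ z, truncCrossReg M P' a S z ^ 4 ∂P ≤ C) :
    ∫ z, truncInfluence δ M P' a S z ^ 2 ∂P ≤ 400 * (1 / δ * (1 / δ)) ^ 2 * (4 * C) := by
  have i1 : Integrable (fun z => truncOutcome M z ^ 4) P :=
    ((bdd_truncOutcome hM).pow 4).integrable ((measurable_truncOutcome M).pow_const 4)
  have i2 : ∀ T, Integrable (fun z => truncOutReg M P' a T z ^ 4) P := fun T =>
    ((bdd_clippedRegr hM P' a T (truncOutcome M)).pow 4).integrable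
      ((measurable_truncOutReg M P' a T).of_covSigma.pow_const 4)
  have i3 : Integrable (fun z => truncCrossReg M P' a S z ^ 4) P :=
    ((bdd_clippedRegr hM P' (1 - a) S (truncOutReg M P' a ∅)).pow 4).integrable
      ((measurable_truncCrossReg M P' a S).of_covSigma.pow_const 4)
  have i12 : Integrable (fun z => truncOutcome M z ^ 4 + truncOutReg M P' a S z ^ 4) P :=
    i1.add (i2 S)
  have i123 : Integrable (fun z => truncOutcome M z ^ 4 + truncOutReg M P' a S z ^ 4
    + truncOutReg M P' a ∅ z ^ 4) P := i12.add (i2 ∅)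
  refine (integral_mono_of_nonneg (ae_of_all _ fun z => sq_nonneg _) ((i123.add i3).const_mul _)
    (ae_of_all _ (truncInfluence_sq_le hδ hδ1 M P' a S))).trans ?_
  simp only [Pi.add_apply]
  rw [integral_const_mul]
  refine mul_le_mul_of_nonneg_left ?_ (by positivity)
  rw [integral_add i123 i3, integral_add i12 (i2 ∅), integral_add i1 (i2 S)]
  linarith

end Influence

/-! ### The remainder along a submodel -/

section Remainder

lemma abs_sub_div_mul_le {δ p q k : ℝ} (hδ : 0 < δ) (hq : δ ≤ q) :
    |(p - q) / q * k| ≤ 1 / δ * (|q - p| * |k|) := by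
  have hq0 : 0 < q := hδ.trans_le hq
  rw [abs_mul, abs_div, abs_of_pos hq0, abs_sub_comm p q, ← mul_assoc, div_eq_mul_one_div,
    mul_comm |q - p|]
  gcongr

lemma abs_div_sub_div_le {δ p q p' q' : ℝ} (hδ : 0 < δ) (hq : δ ≤ q) (hq' : δ ≤ q') (hp' : |p'| ≤ 1)
    (hδ1 : δ ≤ 1) :
    |p / q - p' / q'| ≤ 1 / δ * (1 / δ) * (|p - p'| + |q - q'|) := by
  have hq0 : 0 < q := hδ.trans_le hq
  have hq0' : 0 < q' := hδ.trans_le hq'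
  have hκ : 1 ≤ 1 / δ := by rw [le_div_iff₀ hδ]; linarith
  have e : p / q - p' / q' = (p - p') * (1 / q) - (q - q') * (1 / q) * (p' / q') := by
    field_simp; ring
  have h1 : |1 / q| ≤ 1 / δ := abs_div_le_of_bounds hδ (by simp) hq
  have h2 : |p' / q'| ≤ 1 / δ := abs_div_le_of_bounds hδ hp' hq'
  rw [e, mul_add]
  refine (abs_sub _ _).trans (add_le_add ?_ ?_)
  · rw [abs_mul, mul_comm]
    refine mul_le_mul_of_nonneg_right (h1.trans ?_) (abs_nonneg _)
    nlinarith
  · rw [abs_mul, abs_mul, mul_assoc, mul_comm]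
    exact mul_le_mul_of_nonneg_right (mul_le_mul h1 h2 (abs_nonneg _) (by positivity))
      (abs_nonneg _)

lemma sum_mul_le_mul_sum {u₁ u₂ u₃ u₄ k₁ k₂ k₃ : ℝ} (hu₁ : 0 ≤ u₁) (hu₂ : 0 ≤ u₂) (hu₃ : 0 ≤ u₃)
    (hu₄ : 0 ≤ u₄) (hk₁ : 0 ≤ k₁) (hk₂ : 0 ≤ k₂) (hk₃ : 0 ≤ k₃) :
    u₁ * k₁ + u₂ * k₂ + u₃ * k₃ + (u₄ + u₃) * k₂ ≤ (u₁ + u₂ + u₃ + u₄) * (k₁ + k₂ + k₃) := by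
  have h : 0 ≤ u₁ * k₂ + u₁ * k₃ + u₂ * k₁ + u₂ * k₃ + u₃ * k₁ + u₄ * k₁ + u₄ * k₃ := by positivity
  linarith

lemma sub_sub_sq_le (x y v w : ℝ) :
    (x - v - w) ^ 2 ≤ 3 * (|x| + |y| + |v|) ^ 2 + 3 * w ^ 2 := by
  have h1 : x ^ 2 + v ^ 2 ≤ (|x| + |y| + |v|) ^ 2 := by
    rw [← sq_abs x, ← sq_abs v]
    have : 0 ≤ |y| ^ 2 + 2 * |x| * |y| + 2 * |x| * |v| + 2 * |y| * |v| := by positivity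
    linarith
  have h2 : (x - v - w) ^ 2 ≤ 3 * (x ^ 2 + v ^ 2) + 3 * w ^ 2 := by
    linarith [sq_nonneg (x + v), sq_nonneg (x + w), sq_nonneg (v - w)]
  linarith

variable {d : ℕ} {P ρ : Measure (Obs d)} [IsProbabilityMeasure ρ] {δ M : ℝ}

/-- The total error of the propensity scores. -/
def propError (δ : ℝ) (P ρ : Measure (Obs d)) (a : Fin 2) (S : Finset (Fin d)) (z : Obs d) : ℝ :=
  |clippedPropScore δ P a S z - clippedPropScore δ ρ a S z|
    + |clippedPropScore δ P a ∅ z - clippedPropScore δ ρ a ∅ z|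
    + |clippedPropScore δ P (1 - a) S z - clippedPropScore δ ρ (1 - a) S z|
    + |clippedPropScore δ P (1 - a) ∅ z - clippedPropScore δ ρ (1 - a) ∅ z|

/-- The total error of the regressions. -/
def regrError (M : ℝ) (P ρ : Measure (Obs d)) (a : Fin 2) (S : Finset (Fin d)) (z : Obs d) : ℝ :=
  |truncOutReg M P a S z - truncOutReg M ρ a S z|
    + |truncOutReg M P a ∅ z - truncOutReg M ρ a ∅ z|
    + |truncCrossReg M P a S z - clippedRegr M ρ (1 - a) S (truncOutReg M P a ∅) z|

lemma abs_truncRemainder_le (hδ : 0 < δ) (hδ1 : δ ≤ 1) (M : ℝ) (P ρ : Measure (Obs d))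
    (a : Fin 2) (S : Finset (Fin d)) (z : Obs d) :
    |truncRemainder δ M P ρ a S z| ≤ 3 * regrError M P ρ a S z ^ 2
      + 3 * (clippedRegr M ρ (1 - a) S (truncOutReg M P a ∅) z - truncCrossReg M ρ a S z) ^ 2
      + 2 * (1 / δ * (1 / δ)) *
        |truncGap M P a S z * propError δ P ρ a S z * regrError M P ρ a S z| := by
  have hU0 : 0 ≤ propError δ P ρ a S z := by unfold propError; positivity
  have hK0 : 0 ≤ regrError M P ρ a S z := by unfold regrError; positivity
  have b2 : ∀ (T : Measure (Obs d)) b U, δ ≤ clippedPropScore δ T b U z := fun T b U =>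
    (clip_mem hδ1 _).1
  have b1 : ∀ (T : Measure (Obs d)) b U, |clippedPropScore δ T b U z| ≤ 1 := fun T b U =>
    abs_clippedPropScore_le_one T hδ.le hδ1 b U z
  rw [abs_mul, abs_mul, abs_of_nonneg hU0, abs_of_nonneg hK0]
  set kS := truncOutReg M P a S z - truncOutReg M ρ a S z with hkS
  set kX := truncOutReg M P a ∅ z - truncOutReg M ρ a ∅ z with hkX
  -- The error of the cross regression is split at the regression under `ρ` of the outcome
  -- regression of `P`. Then `ke` compares two laws for one function, which is a perturbation
  -- estimate, and `kc` compares two functions under one law, which is a contraction estimate.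
  set ke := truncCrossReg M P a S z - clippedRegr M ρ (1 - a) S (truncOutReg M P a ∅) z with hke
  set kc := clippedRegr M ρ (1 - a) S (truncOutReg M P a ∅) z - truncCrossReg M ρ a S z with hkc
  have hK : regrError M P ρ a S z = |kS| + |kX| + |ke| := rfl
  set K := regrError M P ρ a S z
  set U := propError δ P ρ a S z with hU
  set φ := truncGap M P a S z with hφ
  have t1 := abs_sub_div_mul_le (p := clippedPropScore δ ρ a S z) (k := -kS) hδ (b2 P a S)
  have t2 := abs_sub_div_mul_le (p := clippedPropScore δ ρ a ∅ z) (k := -kX) hδ (b2 P a ∅)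
  have t3 := abs_sub_div_mul_le (p := clippedPropScore δ ρ (1 - a) S z) (k := -ke) hδ
    (b2 P (1 - a) S)
  have t4 := abs_div_sub_div_le (p := clippedPropScore δ P (1 - a) ∅ z) hδ (b2 P (1 - a) S)
    (b2 ρ (1 - a) S) (b1 ρ (1 - a) ∅) hδ1
  have t5 := bdd_div_clippedPropScore hδ hδ1 (abs_clippedPropScore_le_one P hδ.le hδ1 (1 - a) ∅) P
    (1 - a) S z
  rw [abs_neg] at t1 t2 t3
  have e1 : truncRemainder δ M P ρ a S z = -(kS - ke - kc) ^ 2 + 2 * (φ *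
      ((clippedPropScore δ ρ a S z - clippedPropScore δ P a S z) / clippedPropScore δ P a S z * -kS
        - (clippedPropScore δ ρ a ∅ z - clippedPropScore δ P a ∅ z) / clippedPropScore δ P a ∅ z
          * -kX * (clippedPropScore δ P (1 - a) ∅ z / clippedPropScore δ P (1 - a) S z)
        - (clippedPropScore δ ρ (1 - a) S z - clippedPropScore δ P (1 - a) S z)
          / clippedPropScore δ P (1 - a) S z * -ke
        + kX * (clippedPropScore δ P (1 - a) ∅ z / clippedPropScore δ P (1 - a) S z
            - clippedPropScore δ ρ (1 - a) ∅ z / clippedPropScore δ ρ (1 - a) S z))) := by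
    simp only [truncRemainder, hkS, hkX, hke, hkc, hφ, truncGap]; ring
  rw [e1]
  set T1 := (clippedPropScore δ ρ a S z - clippedPropScore δ P a S z)
    / clippedPropScore δ P a S z * -kS
  set T2 := (clippedPropScore δ ρ a ∅ z - clippedPropScore δ P a ∅ z)
    / clippedPropScore δ P a ∅ z * -kX
  set T3 := (clippedPropScore δ ρ (1 - a) S z - clippedPropScore δ P (1 - a) S z)
    / clippedPropScore δ P (1 - a) S z * -ke
  set r := clippedPropScore δ P (1 - a) ∅ z / clippedPropScore δ P (1 - a) S z
  set r' := clippedPropScore δ ρ (1 - a) ∅ z / clippedPropScore δ ρ (1 - a) S z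
  set u1 := |clippedPropScore δ P a S z - clippedPropScore δ ρ a S z|
  set u2 := |clippedPropScore δ P a ∅ z - clippedPropScore δ ρ a ∅ z|
  set u3 := |clippedPropScore δ P (1 - a) S z - clippedPropScore δ ρ (1 - a) S z|
  set u4 := |clippedPropScore δ P (1 - a) ∅ z - clippedPropScore δ ρ (1 - a) ∅ z|
  have hUu : U = u1 + u2 + u3 + u4 := rfl
  have hu1 : 0 ≤ u1 := abs_nonneg _
  have hu2 : 0 ≤ u2 := abs_nonneg _
  have hu3 : 0 ≤ u3 := abs_nonneg _
  have hu4 : 0 ≤ u4 := abs_nonneg _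
  have hκ : 1 ≤ 1 / δ := by rw [le_div_iff₀ hδ]; linarith
  set κ := 1 / δ
  have hκκ : κ ≤ κ * κ := by nlinarith
  have hS0 := abs_nonneg kS
  have hX0 := abs_nonneg kX
  have he0 := abs_nonneg ke
  have s1 : |T1| ≤ κ * κ * (u1 * |kS|) := t1.trans (by gcongr)
  have s2 : |T2 * r| ≤ κ * κ * (u2 * |kX|) := by
    rw [abs_mul]
    refine (mul_le_mul t2 t5 (abs_nonneg _) (by positivity)).trans (le_of_eq (by ring))
  have s3 : |T3| ≤ κ * κ * (u3 * |ke|) := t3.trans (by gcongr)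
  have s4 : |kX * (r - r')| ≤ κ * κ * ((u4 + u3) * |kX|) := by
    rw [abs_mul]
    refine (mul_le_mul_of_nonneg_left t4 hX0).trans (le_of_eq (by ring))
  have s5 : |T1 - T2 * r - T3 + kX * (r - r')| ≤ κ * κ * (U * K) := by
    have a1 := abs_add_le (T1 - T2 * r - T3) (kX * (r - r'))
    have a2 := abs_sub (T1 - T2 * r) T3
    have a3 := abs_sub T1 (T2 * r)
    have a4 : u1 * |kS| + u2 * |kX| + u3 * |ke| + (u4 + u3) * |kX| ≤ U * K := by
      rw [hUu, hK]
      exact sum_mul_le_mul_sum hu1 hu2 hu3 hu4 hS0 hX0 he0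
    have a5 := mul_le_mul_of_nonneg_left a4 (by positivity : 0 ≤ κ * κ)
    linarith
  have s6 : (kS - ke - kc) ^ 2 ≤ 3 * K ^ 2 + 3 * kc ^ 2 := by
    rw [hK]
    exact sub_sub_sq_le kS kX ke kc
  refine (abs_add_le _ _).trans (add_le_add ?_ ?_)
  · rwa [abs_neg, abs_of_nonneg (sq_nonneg _)]
  · rw [abs_mul, abs_two, abs_mul]
    have := mul_le_mul_of_nonneg_left s5 (abs_nonneg φ)
    linarith

lemma Bdd.abs {Ω : Type*} {f : Ω → ℝ} (hf : Bdd f) : Bdd fun z => |f z| := by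
  obtain ⟨B, hB⟩ := hf
  exact ⟨B, fun z => by rw [abs_abs]; exact hB z⟩

lemma bdd_clippedPropScore (hδ : 0 < δ) (hδ1 : δ ≤ 1) (P : Measure (Obs d)) (b : Fin 2)
    (S : Finset (Fin d)) : Bdd (clippedPropScore δ P b S) :=
  ⟨1, abs_clippedPropScore_le_one P hδ.le hδ1 b S⟩

lemma measurable_propError (P ρ : Measure (Obs d)) (a : Fin 2) (S : Finset (Fin d)) :
    Measurable (propError δ P ρ a S) := by
  have h := fun (T : Measure (Obs d)) b U => (measurable_clippedPropScore δ T b U).of_covSigma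
  exact ((((h P a S).sub (h ρ a S)).abs.add ((h P a ∅).sub (h ρ a ∅)).abs).add
    ((h P (1 - a) S).sub (h ρ (1 - a) S)).abs).add ((h P (1 - a) ∅).sub (h ρ (1 - a) ∅)).abs

lemma bdd_propError (hδ : 0 < δ) (hδ1 : δ ≤ 1) (P ρ : Measure (Obs d)) (a : Fin 2)
    (S : Finset (Fin d)) : Bdd (propError δ P ρ a S) := by
  have h := fun (T : Measure (Obs d)) b U => bdd_clippedPropScore hδ hδ1 T b U
  exact ((((h P a S).sub (h ρ a S)).abs.add ((h P a ∅).sub (h ρ a ∅)).abs).add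
    ((h P (1 - a) S).sub (h ρ (1 - a) S)).abs).add ((h P (1 - a) ∅).sub (h ρ (1 - a) ∅)).abs

lemma measurable_regrError (M : ℝ) (P ρ : Measure (Obs d)) (a : Fin 2) (S : Finset (Fin d)) :
    Measurable (regrError M P ρ a S) := by
  have h := fun (T : Measure (Obs d)) U => (measurable_truncOutReg M T a U).of_covSigma
  exact (((h P S).sub (h ρ S)).abs.add ((h P ∅).sub (h ρ ∅)).abs).add
    ((measurable_truncCrossReg M P a S).of_covSigma.sub
      (measurable_clippedRegr M ρ (1 - a) S _).of_covSigma).abs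

lemma bdd_regrError (hM : 0 ≤ M) (P ρ : Measure (Obs d)) (a : Fin 2) (S : Finset (Fin d)) :
    Bdd (regrError M P ρ a S) := by
  have h := fun (T : Measure (Obs d)) b U f => bdd_clippedRegr hM T b U f
  exact (((h P a S _).sub (h ρ a S _)).abs.add ((h P a ∅ _).sub (h ρ a ∅ _)).abs).add
    ((h P _ S _).sub (h ρ (1 - a) S _)).abs

/-- Each error is at most `1`, so its fourth power is below its square; `(x + y + v + w)⁴ ≤ 64 (x⁴ +
y⁴ + v⁴ + w⁴)` and four terms bounded by `V` give `256`. -/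
lemma integral_propError_pow_four_le (hδ : 0 < δ) (hδ1 : δ ≤ 1) (P : Measure (Obs d)) (a : Fin 2)
    (S : Finset (Fin d)) {V : ℝ}
    (hV : ∀ b T, ∫ z, (clippedPropScore δ P b T z - clippedPropScore δ ρ b T z) ^ 2 ∂ρ ≤ V) :
    ∫ z, propError δ P ρ a S z ^ 4 ∂ρ ≤ 256 * V := by
  have i : ∀ b T, Integrable
      (fun z => (clippedPropScore δ P b T z - clippedPropScore δ ρ b T z) ^ 2) ρ := fun b T =>
    (((bdd_clippedPropScore hδ hδ1 P b T).sub (bdd_clippedPropScore hδ hδ1 ρ b T)).pow 2).integrable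
      (((measurable_clippedPropScore δ P b T).of_covSigma.sub
        (measurable_clippedPropScore δ ρ b T).of_covSigma).pow_const 2)
  have i2 := (i a S).add (i a ∅)
  have i3 := i2.add (i (1 - a) S)
  have hu : ∀ b T z, |clippedPropScore δ P b T z - clippedPropScore δ ρ b T z| ≤ 1 := fun b T z => by
    have h1 := clip_mem hδ1 (propScore P b T z)
    have h2 := clip_mem hδ1 (propScore ρ b T z)
    unfold clippedPropScore
    rw [abs_le]; constructor <;> linarith
  have hp : ∀ x : ℝ, |x| ≤ 1 → |x| ^ 4 ≤ x ^ 2 := fun x hx => by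
    rw [← sq_abs x]; exact pow_le_pow_of_le_one (abs_nonneg _) hx (by norm_num)
  refine (integral_mono_of_nonneg (ae_of_all _ fun z => by positivity)
    ((i3.add (i (1 - a) ∅)).const_mul 64) (ae_of_all _ fun z => ?_)).trans ?_
  · have h1 := hp _ (hu a S z)
    have h2 := hp _ (hu a ∅ z)
    have h3 := hp _ (hu (1 - a) S z)
    have h4 := hp _ (hu (1 - a) ∅ z)
    simp only [Pi.add_apply, propError]
    refine le_trans ?_ (mul_le_mul_of_nonneg_left
      (add_le_add (add_le_add (add_le_add h1 h2) h3) h4) (by norm_num))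
    set x := |clippedPropScore δ P a S z - clippedPropScore δ ρ a S z|
    set y := |clippedPropScore δ P a ∅ z - clippedPropScore δ ρ a ∅ z|
    set v := |clippedPropScore δ P (1 - a) S z - clippedPropScore δ ρ (1 - a) S z|
    set w := |clippedPropScore δ P (1 - a) ∅ z - clippedPropScore δ ρ (1 - a) ∅ z|
    have e1 : (x + y + v + w) ^ 2 ≤ 4 * (x ^ 2 + y ^ 2 + v ^ 2 + w ^ 2) := by
      nlinarith [sq_nonneg (x - y), sq_nonneg (x - v), sq_nonneg (x - w), sq_nonneg (y - v),
        sq_nonneg (y - w), sq_nonneg (v - w)]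
    have e2 := pow_le_pow_left₀ (sq_nonneg _) e1 2
    nlinarith [sq_nonneg (x ^ 2 - y ^ 2), sq_nonneg (x ^ 2 - v ^ 2), sq_nonneg (x ^ 2 - w ^ 2),
      sq_nonneg (y ^ 2 - v ^ 2), sq_nonneg (y ^ 2 - w ^ 2), sq_nonneg (v ^ 2 - w ^ 2)]
  · rw [integral_const_mul, integral_add' i3 (i _ _), integral_add' i2 (i _ _),
      integral_add' (i _ _) (i _ _)]
    linarith [hV a S, hV a ∅, hV (1 - a) S, hV (1 - a) ∅]

lemma integral_regrError_sq_le (hM : 0 ≤ M) (a : Fin 2) (S : Finset (Fin d)) :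
    ∫ z, regrError M P ρ a S z ^ 2 ∂ρ
      ≤ 3 * (∫ z, (truncOutReg M P a S z - truncOutReg M ρ a S z) ^ 2 ∂ρ
        + ∫ z, (truncOutReg M P a ∅ z - truncOutReg M ρ a ∅ z) ^ 2 ∂ρ
        + ∫ z, (truncCrossReg M P a S z
          - clippedRegr M ρ (1 - a) S (truncOutReg M P a ∅) z) ^ 2 ∂ρ) := by
  have i : ∀ T, Integrable (fun z => (truncOutReg M P a T z - truncOutReg M ρ a T z) ^ 2) ρ :=
    fun T => ((memLp_truncOutReg ρ hM P a T 2).sub (memLp_truncOutReg ρ hM ρ a T 2)).integrable_sq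
  have i' : Integrable (fun z => (truncCrossReg M P a S z
      - clippedRegr M ρ (1 - a) S (truncOutReg M P a ∅) z) ^ 2) ρ :=
    ((memLp_truncCrossReg ρ hM P a S 2).sub ((bdd_clippedRegr hM _ _ _ _).memLp
      (measurable_clippedRegr _ _ _ _ _).of_covSigma 2)).integrable_sq
  have i2 := (i S).add (i ∅)
  rw [← integral_add' (i S) (i ∅), ← integral_add' i2 i', ← integral_const_mul]
  refine integral_mono_of_nonneg (ae_of_all _ fun z => sq_nonneg _) ((i2.add i').const_mul 3)
    (ae_of_all _ fun z => ?_)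
  simp only [Pi.add_apply, regrError]
  rw [← sq_abs (truncOutReg M P a S z - _), ← sq_abs (truncOutReg M P a ∅ z - _),
    ← sq_abs (truncCrossReg M P a S z - _)]
  set x := |truncOutReg M P a S z - truncOutReg M ρ a S z|
  set y := |truncOutReg M P a ∅ z - truncOutReg M ρ a ∅ z|
  set v := |truncCrossReg M P a S z - clippedRegr M ρ (1 - a) S (truncOutReg M P a ∅) z|
  nlinarith [sq_nonneg (x - y), sq_nonneg (x - v), sq_nonneg (y - v)]

/-- Cauchy-Schwarz is used twice on the triple product: first to separate the regression error, then
to separate the gap from the propensity error at the level of fourth moments. -/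
lemma PositivityWith.abs_integral_truncRemainder_le (h : PositivityWith δ ρ) (hδ : 0 < δ)
    (hM : 0 ≤ M) (P : Measure (Obs d)) (a : Fin 2) (S : Finset (Fin d)) {F V : ℝ}
    (hF : ∫ z, truncGap M P a S z ^ 4 ∂ρ ≤ F)
    (hV : ∀ b T, ∫ z, (clippedPropScore δ P b T z - clippedPropScore δ ρ b T z) ^ 2 ∂ρ ≤ V) :
    |∫ z, truncRemainder δ M P ρ a S z ∂ρ| ≤ 3 * ∫ z, regrError M P ρ a S z ^ 2 ∂ρ
      + 3 * ((∫ z, (truncOutReg M P a ∅ z - truncOutReg M ρ a ∅ z) ^ 2 ∂ρ) / δ)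
      + 2 * (1 / δ * (1 / δ)) * (√(√F * √(256 * V)) * √(∫ z, regrError M P ρ a S z ^ 2 ∂ρ)) := by
  have hδ1 := h.le_one
  have hKb := bdd_regrError hM P ρ a S
  have hKm := measurable_regrError M P ρ a S
  have hUb := bdd_propError hδ hδ1 P ρ a S
  have hUm : Measurable (propError δ P ρ a S) := measurable_propError P ρ a S
  have hgb := bdd_truncGap hM P a S
  have hgm := measurable_truncGap M P a S
  have hcb := (bdd_clippedRegr hM ρ (1 - a) S (truncOutReg M P a ∅)).sub
    (bdd_clippedRegr hM ρ (1 - a) S (truncOutReg M ρ a ∅))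
  have hcm := (measurable_clippedRegr M ρ (1 - a) S (truncOutReg M P a ∅)).of_covSigma.sub
    (measurable_truncCrossReg M ρ a S).of_covSigma
  have i1 : Integrable (fun z => 3 * regrError M P ρ a S z ^ 2) ρ :=
    ((hKb.pow 2).integrable (hKm.pow_const 2)).const_mul 3
  have i2 : Integrable (fun z => 3 * (clippedRegr M ρ (1 - a) S (truncOutReg M P a ∅) z
      - truncCrossReg M ρ a S z) ^ 2) ρ :=
    ((hcb.pow 2).integrable (hcm.pow_const 2)).const_mul 3
  have i3 : Integrable (fun z => 2 * (1 / δ * (1 / δ)) *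
      |truncGap M P a S z * propError δ P ρ a S z * regrError M P ρ a S z|) ρ :=
    ((((hgb.mul hUb).mul hKb).abs).integrable ((hgm.mul hUm).mul hKm).abs).const_mul _
  have i12 : Integrable (fun z => 3 * regrError M P ρ a S z ^ 2
      + 3 * (clippedRegr M ρ (1 - a) S (truncOutReg M P a ∅) z
      - truncCrossReg M ρ a S z) ^ 2) ρ := i1.add i2
  refine abs_integral_le_integral_abs.trans ((integral_mono_of_nonneg
    (ae_of_all _ fun z => abs_nonneg _) (i12.add i3)
    (ae_of_all _ (abs_truncRemainder_le hδ hδ1 M P ρ a S))).trans ?_)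
  simp only [Pi.add_apply]
  rw [integral_add i12 i3, integral_add i1 i2, integral_const_mul, integral_const_mul,
    integral_const_mul]
  refine add_le_add (add_le_add le_rfl (mul_le_mul_of_nonneg_left ?_ (by norm_num)))
    (mul_le_mul_of_nonneg_left ?_ (by positivity))
  · refine le_trans (le_of_eq (integral_congr_ae ?_)) (h.integral_sub_regr_sq_le hδ (1 - a) S
      (memLp_truncOutReg ρ hM P a ∅ 2) (memLp_truncOutReg ρ hM ρ a ∅ 2))
    filter_upwards [h.clippedRegr_ae_eq hδ (1 - a) S (abs_clippedRegr_le hM P a ∅ (truncOutcome M)),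
      h.clippedRegr_ae_eq hδ (1 - a) S (abs_clippedRegr_le hM ρ a ∅ (truncOutcome M))]
      with z h1 h2
    simp only [truncCrossReg, truncOutReg, h1, h2]
  · refine (integral_abs_mul_le_sqrt ((hgb.mul hUb).memLp (hgm.mul hUm) 2)
      (hKb.memLp hKm 2)).trans ?_
    refine mul_le_mul_of_nonneg_right (Real.sqrt_le_sqrt ?_) (Real.sqrt_nonneg _)
    refine (integral_sq_mul_sq_le_sqrt ((hgb.pow 2).memLp (hgm.pow_const 2) 2)
      ((hUb.pow 2).memLp (hUm.pow_const 2) 2)).trans ?_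
    exact mul_le_mul (Real.sqrt_le_sqrt hF)
      (Real.sqrt_le_sqrt (integral_propError_pow_four_le hδ hδ1 P a S hV))
      (Real.sqrt_nonneg _) (Real.sqrt_nonneg _)

end Remainder

/-! ### The efficient influence function of `gapNormSq` -/

section GapInfluence

variable {d : ℕ} {P : Measure (Obs d)} {Q : ℝ → Measure (Obs d)} {g : Obs d → ℝ} {δ C : ℝ}

lemma LocallyRegular.exists_bounds (hQ : LocallyRegular Q) :
    ∃ δ C : ℝ, 0 < δ ∧ 0 ≤ C ∧ ∀ᶠ ε in 𝓝 (0 : ℝ), PositivityWith δ (Q ε) ∧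
      MemLp outcome 4 (Q ε) ∧ ∫ z, outcome z ^ 4 ∂(Q ε) ≤ C := by
  obtain ⟨δ, C, hδ, h⟩ := hQ
  exact ⟨δ, (C : ℝ) ^ 4, hδ, by positivity, h.mono fun ε hε =>
    ⟨hε.1, memLp_outcome_of_eLpNorm_le hε.2⟩⟩

/-- Bounds along the submodel, and at its base, for truncated nuisance functions. -/
structure SubmodelBounds (P : Measure (Obs d)) (Q : ℝ → Measure (Obs d)) (δ C : ℝ) : Prop where
  pos : 0 < δ
  nonneg : 0 ≤ C
  base : PositivityWith δ P ∧ MemLp outcome 4 P ∧ ∫ z, outcome z ^ 4 ∂P ≤ C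
  near : ∀ᶠ ε in 𝓝[≠] (0 : ℝ), PositivityWith δ (Q ε) ∧ MemLp outcome 4 (Q ε) ∧
    ∫ z, outcome z ^ 4 ∂(Q ε) ≤ C

lemma IsSmoothSubmodel.exists_submodelBounds (h : IsSmoothSubmodel P Q g)
    (hQ : LocallyRegular Q) : ∃ δ C, SubmodelBounds P Q δ C := by
  obtain ⟨δ, C, hδ, hC, hb⟩ := hQ.exists_bounds
  refine ⟨δ, C, hδ, hC, ?_, hb.filter_mono nhdsWithin_le_nhds⟩
  have := hb.self_of_nhds
  rwa [h.base] at this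

/-- Regressions of `P` need not be regressions under `Q ε`, so contraction bounds their moments
under `P` only. The bounds pass to `Q ε` because truncation keeps these functions below
`|ε|^(-1/2)`. -/
lemma SubmodelBounds.exists_pow_four_le (hb : SubmodelBounds P Q δ C)
    (h : IsSmoothSubmodel P Q g) (a : Fin 2) (S : Finset (Fin d)) :
    ∃ D, 0 ≤ D ∧ ∀ᶠ ε in 𝓝[≠] (0 : ℝ), ∀ ρ, ρ = P ∨ ρ = Q ε →
      ∫ z, truncOutcome (truncLevel ε) z ^ 4 ∂ρ ≤ D ∧
      ∫ z, truncOutReg (truncLevel ε) P a S z ^ 4 ∂ρ ≤ D ∧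
      ∫ z, truncOutReg (truncLevel ε) P a ∅ z ^ 4 ∂ρ ≤ D ∧
      ∫ z, truncCrossReg (truncLevel ε) P a S z ^ 4 ∂ρ ≤ D := by
  have := h.isProbabilityMeasure
  have := h.isProb
  obtain ⟨hδ, hC, ⟨hP, hY, hYC⟩, hnear⟩ := hb
  have h1 : 0 ≤ C / δ := by positivity
  have h2 : 0 ≤ C / δ / δ := by positivity
  obtain ⟨D, hD, hT⟩ := h.exists_integral_pow_four_le
    (C := C + C / δ + C / δ / δ) (by positivity)
  refine ⟨C + C / δ + C / δ / δ + D, by positivity, ?_⟩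
  filter_upwards [hT, hnear] with ε hT ⟨hQ, hYQ, hYQC⟩ ρ hρ
  have hM := truncLevel_nonneg ε
  have hR := fun T =>
    hP.integral_truncOutReg_pow_four_le hδ hM hY hYC a T
  have hc := hP.integral_truncCrossReg_pow_four_le hδ hM hY hYC a S
  have hRQ := fun T => (hT _ (measurable_truncOutReg (truncLevel ε) P a T).of_covSigma fun z =>
    sq_mul_abs_le_one_of_abs_le (abs_clippedRegr_le hM P a T _ z)).1 ((hR T).trans (by linarith))
  have hcQ := (hT _ (measurable_truncCrossReg (truncLevel ε) P a S).of_covSigma fun z =>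
    sq_mul_abs_le_one_of_abs_le (abs_clippedRegr_le hM P (1 - a) S _ z)).1 (hc.trans (by linarith))
  have hyP := (integral_truncOutcome_pow_four_le hM hY).trans hYC
  have hyQ := (integral_truncOutcome_pow_four_le hM hYQ).trans hYQC
  have hRS := hR S
  have hRX := hR ∅
  rcases hρ with rfl | rfl
  · refine ⟨?_, ?_, ?_, ?_⟩ <;> linarith
  · have h3 := hRQ S
    have h4 := hRQ ∅
    refine ⟨?_, ?_, ?_, ?_⟩ <;> linarith

lemma SubmodelBounds.l2Bounded_truncInfluence (hb : SubmodelBounds P Q δ C)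
    (h : IsSmoothSubmodel P Q g) (a : Fin 2) (S : Finset (Fin d)) :
    L2Bounded P Q fun ε => truncInfluence δ (truncLevel ε) P a S := by
  have := h.isProbabilityMeasure
  have := h.isProb
  obtain ⟨D, hD, hD4⟩ := hb.exists_pow_four_le h a S
  have hδ := hb.pos
  have hδ1 := hb.base.1.le_one
  refine ⟨400 * (1 / δ * (1 / δ)) ^ 2 * (4 * D), by positivity, ?_⟩
  filter_upwards [hD4] with ε hε
  have hM := truncLevel_nonneg ε
  have hm := measurable_truncInfluence δ (truncLevel ε) P a S
  have hbd := bdd_truncInfluence hδ hδ1 hM P a S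
  obtain ⟨p1, p2, p3, p4⟩ := hε P (Or.inl rfl)
  obtain ⟨q1, q2, q3, q4⟩ := hε (Q ε) (Or.inr rfl)
  exact ⟨hm, hbd.memLp hm 2, hbd.memLp hm 2,
    integral_truncInfluence_sq_le hδ hδ1 hM a S p1 p2 p3 p4,
    integral_truncInfluence_sq_le hδ hδ1 hM a S q1 q2 q3 q4⟩

lemma SubmodelBounds.tendsto_truncOutReg_sub (hb : SubmodelBounds P Q δ C)
    (h : IsSmoothSubmodel P Q g) (a : Fin 2) (S : Finset (Fin d)) :
    Tendsto (fun ε => (∫ z, (truncOutReg (truncLevel ε) P a S z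
      - truncOutReg (truncLevel ε) (Q ε) a S z) ^ 2 ∂(Q ε)) / ε) (𝓝[≠] 0) (𝓝 0) := by
  have := h.isProbabilityMeasure
  have := h.isProb
  obtain ⟨hδ, hC, ⟨hP, hY, hYC⟩, hnear⟩ := hb
  refine h.tendsto_regression_sub (covSigma_le S) (measurable_expInd a) (expInd_nonneg a)
    (expInd_le_one a) hδ hC (f := fun ε => truncOutcome (truncLevel ε)) ?_ ?_ ?_
  · filter_upwards [hnear] with ε ⟨hQ, hYQ, hYQC⟩
    have hM := truncLevel_nonneg ε
    exact ⟨measurable_truncOutcome _, fun z =>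
      sq_mul_abs_le_one_of_abs_le (abs_truncOutcome_le hM z),
      (integral_truncOutcome_pow_four_le hM hY).trans hYC,
      (integral_truncOutcome_pow_four_le hM hYQ).trans hYQC⟩
  · refine Eventually.of_forall fun ε => ⟨hP.weightPos a S, hP.isRegr_clippedRegr hδ a S
      (abs_truncOutcome_le (truncLevel_nonneg ε)) (measurable_truncOutcome _), fun z =>
      sq_mul_abs_le_one_of_abs_le (abs_clippedRegr_le (truncLevel_nonneg ε) _ _ _ _ z)⟩
  · filter_upwards [hnear] with ε ⟨hQ, hYQ, hYQC⟩
    exact ⟨hQ.weightPos a S, hQ.isRegr_clippedRegr hδ a S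
      (abs_truncOutcome_le (truncLevel_nonneg ε)) (measurable_truncOutcome _), fun z =>
      sq_mul_abs_le_one_of_abs_le (abs_clippedRegr_le (truncLevel_nonneg ε) _ _ _ _ z)⟩

lemma SubmodelBounds.tendsto_truncCrossReg_sub (hb : SubmodelBounds P Q δ C)
    (h : IsSmoothSubmodel P Q g) (a : Fin 2) (S : Finset (Fin d)) :
    Tendsto (fun ε => (∫ z, (truncCrossReg (truncLevel ε) P a S z - clippedRegr (truncLevel ε)
      (Q ε) (1 - a) S (truncOutReg (truncLevel ε) P a ∅) z) ^ 2 ∂(Q ε)) / ε)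
      (𝓝[≠] 0) (𝓝 0) := by
  have := h.isProbabilityMeasure
  have := h.isProb
  obtain ⟨D, hD, hD4⟩ := hb.exists_pow_four_le h a S
  obtain ⟨hδ, hC, ⟨hP, hY, hYC⟩, hnear⟩ := hb
  have hfb := fun ε => abs_clippedRegr_le (truncLevel_nonneg ε) P a ∅ (truncOutcome (truncLevel ε))
  have hfm := fun ε => (measurable_truncOutReg (truncLevel ε) P a ∅).of_covSigma
  refine h.tendsto_regression_sub (covSigma_le S) (measurable_expInd (1 - a))
    (expInd_nonneg (1 - a)) (expInd_le_one (1 - a)) hδ hD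
    (f := fun ε => truncOutReg (truncLevel ε) P a ∅) ?_ ?_ ?_
  · filter_upwards [hD4] with ε hε
    exact ⟨hfm ε, fun z => sq_mul_abs_le_one_of_abs_le (hfb ε z),
      (hε P (Or.inl rfl)).2.2.1, (hε (Q ε) (Or.inr rfl)).2.2.1⟩
  · exact Eventually.of_forall fun ε => ⟨hP.weightPos (1 - a) S,
      hP.isRegr_clippedRegr hδ (1 - a) S (hfb ε) (hfm ε), fun z =>
      sq_mul_abs_le_one_of_abs_le (abs_clippedRegr_le (truncLevel_nonneg ε) _ _ _ _ z)⟩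
  · filter_upwards [hnear] with ε ⟨hQ, hYQ, hYQC⟩
    exact ⟨hQ.weightPos (1 - a) S,
      hQ.isRegr_clippedRegr hδ (1 - a) S (hfb ε) (hfm ε), fun z =>
      sq_mul_abs_le_one_of_abs_le (abs_clippedRegr_le (truncLevel_nonneg ε) _ _ _ _ z)⟩

lemma SubmodelBounds.exists_clippedPropScore_sub_le (hb : SubmodelBounds P Q δ C)
    (h : IsSmoothSubmodel P Q g) : ∃ B : ℝ, 0 ≤ B ∧ ∀ᶠ ε in 𝓝[≠] (0 : ℝ), ∀ b T,
      ∫ z, (clippedPropScore δ P b T z - clippedPropScore δ (Q ε) b T z) ^ 2 ∂(Q ε)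
        ≤ B * ε ^ 2 := by
  have := h.isProbabilityMeasure
  have := h.isProb
  obtain ⟨hδ, hC, ⟨hP, hY, hYC⟩, hnear⟩ := hb
  have hδ1 := hP.le_one
  choose B hB hBε using fun (b : Fin 2) (T : Finset (Fin d)) =>
    h.exists_integral_regression_sub_sq_le (covSigma_le T) (measurable_expInd b)
      (expInd_nonneg b) (expInd_le_one b)
  refine ⟨∑ b, ∑ T, B b T, Finset.sum_nonneg fun b _ => Finset.sum_nonneg fun T _ => hB b T, ?_⟩
  filter_upwards [eventually_all.2 fun b => eventually_all.2 fun T => hBε b T, hnear]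
    with ε hε ⟨hQ, _⟩ b T
  have h1 : B b T ≤ ∑ b, ∑ T, B b T :=
    (Finset.single_le_sum (f := fun T => B b T) (fun T _ => hB b T) (Finset.mem_univ T)).trans
      (Finset.single_le_sum (f := fun b => ∑ T, B b T)
        (fun b _ => Finset.sum_nonneg fun T _ => hB b T) (Finset.mem_univ b))
  have h2 : ∀ (ρ : Measure (Obs d)) z, 0 ≤ clippedPropScore δ ρ b T z ∧
      clippedPropScore δ ρ b T z ≤ 1 := fun ρ z =>
    ⟨hδ.le.trans (clip_mem hδ1 _).1, (clip_mem hδ1 _).2⟩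
  exact (hε b T _ _ (hP.isRegr_clippedPropScore b T) (hQ.isRegr_clippedPropScore b T) (h2 P)
    (h2 (Q ε))).trans (mul_le_mul_of_nonneg_right h1 (sq_nonneg ε))

/-- Squared regression errors are `o(ε)`. In the product term, the gap times the propensity error
has norm `O(|ε|^(1/2))` and the regression error has norm `o(|ε|^(1/2))`. -/
lemma SubmodelBounds.tendsto_truncRemainder (hb : SubmodelBounds P Q δ C)
    (h : IsSmoothSubmodel P Q g) (a : Fin 2) (S : Finset (Fin d)) :
    Tendsto (fun ε => (∫ z, truncRemainder δ (truncLevel ε) P (Q ε) a S z ∂(Q ε)) / ε)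
      (𝓝[≠] 0) (𝓝 0) := by
  have := h.isProbabilityMeasure
  have := h.isProb
  obtain ⟨D, hD, hD4⟩ := hb.exists_pow_four_le h a S
  obtain ⟨B, hB, hBε⟩ := hb.exists_clippedPropScore_sub_le h
  have hX := hb.tendsto_truncOutReg_sub h a ∅
  set J : ℝ → ℝ := fun ε => ∫ z, regrError (truncLevel ε) P (Q ε) a S z ^ 2 ∂(Q ε) with hJ
  have hJ0 : ∀ ε, 0 ≤ J ε := fun ε => integral_nonneg fun z => sq_nonneg _
  have hX0 : ∀ ε, 0 ≤ ∫ z, (truncOutReg (truncLevel ε) P a ∅ z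
      - truncOutReg (truncLevel ε) (Q ε) a ∅ z) ^ 2 ∂(Q ε) :=
    fun ε => integral_nonneg fun z => sq_nonneg _
  have hXlim : Tendsto (fun ε => (∫ z, (truncOutReg (truncLevel ε) P a ∅ z
      - truncOutReg (truncLevel ε) (Q ε) a ∅ z) ^ 2 ∂(Q ε)) / |ε|) (𝓝[≠] 0) (𝓝 0) := by
    have := hX.abs
    rw [abs_zero] at this
    refine this.congr fun ε => ?_
    rw [abs_div, abs_of_nonneg (hX0 ε)]
  have hJlim : Tendsto (fun ε => J ε / |ε|) (𝓝[≠] 0) (𝓝 0) := by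
    have hlim := ((((hb.tendsto_truncOutReg_sub h a S).add hX).add
      (hb.tendsto_truncCrossReg_sub h a S)).const_mul 3).abs
    simp only [add_zero, mul_zero, abs_zero] at hlim
    refine squeeze_zero (fun ε => div_nonneg (hJ0 ε) (abs_nonneg _)) (fun ε => ?_) hlim
    rw [← add_div, ← add_div, mul_div_assoc', abs_div]
    exact div_le_div_of_nonneg_right ((integral_regrError_sq_le (truncLevel_nonneg ε) a S).trans
      (le_abs_self _)) (abs_nonneg _)
  have hbound : Tendsto (fun ε => 3 * (J ε / |ε|)
      + 3 * ((∫ z, (truncOutReg (truncLevel ε) P a ∅ z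
        - truncOutReg (truncLevel ε) (Q ε) a ∅ z) ^ 2 ∂(Q ε)) / |ε| / δ)
      + 2 * (1 / δ * (1 / δ)) * √(√(8 * D + 8 * D) * √(256 * B) * (J ε / |ε|)))
      (𝓝[≠] 0) (𝓝 0) := by
    have := ((hJlim.const_mul 3).add ((hXlim.div_const δ).const_mul 3)).add
      (((hJlim.const_mul (√(8 * D + 8 * D) * √(256 * B))).sqrt).const_mul (2 * (1 / δ * (1 / δ))))
    simpa using this
  refine squeeze_zero_norm' ?_ hbound
  filter_upwards [hb.near, hD4, hBε, self_mem_nhdsWithin] with ε hQ hD4 hBε hε0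
  have hε0 : 0 < |ε| := abs_pos.2 hε0
  have hM := truncLevel_nonneg ε
  obtain ⟨q1, q2, q3, q4⟩ := hD4 (Q ε) (Or.inr rfl)
  have hF : ∫ z, truncGap (truncLevel ε) P a S z ^ 4 ∂(Q ε) ≤ 8 * D + 8 * D := by
    refine (integral_sub_pow_four_le (((bdd_clippedRegr hM P a S _).pow 4).integrable
      ((measurable_truncOutReg _ P a S).of_covSigma.pow_const 4))
      (((bdd_clippedRegr hM P (1 - a) S _).pow 4).integrable
      ((measurable_truncCrossReg _ P a S).of_covSigma.pow_const 4))).trans ?_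
    exact add_le_add (mul_le_mul_of_nonneg_left q2 (by norm_num))
      (mul_le_mul_of_nonneg_left q4 (by norm_num))
  have key := hQ.1.abs_integral_truncRemainder_le hb.pos hM P a S hF hBε
  rw [Real.norm_eq_abs, abs_div, div_le_iff₀ hε0]
  refine key.trans (le_of_eq ?_)
  -- Each of the two factors yields `|ε|^(1/2)`: one from the fourth root of `ε²`, the other from
  -- normalising `J ε` by `|ε|`.
  have e1 : √(√(8 * D + 8 * D) * √(256 * (B * ε ^ 2))) * √(J ε)
      = √(√(8 * D + 8 * D) * √(256 * B) * (J ε / |ε|)) * |ε| := by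
    rw [← mul_assoc 256, Real.sqrt_mul (by positivity : (0 : ℝ) ≤ 256 * B), Real.sqrt_sq_eq_abs,
      ← Real.sqrt_mul (by positivity)]
    conv_rhs => rw [← Real.sqrt_sq hε0.le, ← Real.sqrt_mul (by have := hJ0 ε; positivity)]
    congr 1
    rw [Real.sqrt_sq hε0.le]
    field_simp
  change 3 * J ε + _ + _ * (_ * √(J ε)) = _
  rw [e1]
  field_simp

/-- The errors at `Q ε` and at `P` are each `o(ε)`: the truncation event has probability `o(ε²)`
under both laws, and the error is of the order of the root of that probability. -/
lemma SubmodelBounds.tendsto_truncation_error (hb : SubmodelBounds P Q δ C)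
    (h : IsSmoothSubmodel P Q g) (a : Fin 2) (S : Finset (Fin d)) :
    Tendsto (fun ε => ((gapNormSq a S (Q ε) - ∫ z, truncGap (truncLevel ε) (Q ε) a S z ^ 2 ∂(Q ε))
      - (gapNormSq a S P - ∫ z, truncGap (truncLevel ε) P a S z ^ 2 ∂P)) / ε)
      (𝓝[≠] 0) (𝓝 0) := by
  have := h.isProbabilityMeasure
  have := h.isProb
  obtain ⟨hδ, hC, ⟨hP, hY, hYC⟩, hnear⟩ := hb
  obtain ⟨A, hA⟩ := exists_abs_gapNormSq_sub_le (d := d) hδ C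
  have hPlim := tendsto_measureReal_truncEvent_div_sq hY
  have hQlim := h.tendsto_measureReal_div_sq (fun ε => measurableSet_truncEvent (truncLevel ε)) hPlim
  have hlim := ((tendsto_sqrt_div_of_tendsto_div_sq hQlim).const_mul A).add
    ((tendsto_sqrt_div_of_tendsto_div_sq hPlim).const_mul A)
  simp only [mul_zero, add_zero] at hlim
  refine squeeze_zero_norm' ?_ hlim
  filter_upwards [hnear] with ε ⟨hQ, hYQ, hYQC⟩
  have hM := truncLevel_nonneg ε
  rw [Real.norm_eq_abs, abs_div, ← mul_div_assoc, ← mul_div_assoc, ← add_div]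
  exact div_le_div_of_nonneg_right ((abs_sub _ _).trans
    (add_le_add (hA (Q ε) (h.isProb ε) hQ hYQ hYQC _ hM a S)
      (hA P h.isProbabilityMeasure hP hY hYC _ hM a S))) (abs_nonneg _)

/-- The increment of the functional is exactly the change in the expectation of the truncated
influence function of `P`, plus the difference of the truncation errors, minus the remainder; the
last two are `o(ε)`. -/
lemma IsSmoothSubmodel.hasDerivAt_gapNormSq (h : IsSmoothSubmodel P Q g) (hQ : LocallyRegular Q)
    (a : Fin 2) (S : Finset (Fin d)) :
    HasDerivAt (fun ε => gapNormSq a S (Q ε)) (∫ z, lambdaEIF a S P z * g z ∂P) 0 := by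
  have := h.isProbabilityMeasure
  have := h.isProb
  obtain ⟨δ, C, hb⟩ := h.exists_submodelBounds hQ
  have hδ := hb.pos
  obtain ⟨hP, hY, -⟩ := hb.base
  have hslope := h.tendsto_slope_integral (hb.l2Bounded_truncInfluence h a S)
    (hP.memLp_lambdaEIF hδ hY a S) (hP.tendsto_integral_abs_truncInfluence_sub hδ hY a S)
  have hrem := (hb.tendsto_truncation_error h a S).sub (hb.tendsto_truncRemainder h a S)
  simp only [← sub_div, sub_zero] at hrem
  refine hasDerivAt_zero_of_expansion ?_ hslope hrem
  filter_upwards [hb.near] with ε ⟨hQ, _⟩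
  have hM := truncLevel_nonneg ε
  have h1 := hQ.integral_truncInfluence hδ hM P a S
  have h2 := hP.integral_truncInfluence_self hδ hM a S
  rw [h.base, h1, h2]
  ring

lemma isUncenteredEIF_gapNormSq [IsProbabilityMeasure P] (hpos : Positivity P)
    (hY : MemLp outcome 4 P) (a : Fin 2) (S : Finset (Fin d)) :
    IsUncenteredEIF LocallyRegular (gapNormSq a S) P (lambdaEIF a S P) := by
  have hpos' := hpos
  obtain ⟨δ, hδ, hP⟩ := hpos
  exact isUncenteredEIF_of_pathwise
    (fun b N hm hN h0 => mem_scoreSet_locallyRegular hpos' hY hm hN h0)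
    (hP.memLp_lambdaEIF hδ hY a S) (hP.integral_lambdaEIF_self hδ a S (memLp_outcome_two hY))
    fun Q g hQ h => h.hasDerivAt_gapNormSq hQ a S

end GapInfluence

end

theorem mainTheorem8 {d : ℕ} (P : Measure (Obs d)) [IsProbabilityMeasure P]
    (hpos : Positivity P) (a : Fin 2) :
    -- `ξ_a` is the un-centered efficient influence function of `‖π_a(X)‖₂²`
    IsUncenteredEIF (fun _ => True) (propNormSq a) P (xiEIF a P) ∧
    -- with a second-order von Mises remainder
    (∀ P' : Measure (Obs d), IsProbabilityMeasure P' →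
      P.map Prod.fst ≪ P'.map Prod.fst →
      vonMisesRemainder (propNormSq a) (xiEIF a) P' P =
        -∫ z, (propScore P' a ∅ z - propScore P a ∅ z) ^ 2 ∂P) ∧
    ∀ S : Finset (Fin d),
      -- `λ_a(Z; S)` is the un-centered efficient influence function of
      -- `‖μ_a(X_{-S}) - E{μ_a(X) ∣ A = 1 - a, X_{-S}}‖₂²`
      (MemLp outcome 4 P →
        IsUncenteredEIF LocallyRegular (gapNormSq a S) P (lambdaEIF a S P)) ∧
      -- with a second-order von Mises remainder
      (∀ P' : Measure (Obs d), IsProbabilityMeasure P' → Positivity P' →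
        P.map Prod.fst ≪ P'.map Prod.fst →
        MemLp outcome 2 P → MemLp outcome 2 P' →
        MemLp (outReg P' a ∅) 2 P → MemLp (outReg P' a S) 2 P → MemLp (crossReg P' a S) 2 P →
        vonMisesRemainder (gapNormSq a S) (lambdaEIF a S) P' P =
          ∫ z, (-(outGap P' a S z - outGap P a S z) ^ 2 + 2 * errorProducts a S P' P z) ∂P) := by
  exact ⟨isUncenteredEIF_propNormSq a, fun P' _ hac => vonMisesRemainder_propNormSq a hac,
    fun S => ⟨fun hY => isUncenteredEIF_gapNormSq hpos hY a S,
      fun P' _ hpos' hac hY hY' hX hS hc =>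
        vonMisesRemainder_gapNormSq hpos hpos' hac a S hY hY' hX hS hc⟩⟩
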